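/- Let $A=\mathbb F_q[T]$, $Q=\mathbb F_q(T)$, let $K\supseteq Q$ be a field with a fixed algebraic closure $\bar K$, let $K^{\rm sep}\subset\bar K$ be the separable closure of $K$ and $G_K={\rm Gal}(K^{\rm sep}/K)$. Let $F\{\tau\}$ be the twisted polynomial ring over $F$, with $\tau c=c^q\tau$, and let $\partial:F\{\tau\}\to F$ be the constant coefficient. A Drinfeld $A$-module $\phi$ over $K^{\rm sep}$ is an $\mathbb F_q$-algebra homomorphism $\phi:A\to K^{\rm sep}\{\tau\}$, $a\mapsto\phi_a$, with $\partial(\phi_a)=a$ for all $a\in A$ and $\phi_a\neq a$ for some $a$; its rank is $\deg_\tau\phi_T$. An isogeny $\mu:\phi\to\psi$ is a non-zero $\mu\in\bar K\{\tau\}$ with $\mu\phi_a=\psi_a\mu$ for all $a\in A$; it is an isomorphism if $\mu\in\bar K^\times$, and $\mu,\eta$ are equivalent if $\eta=\lambda\mu\nu^{-1}$ for some isomorphisms $\lambda,\nu$. If $\operatorname{Ker}\mu\cong\bigoplus_i A/\mathfrak n_i$ as an $A$-module, then $\deg\mu=\prod_i\mathfrak n_i$; $\mu$ is an $\mathfrak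 n$-isogeny if $\deg\mu=\mathfrak n$. It is primitive if there is no isogeny $\eta:\phi\to\psi$ with $\deg\eta\mid\deg\mu$ and $\deg\eta\ne\deg\mu$. Let $\phi$ be a Drinfeld $A$-module of rank two over $K^{\rm sep}$ without complex multiplication (the fraction field of $\partial({\rm End}_{K^{\rm sep}}(\phi))$ is $Q$) that is virtually $K$-rational ($\phi$ is isogenous to its conjugate ${}^s\phi$ for every $s\in G_K$), and let $\mathfrak p\subset A$ be a non-zero prime ideal. Identify isomorphic Drinfeld modules. Let $I$ be the set of Drinfeld $A$-modules over $K^{\rm sep}$ isogenous to $\phi$, and let $I_{\mathfrak p}\subset I$ be the subset of those that admit a $\mathfrak p^n$-isogeny to $\phi$ for some $n\ge0$. For $\psi_1,\psi_2\in I$ let $\delta_{\mathfrak p}(\psi_1,\psi_2)$ be the largest $n$ such that $\mathfrak p^n$ divides the degree of a primitive isogeny $\psi_1\to\psi_2$; such isogenies exist, and $n$ does not depend on the choice of the primitive isogeny. For $\psi\in I$ let $\pi_{\mathfrak p}(\psi)\in I_{\mathfrak p}$ be the unique element such that every primitive isogeny $\mu:\phi\to\psi$ factors as $\mu=\eta\mu'$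 with a $\mathfrak p^{\delta_{\mathfrak p}(\phi,\psi)}$-isogeny $\mu':\phi\to\pi_{\mathfrak p}(\psi)$ and an isogeny $\eta:\pi_{\mathfrak p}(\psi)\to\psi$ of degree prime to $\mathfrak p$; this gives a well-defined surjection $\pi_{\mathfrak p}:I\to I_{\mathfrak p}$. Proposition. The graph with vertex set $I_{\mathfrak p}$ whose edges are the $\mathfrak p$-isogenies, up to equivalence, between the vertices is undirected (if there is a $\mathfrak p$-isogeny from $v$ to $w$, then there is one from $w$ to $v$), has no loops and no multiple edges, and is a regular tree of degree $\#(A/\mathfrak p)+1$. For all $\psi_1,\psi_2\in I$, the length of the path between $\pi_{\mathfrak p}(\psi_1)$ and $\pi_{\mathfrak p}(\psi_2)$ is equal to $\delta_{\mathfrak p}(\psi_1,\psi_2)$. -/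

import Mathlib

open Polynomial

noncomputable section

namespace Drinfeld

/-! ### The twisted polynomial ring -/

section Twisted

variable (Fq : Type*) [Field Fq] [Fintype Fq]
variable (F : Type*) [Field F] [Algebra (RatFunc Fq) F]

/-- The inclusion `𝔽_q → F` for a field `F` containing `Q = 𝔽_q(T)`. -/
def constHom : Fq →+* F := (algebraMap (RatFunc Fq) F).comp RatFunc.C

/-- The inclusion `A = 𝔽_q[T] → F` for a field `F` containing `Q = 𝔽_q(T)`. -/
def incl : Fq[X] →+* F := (algebraMap (RatFunc Fq) F).comp (algebraMap Fq[X] (RatFunc Fq))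

/-- The `q`-power Frobenius `x ↦ x ^ q` of `F`. -/
def qFrob : F →+* F :=
  letI : Algebra Fq F := (constHom Fq F).toAlgebra
  (FiniteField.frobeniusAlgHom Fq F).toRingHom

theorem qFrob_apply (x : F) : qFrob Fq F x = x ^ Fintype.card Fq := rfl

/-- The `q`-power Frobenius as an additive endomorphism. -/
def qFrobEnd : AddMonoid.End F := (qFrob Fq F).toAddMonoidHom

theorem qFrobEnd_pow_apply (n : ℕ) (x : F) :
    ((qFrobEnd Fq F) ^ n) x = x ^ (Fintype.card Fq) ^ n := by
  induction n with
  | zero => rw [pow_zero, pow_zero, pow_one]; rfl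
  | succ n ih => rw [pow_succ', pow_succ, pow_mul, ← ih]; rfl

theorem qFrob_pow_apply (n : ℕ) (x : F) :
    ((qFrob Fq F) ^ n) x = x ^ (Fintype.card Fq) ^ n := by
  induction n with
  | zero => simp
  | succ n ih => rw [pow_succ', RingHom.mul_def, RingHom.comp_apply, ih, qFrob_apply, ← pow_mul,
      pow_succ]

/-- The action of `ℕ` on `F` where `n` acts as `x ↦ x ^ (q ^ n)`. -/
abbrev frobAction : MulSemiringAction (Multiplicative ℕ) F :=
  MulSemiringAction.compHom F (powersHom (F →+* F) (qFrob Fq F))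

theorem frobAction_smul (n : Multiplicative ℕ) (x : F) :
    (frobAction Fq F).toSMul.smul n x = x ^ (Fintype.card Fq) ^ n.toAdd :=
  qFrob_pow_apply Fq F n.toAdd x

/-- The twisted polynomial ring `F{τ}`, where `τ c = c ^ q τ`. -/
def TwistedPoly (_Fq : Type*) (F : Type*) [Field F] : Type _ := SkewPolynomial F

instance : Ring (TwistedPoly Fq F) :=
  letI := frobAction Fq F
  inferInstanceAs (Ring (SkewMonoidAlgebra F (Multiplicative ℕ)))

end Twisted

namespace TwistedPoly

variable {Fq : Type*} [Field Fq] [Fintype Fq]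
variable {F : Type*} [Field F] [Algebra (RatFunc Fq) F]

/-- The coefficient of `τ ^ n`. -/
def coeff (μ : TwistedPoly Fq F) (n : ℕ) : F := SkewPolynomial.coeff μ n

/-- The finite set of the exponents `n` with non-zero coefficient of `τ ^ n`. -/
def support (μ : TwistedPoly Fq F) : Finset ℕ := SkewPolynomial.support μ

/-- The degree in `τ` (and `0` for the zero polynomial). -/
def natDegree (μ : TwistedPoly Fq F) : ℕ := μ.support.sup id

variable (Fq F) in
/-- The constant polynomials. -/
def C : F →+* TwistedPoly Fq F :=
  letI := frobAction Fq F
  SkewPolynomial.CRingHom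

/-- The variable `τ`. -/
def tau : TwistedPoly Fq F := (SkewPolynomial.X : SkewPolynomial F)

theorem tau_mul_C (c : F) :
    (tau : TwistedPoly Fq F) * C Fq F c = C Fq F (c ^ Fintype.card Fq) * tau := by
  let := frobAction Fq F
  have h : (SkewPolynomial.X : SkewPolynomial F) * SkewPolynomial.C c =
      SkewPolynomial.C (c ^ Fintype.card Fq) * SkewPolynomial.X := by
    rw [← SkewPolynomial.monomial_one_one_eq_X, SkewPolynomial.monomial_mul_C,
      SkewPolynomial.C_mul_monomial, one_mul, mul_one, SkewPolynomial.φ_iterate_apply]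
    congr 1
  exact h

theorem C_injective : Function.Injective (C Fq F) :=
  SkewPolynomial.C_injective

/-- The differential map `∂ : F{τ} → F`, the constant coefficient. -/
def diff (μ : TwistedPoly Fq F) : F := μ.coeff 0

theorem C_constHom_comm (c : Fq) (μ : TwistedPoly Fq F) :
    C Fq F (constHom Fq F c) * μ = μ * C Fq F (constHom Fq F c) := by
  let := frobAction Fq F
  have h : ∀ μ : SkewPolynomial F, SkewPolynomial.C (constHom Fq F c) * μ =
      μ * SkewPolynomial.C (constHom Fq F c) := by
    intro μ
    induction μ using SkewPolynomial.induction with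
    | h0 => simp
    | ha n r p _ _ hp =>
      rw [mul_add, add_mul, hp, SkewPolynomial.C_mul_monomial, SkewPolynomial.monomial_mul_C,
        SkewPolynomial.φ_iterate_apply, mul_comm r]
      congr 3
      refine ((frobAction_smul Fq F _ _).trans ?_).symm
      rw [← map_pow, FiniteField.pow_card_pow]
  exact h μ

instance : Nontrivial (TwistedPoly Fq F) :=
  ⟨⟨C Fq F 0, C Fq F 1, fun h => zero_ne_one (C_injective h)⟩⟩

instance : Algebra Fq (TwistedPoly Fq F) :=
  ((C Fq F).comp (constHom Fq F)).toAlgebra' C_constHom_comm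

theorem algebraMap_eq (c : Fq) :
    algebraMap Fq (TwistedPoly Fq F) c = C Fq F (constHom Fq F c) := rfl

/-- The evaluation of `μ = ∑ c_i τ ^ i` as the additive map `x ↦ ∑ c_i x ^ (q ^ i)`. -/
def toEnd : TwistedPoly Fq F →+* AddMonoid.End F :=
  letI := frobAction Fq F
  SkewMonoidAlgebra.liftNCRingHom (k := F) (G := Multiplicative ℕ)
    (Module.toAddMonoidEnd F F)
    (powersHom (AddMonoid.End F) (qFrobEnd Fq F))
    (by
      intro x y
      ext z
      change ((qFrob Fq F) ^ y.toAdd) x * ((qFrobEnd Fq F) ^ y.toAdd) z =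
        ((qFrobEnd Fq F) ^ y.toAdd) (x * z)
      rw [qFrob_pow_apply, qFrobEnd_pow_apply, qFrobEnd_pow_apply, mul_pow])

theorem toEnd_apply (μ : TwistedPoly Fq F) (x : F) :
    toEnd μ x = ∑ i ∈ μ.support, μ.coeff i * x ^ (Fintype.card Fq) ^ i := by
  have h : ∀ μ : SkewPolynomial F, toEnd (Fq := Fq) (F := F) μ x =
      μ.sum fun i c => c * x ^ (Fintype.card Fq) ^ i := by
    intro μ
    rw [SkewPolynomial.sum, SkewMonoidAlgebra.sum_def, Finsupp.sum]
    refine (AddMonoidHom.finsetSum_apply _ _ x).trans (Finset.sum_congr rfl fun i _ => ?_)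
    exact congrArg (fun y => SkewMonoidAlgebra.coeff μ i * y) (qFrobEnd_pow_apply Fq F i.toAdd x)
  exact (h μ).trans (SkewPolynomial.sum_def _ _)

/-- Applying a homomorphism `f` of fields over `Q` to the coefficients. -/
def map {L : Type*} [Field L] [Algebra (RatFunc Fq) L] (f : F →ₐ[RatFunc Fq] L) :
    TwistedPoly Fq F →+* TwistedPoly Fq L :=
  letI := frobAction Fq F
  SkewMonoidAlgebra.liftNCRingHom (k := F) (G := Multiplicative ℕ)
    ((C Fq L).comp f.toRingHom) (powersHom (TwistedPoly Fq L) tau)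
    (by
      intro x y
      have h : ∀ (n : ℕ) (c : L),
          (tau : TwistedPoly Fq L) ^ n * C Fq L c = C Fq L (c ^ Fintype.card Fq ^ n) * tau ^ n := by
        intro n
        induction n with
        | zero => intro c; simp
        | succ n ih =>
          intro c
          rw [pow_succ, mul_assoc, tau_mul_C, ← mul_assoc, ih, mul_assoc, ← pow_mul, ← pow_succ']
      refine Eq.trans ?_ (h y.toAdd (f x)).symm
      have e := frobAction_smul Fq F y x
      rw [← map_pow, ← e]
      rfl)

theorem map_C {L : Type*} [Field L] [Algebra (RatFunc Fq) L] (f : F →ₐ[RatFunc Fq] L) (c : F) :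
    map f (C Fq F c) = C Fq L (f c) := by
  let := frobAction Fq L
  refine (SkewMonoidAlgebra.liftNC_single _ _ _ _).trans ?_
  exact mul_one (C Fq L (f c))

theorem coeff_map {L : Type*} [Field L] [Algebra (RatFunc Fq) L] (f : F →ₐ[RatFunc Fq] L)
    (μ : TwistedPoly Fq F) (n : ℕ) : (map f μ).coeff n = f (μ.coeff n) := by
  have hm : ∀ (n : ℕ) (c : F),
      map f (SkewPolynomial.monomial n c : SkewPolynomial F) =
        (SkewPolynomial.monomial n (f c) : SkewPolynomial L) := by
    intro n c
    let := frobAction Fq L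
    refine (SkewMonoidAlgebra.liftNC_single _ _ _ _).trans ?_
    exact SkewPolynomial.C_mul_X_pow_eq_monomial (a := f c) (n := n)
  have h : ∀ μ : SkewPolynomial F, SkewPolynomial.coeff (map (Fq := Fq) f μ) n =
      f (SkewPolynomial.coeff μ n) := by
    intro μ
    induction μ using SkewPolynomial.induction with
    | h0 => rw [SkewPolynomial.coeff_zero, map_zero f]
            exact congrArg (fun p => TwistedPoly.coeff p n) (map_zero (map (Fq := Fq) f))
    | ha k r p _ _ hp =>
      have e : map (Fq := Fq) f (SkewPolynomial.monomial k r + p : SkewPolynomial F) =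
          ((SkewPolynomial.monomial k (f r) : SkewPolynomial L) +
            (show SkewPolynomial L from map (Fq := Fq) f p) : SkewPolynomial L) :=
        (map_add (map (Fq := Fq) f) _ _).trans (congrArg₂ _ (hm k r) rfl)
      refine (congrArg (fun p => SkewPolynomial.coeff p n) e).trans ?_
      rw [SkewPolynomial.coeff_add, SkewPolynomial.coeff_add, hp, map_add,
        SkewPolynomial.coeff_monomial, SkewPolynomial.coeff_monomial]
      split_ifs <;> simp
  exact h μ

theorem map_injective {L : Type*} [Field L] [Algebra (RatFunc Fq) L] (f : F →ₐ[RatFunc Fq] L) :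
    Function.Injective (map (Fq := Fq) f) := by
  intro μ ν h
  refine SkewPolynomial.ext_iff.mpr fun n => f.toRingHom.injective ?_
  exact (coeff_map f μ n).symm.trans ((congrArg (fun p => coeff p n) h).trans (coeff_map f ν n))

end TwistedPoly

/-! ### Drinfeld modules -/

/-- A Drinfeld `𝔽_q[T]`-module over a field `F ⊇ 𝔽_q(T)`. -/
structure DrinfeldModule (Fq : Type*) [Field Fq] [Fintype Fq]
    (F : Type*) [Field F] [Algebra (RatFunc Fq) F] where
  /-- The structure homomorphism `a ↦ φ_a`. -/
  toAlgHom : Fq[X] →ₐ[Fq] TwistedPoly Fq F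
  diff_eq : ∀ a, (toAlgHom a).diff = incl Fq F a
  nontrivial : ∃ a, toAlgHom a ≠ TwistedPoly.C Fq F (incl Fq F a)

namespace DrinfeldModule

variable {Fq : Type*} [Field Fq] [Fintype Fq]
variable {F : Type*} [Field F] [Algebra (RatFunc Fq) F]

/-- The rank: the degree in `τ` of `φ_T`. -/
def rank (φ : DrinfeldModule Fq F) : ℕ := (φ.toAlgHom X).natDegree

/-- The Drinfeld module obtained by applying a homomorphism of fields over `𝔽_q(T)` to all
coefficients. -/
def map {L : Type*} [Field L] [Algebra (RatFunc Fq) L] (f : F →ₐ[RatFunc Fq] L)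
    (φ : DrinfeldModule Fq F) : DrinfeldModule Fq L where
  toAlgHom :=
    { (TwistedPoly.map f).comp φ.toAlgHom.toRingHom with
      commutes' := fun c => by
        change TwistedPoly.map f (φ.toAlgHom (algebraMap Fq Fq[X] c)) = _
        rw [AlgHom.commutes, TwistedPoly.algebraMap_eq, TwistedPoly.algebraMap_eq,
          TwistedPoly.map_C]
        exact congrArg (TwistedPoly.C Fq L) (f.commutes _) }
  diff_eq a := by
    refine (TwistedPoly.coeff_map f (φ.toAlgHom a) 0).trans ?_
    exact (congrArg f (φ.diff_eq a)).trans (f.commutes _)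
  nontrivial := by
    obtain ⟨a, ha⟩ := φ.nontrivial
    refine ⟨a, fun h => ha ?_⟩
    refine TwistedPoly.map_injective f ?_
    rw [TwistedPoly.map_C]
    exact h.trans (congrArg (TwistedPoly.C Fq L) (f.commutes _).symm)

/-- The additive group of `F`, on which `a ∈ 𝔽_q[T]` acts through `φ_a`. -/
def Points (_φ : DrinfeldModule Fq F) : Type _ := F

instance (φ : DrinfeldModule Fq F) : AddCommGroup φ.Points := inferInstanceAs (AddCommGroup F)

instance (φ : DrinfeldModule Fq F) : Module Fq[X] φ.Points :=
  Module.compHom F (TwistedPoly.toEnd.comp φ.toAlgHom.toRingHom)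

theorem smul_points (φ : DrinfeldModule Fq F) (a : Fq[X]) (x : φ.Points) :
    a • x = TwistedPoly.toEnd (φ.toAlgHom a) x := rfl

/-- `φ` has complex multiplication: its rank is greater than one, and the field `Q(∂(End φ))`
generated over `Q` by the image of the endomorphism ring under `∂` has degree greater than one
over `Q = 𝔽_q(T)`. -/
def HasCM (φ : DrinfeldModule Fq F) : Prop :=
  1 < φ.rank ∧ 1 < Module.rank (RatFunc Fq) (IntermediateField.adjoin (RatFunc Fq)
    {x : F | ∃ μ : TwistedPoly Fq F,
      (∀ a, μ * φ.toAlgHom a = φ.toAlgHom a * μ) ∧ μ.diff = x})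

/-- An isogeny `μ : φ → ψ` with coefficients in `F`: a non-zero `μ ∈ F{τ}` such that
`μ φ_a = ψ_a μ` for all `a`. -/
structure Isogeny (φ ψ : DrinfeldModule Fq F) where
  val : TwistedPoly Fq F
  ne_zero : val ≠ 0
  comm : ∀ a, val * φ.toAlgHom a = ψ.toAlgHom a * val

namespace Isogeny

variable {φ ψ φ' ψ' : DrinfeldModule Fq F}

/-- An isogeny is an isomorphism if it is a non-zero constant. -/
def IsIso (μ : Isogeny φ ψ) : Prop := ∃ c : F, c ≠ 0 ∧ μ.val = TwistedPoly.C Fq F c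

/-- The identity. -/
def refl (φ : DrinfeldModule Fq F) : Isogeny φ φ := ⟨1, one_ne_zero, fun a => by simp⟩

theorem IsIso.symm {μ : Isogeny φ ψ} (h : μ.IsIso) : ∃ η : Isogeny ψ φ, η.IsIso := by
  obtain ⟨c, hc, h⟩ := h
  have h1 : TwistedPoly.C Fq F c⁻¹ * TwistedPoly.C Fq F c = 1 := by
    rw [← map_mul, inv_mul_cancel₀ hc, map_one]
  have h2 : TwistedPoly.C Fq F c * TwistedPoly.C Fq F c⁻¹ = 1 := by
    rw [← map_mul, mul_inv_cancel₀ hc, map_one]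
  refine ⟨⟨TwistedPoly.C Fq F c⁻¹, ?_, fun a => ?_⟩, c⁻¹, inv_ne_zero hc, rfl⟩
  · exact fun h0 => inv_ne_zero hc (TwistedPoly.C_injective (h0.trans (map_zero _).symm))
  · have e := μ.comm a
    rw [h] at e
    calc TwistedPoly.C Fq F c⁻¹ * ψ.toAlgHom a
        = TwistedPoly.C Fq F c⁻¹ * (ψ.toAlgHom a * TwistedPoly.C Fq F c) *
            TwistedPoly.C Fq F c⁻¹ := by rw [mul_assoc, mul_assoc, h2, mul_one]
      _ = φ.toAlgHom a * TwistedPoly.C Fq F c⁻¹ := by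
          rw [← e, ← mul_assoc, h1, one_mul]

theorem IsIso.trans {χ : DrinfeldModule Fq F} {μ : Isogeny φ ψ} {η : Isogeny ψ χ}
    (hμ : μ.IsIso) (hη : η.IsIso) : ∃ ν : Isogeny φ χ, ν.IsIso := by
  obtain ⟨c, hc, h⟩ := hμ
  obtain ⟨d, hd, h'⟩ := hη
  have e : η.val * μ.val = TwistedPoly.C Fq F (d * c) := by rw [h, h', map_mul]
  refine ⟨⟨η.val * μ.val, ?_, fun a => ?_⟩, d * c, mul_ne_zero hd hc, e⟩
  · rw [e]
    exact fun h0 => mul_ne_zero hd hc (TwistedPoly.C_injective (h0.trans (map_zero _).symm))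
  · rw [mul_assoc, μ.comm, ← mul_assoc, η.comm, mul_assoc]

/-- Two isogenies are equivalent if they differ by isomorphisms of the sources and of the
targets: `η = λ μ ν⁻¹`, written as `η ν = λ μ`. -/
def IsEquivalent (μ : Isogeny φ ψ) (η : Isogeny φ' ψ') : Prop :=
  ∃ (ν : Isogeny φ φ') (l : Isogeny ψ ψ'), ν.IsIso ∧ l.IsIso ∧ η.val * ν.val = l.val * μ.val

/-- The homomorphism of `𝔽_q[T]`-modules induced by an isogeny on points. -/
def toLinearMap (μ : Isogeny φ ψ) : φ.Points →ₗ[Fq[X]] ψ.Points where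
  toFun x := TwistedPoly.toEnd μ.val x
  map_add' x y := map_add (TwistedPoly.toEnd μ.val) x y
  map_smul' a x := by
    have h := congrArg (fun p => TwistedPoly.toEnd p (show F from x)) (μ.comm a)
    simp only [map_mul] at h
    exact h

/-- The kernel of an isogeny on the `F`-points (`F` is to be algebraically closed). -/
def ker (μ : Isogeny φ ψ) : Submodule Fq[X] φ.Points := LinearMap.ker μ.toLinearMap

/-- `𝔡 = 𝔫_1 ⋯ 𝔫_n` for some decomposition `Ker μ ≅ A/𝔫_1 ⊕ ⋯ ⊕ A/𝔫_n`
with non-trivial ideals `𝔫_i` of `A = 𝔽_q[T]`. -/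
def IsDegree (μ : Isogeny φ ψ) (𝔡 : Ideal Fq[X]) : Prop :=
  ∃ (n : ℕ) (𝔫 : Fin n → Ideal Fq[X]), (∀ i, 𝔫 i ≠ ⊥ ∧ 𝔫 i ≠ ⊤) ∧
    Nonempty (μ.ker ≃ₗ[Fq[X]] ((i : Fin n) → Fq[X] ⧸ 𝔫 i)) ∧ 𝔡 = ∏ i, 𝔫 i

/-- The degree of an isogeny, an ideal of `𝔽_q[T]`: the product of the ideals in a decomposition
of the kernel into cyclic modules. (It does not depend on the decomposition.) -/
def degree (μ : Isogeny φ ψ) : Ideal Fq[X] := Classical.epsilon μ.IsDegree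

/-- An isogeny `μ : φ → ψ` is primitive if no isogeny `φ → ψ` has a degree that is a proper
divisor of `deg μ`. -/
def IsPrimitive (μ : Isogeny φ ψ) : Prop :=
  ∀ η : Isogeny φ ψ, η.degree ∣ μ.degree → η.degree = μ.degree

end Isogeny

/-- `δ_𝔭(φ, ψ)`: the largest `n` such that `𝔭 ^ n` divides the degree of a primitive
isogeny `φ → ψ`. -/
def delta (𝔭 : Ideal Fq[X]) (φ ψ : DrinfeldModule Fq F) : ℕ :=
  sSup {n : ℕ | ∃ μ : Isogeny φ ψ, μ.IsPrimitive ∧ 𝔭 ^ n ∣ μ.degree}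

/-- `ψ'` is a `𝔭`-part of `ψ` relative to `φ`: every primitive isogeny `μ : φ → ψ` factors
as `μ = η μ'` with `μ' : φ → ψ'` of degree `𝔭 ^ δ_𝔭(φ, ψ)` and `η : ψ' → ψ` of degree
prime to `𝔭`. -/
def IsPPart (𝔭 : Ideal Fq[X]) (φ ψ ψ' : DrinfeldModule Fq F) : Prop :=
  ∀ μ : Isogeny φ ψ, μ.IsPrimitive →
    ∃ (μ' : Isogeny φ ψ') (η : Isogeny ψ' ψ), μ.val = η.val * μ'.val ∧
      μ'.degree = 𝔭 ^ delta 𝔭 φ ψ ∧ IsCoprime η.degree 𝔭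

end DrinfeldModule

/-! ### Drinfeld modules over the separable closure -/

section Sep

open DrinfeldModule

variable {Fq : Type*} [Field Fq] [Fintype Fq]
variable {K : Type*} [Field K] [Algebra (RatFunc Fq) K]
variable {Kbar : Type*} [Field Kbar] [Algebra K Kbar] [Algebra (RatFunc Fq) Kbar]
  [IsScalarTower (RatFunc Fq) K Kbar]

variable (Fq K Kbar) in
/-- Drinfeld modules over the separable closure `K^sep` of `K` in `Kbar`. -/
abbrev SepModule : Type _ := DrinfeldModule Fq (separableClosure K Kbar)

/-- A Drinfeld module over `K^sep`, regarded as a Drinfeld module over `Kbar`. -/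
def overKbar (φ : SepModule Fq K Kbar) : DrinfeldModule Fq Kbar :=
  φ.map ((separableClosure K Kbar).val.restrictScalars (RatFunc Fq))

/-- Isogenies between Drinfeld modules over `K^sep`; their coefficients are allowed to lie in
`Kbar`. -/
abbrev SepIsogeny (φ ψ : SepModule Fq K Kbar) : Type _ :=
  Isogeny (overKbar φ) (overKbar ψ)

/-- The conjugate of a Drinfeld module by `s ∈ G_K = Gal(K^sep/K)`. -/
def conj (s : Gal(separableClosure K Kbar/K)) (φ : SepModule Fq K Kbar) : SepModule Fq K Kbar :=
  φ.map (s.toAlgHom.restrictScalars (RatFunc Fq))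

/-- `φ` is virtually `K`-rational: it is isogenous to all its conjugates. -/
def IsVirtuallyRational (φ : SepModule Fq K Kbar) : Prop :=
  ∀ s : Gal(separableClosure K Kbar/K), Nonempty (SepIsogeny φ (conj s φ))

variable (Fq K Kbar) in
/-- Isomorphism of Drinfeld modules. -/
instance isoSetoid : Setoid (SepModule Fq K Kbar) where
  r φ ψ := ∃ μ : SepIsogeny φ ψ, μ.IsIso
  iseqv :=
    { refl := fun _ => ⟨Isogeny.refl _, 1, one_ne_zero, (map_one _).symm⟩
      symm := fun ⟨_, h⟩ => h.symm
      trans := fun ⟨_, hμ⟩ ⟨_, hη⟩ => hμ.trans hη }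

variable (Fq K Kbar) in
/-- Drinfeld modules over `K^sep` up to isomorphism. -/
abbrev IsoClass : Type _ := Quotient (isoSetoid Fq K Kbar)

/-- The set `I` of the Drinfeld modules that are isogenous to `φ`, up to isomorphism. -/
def isogenyClass (φ : SepModule Fq K Kbar) : Set (IsoClass Fq K Kbar) :=
  {v | ∃ ψ : SepModule Fq K Kbar, ⟦ψ⟧ = v ∧ Nonempty (SepIsogeny ψ φ)}

/-- The subset `I_𝔭` of those admitting a `𝔭 ^ n`-isogeny to `φ` for some `n ≥ 0`. -/
def pIsogenyClass (𝔭 : Ideal Fq[X]) (φ : SepModule Fq K Kbar) : Set (IsoClass Fq K Kbar) :=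
  {v | ∃ ψ : SepModule Fq K Kbar, ⟦ψ⟧ = v ∧
    ∃ (n : ℕ) (μ : SepIsogeny ψ φ), μ.degree = 𝔭 ^ n}

/-- There is an edge from `v` to `w`, that is, a `𝔭`-isogeny from a representative of `v` to
a representative of `w`. -/
def PEdge (𝔭 : Ideal Fq[X]) (v w : IsoClass Fq K Kbar) : Prop :=
  ∃ ψ χ : SepModule Fq K Kbar, ⟦ψ⟧ = v ∧ ⟦χ⟧ = w ∧ ∃ μ : SepIsogeny ψ χ, μ.degree = 𝔭

end Sep

end Drinfeld

end

open Drinfeld Drinfeld.DrinfeldModule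

/-!
# The tree of `𝔭`-isogenies of a Drinfeld module of rank two without complex multiplication

Over a field containing `Q = 𝔽_q(T)` every isogeny is a separable additive polynomial
(`diff_ne_zero_of_comm`). Over an algebraically closed field it is therefore determined by its
kernel up to an isomorphism of the target, and isogenies factor as their kernels do
(`exists_factor`). The degree of an isogeny is the order ideal of its kernel, the ideal generated by
the characteristic polynomial of `T` on it (`degree_eq_orderIdeal`). This makes the degree
multiplicative and gives `deg φ_a = (a) ^ r` in rank `r`. In rank two it follows that every isogeny
has a dual of the same degree (`exists_dual_degree_eq`), so that the graph is undirected.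

Torsion points are separable. Hence the quotients by finite submodules descend to `K^sep`
(`exists_sep_quotient`), and so do endomorphisms; without complex multiplication their differentials
lie in `Q`, and all endomorphisms over the algebraic closure are of the form `φ_a`
(`hasTrivialEnd_overKbar`). The isogenies between two members of the isogeny class are then the
multiples `μ φ_a` of a single isogeny `μ`, the one that is not divisible by a non-unit of `A`
(`IsReduced.exists_eq_comp_mulBy`). These reduced isogenies are exactly the primitive ones, and any
two of them with the same source and target differ by a unit.

*The tree.* The composite of the `𝔭`-isogenies along a path is reduced of degree `𝔭 ^ n`
(`exists_isReduced_of_isPath`): otherwise some step would be undone by the next one, because two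
different kernels of `𝔭`-isogenies span the whole `𝔭`-torsion (`ker_mulBy_le_of_ker_ne`). Since all
reduced isogenies between two vertices have the same degree, there are no cycles. The neighbours of
a vertex correspond to the lines in its `𝔭`-torsion, a plane over `A / 𝔭` (`ncard_neighborSet`).

*The projection.* A reduced isogeny `φ → ψ` is the composite of an isogeny of degree a power of `𝔭`
and an isogeny of degree prime to `𝔭`, and the module in the middle is unique up to isomorphism
(`exists_pPart`, `HasReducedFactor.mk_eq`); this is `π_𝔭(ψ)`. As `ψ` and `π_𝔭(ψ)` are linked by an
isogeny of degree prime to `𝔭`, the exponent of `𝔭` in the degree of the reduced isogeny between two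
modules does not change on passing to the projections (`IsReduced.pow_dvd_degree`). Between the
projections it is the length of the path (`length_eq_delta`).
-/

noncomputable section

set_option linter.unusedSectionVars false

namespace Drinfeld
namespace TwistedPoly

variable {Fq : Type*} [Field Fq] [Fintype Fq]
variable {F : Type*} [Field F] [Algebra (RatFunc Fq) F]

/-! ### Coefficients of twisted polynomials -/

theorem ext_coeff {μ ν : TwistedPoly Fq F} (h : ∀ n, μ.coeff n = ν.coeff n) : μ = ν :=
  SkewPolynomial.ext h

theorem coeff_zero (n : ℕ) : (0 : TwistedPoly Fq F).coeff n = 0 := rfl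

theorem coeff_add (μ ν : TwistedPoly Fq F) (n : ℕ) :
    (μ + ν).coeff n = μ.coeff n + ν.coeff n := by
  exact SkewPolynomial.coeff_add (p := μ) (q := ν) n

/-- The coefficient of `τ ^ n`, as an additive map. -/
def coeffHom (n : ℕ) : TwistedPoly Fq F →+ F where
  toFun μ := μ.coeff n
  map_zero' := coeff_zero n
  map_add' μ ν := coeff_add μ ν n

theorem coeff_sub (μ ν : TwistedPoly Fq F) (n : ℕ) :
    (μ - ν).coeff n = μ.coeff n - ν.coeff n := map_sub (coeffHom n) μ ν

theorem coeff_C (c : F) (n : ℕ) : (C Fq F c).coeff n = if n = 0 then c else 0 :=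
  SkewPolynomial.coeff_C (n := n)

theorem mem_support {μ : TwistedPoly Fq F} {n : ℕ} : n ∈ μ.support ↔ μ.coeff n ≠ 0 :=
  SkewPolynomial.mem_support_iff (p := μ)

/-- The multiplication of `F{τ}` is the convolution twisted by the Frobenius. -/
theorem coeff_mul (μ ν : TwistedPoly Fq F) (n : ℕ) :
    (μ * ν).coeff n =
      ∑ x ∈ Finset.HasAntidiagonal.antidiagonal n,
        μ.coeff x.1 * ν.coeff x.2 ^ Fintype.card Fq ^ x.1 := by
  let := frobAction Fq F
  have hadd : ∀ (i : ℕ) (a b : F), (a + b) ^ Fintype.card Fq ^ i =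
      a ^ Fintype.card Fq ^ i + b ^ Fintype.card Fq ^ i := fun i a b => by
    simp only [← qFrob_pow_apply, map_add]
  have h : ∀ μ ν : SkewPolynomial F, SkewPolynomial.coeff (μ * ν) n =
      ∑ x ∈ Finset.HasAntidiagonal.antidiagonal n, SkewPolynomial.coeff μ x.1 *
        SkewPolynomial.coeff ν x.2 ^ Fintype.card Fq ^ x.1 := by
    intro μ ν
    induction μ using SkewPolynomial.induction with
    | h0 => simp
    | ha k r p _ _ hp =>
      simp only [add_mul, SkewPolynomial.coeff_add, hp, Finset.sum_add_distrib]
      congr 1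
      clear hp
      induction ν using SkewPolynomial.induction with
      | h0 => simp
      | ha l s p _ _ hp =>
        simp only [mul_add, SkewPolynomial.coeff_add, hp, hadd, Finset.sum_add_distrib]
        congr 1
        rw [SkewPolynomial.monomial_mul_monomial, SkewPolynomial.φ_iterate_apply,
          SkewPolynomial.coeff_monomial]
        simp only [SkewPolynomial.coeff_monomial]
        have e := frobAction_smul Fq F (Multiplicative.ofAdd k) s
        split_ifs with hkl
        · rw [Finset.sum_eq_single (k, l)]
          · simp only [if_true]
            exact congrArg (r * ·) e
          · rintro ⟨i, j⟩ - hij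
            by_cases hi : k = i
            · have hj : l ≠ j := fun hj => hij (by rw [hi, hj])
              simp [hj]
            · simp [hi]
          · intro h
            exact absurd (Finset.HasAntidiagonal.mem_antidiagonal.mpr hkl) h
        · symm
          refine Finset.sum_eq_zero ?_
          rintro ⟨i, j⟩ hij
          rw [Finset.HasAntidiagonal.mem_antidiagonal] at hij
          by_cases hi : k = i
          · have hj : l ≠ j := fun hj => hkl (by rw [hi, hj]; exact hij)
            simp [hj]
          · simp [hi]
  exact h μ ν

theorem coeff_C_mul (c : F) (μ : TwistedPoly Fq F) (n : ℕ) :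
    (C Fq F c * μ).coeff n = c * μ.coeff n := by
  rw [coeff_mul, Finset.sum_eq_single (0, n)]
  · simp [coeff_C]
  · rintro ⟨i, j⟩ hij h
    rw [Finset.HasAntidiagonal.mem_antidiagonal] at hij
    have : i ≠ 0 := by rintro rfl; exact h (by simpa using hij)
    simp [coeff_C, this]
  · simp

theorem coeff_mul_C (c : F) (μ : TwistedPoly Fq F) (n : ℕ) :
    (μ * C Fq F c).coeff n = μ.coeff n * c ^ Fintype.card Fq ^ n := by
  rw [coeff_mul, Finset.sum_eq_single (n, 0)]
  · simp [coeff_C]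
  · rintro ⟨i, j⟩ hij h
    rw [Finset.HasAntidiagonal.mem_antidiagonal] at hij
    have : j ≠ 0 := by rintro rfl; exact h (by simpa using hij)
    simp [coeff_C, this]
  · simp

theorem coeff_tau (n : ℕ) : (tau : TwistedPoly Fq F).coeff n = if 1 = n then 1 else 0 :=
  SkewPolynomial.coeff_X

theorem coeff_tau_pow (m n : ℕ) :
    ((tau : TwistedPoly Fq F) ^ m).coeff n = if m = n then 1 else 0 := by
  let := frobAction Fq F
  have h : SkewPolynomial.coeff ((SkewPolynomial.X : SkewPolynomial F) ^ m) n =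
      if m = n then 1 else 0 := by
    rw [SkewPolynomial.X_pow_eq_monomial, SkewPolynomial.coeff_monomial]
  exact h

theorem diff_mul (μ ν : TwistedPoly Fq F) : (μ * ν).diff = μ.diff * ν.diff := by
  simp [diff, coeff_mul]

theorem diff_one : (1 : TwistedPoly Fq F).diff = 1 := by
  exact (congrArg diff (map_one (C Fq F)).symm).trans (by rw [diff, coeff_C, if_pos rfl])

/-! ### Degree and division in the twisted polynomial ring -/

theorem coeff_eq_zero_of_natDegree_lt {μ : TwistedPoly Fq F} {n : ℕ} (h : μ.natDegree < n) :
    μ.coeff n = 0 := by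
  by_contra hn
  exact absurd (Finset.le_sup (f := id) (mem_support.mpr hn)) (not_le.mpr h)

theorem natDegree_le_iff {μ : TwistedPoly Fq F} {n : ℕ} :
    μ.natDegree ≤ n ↔ ∀ m, n < m → μ.coeff m = 0 := by
  refine ⟨fun h m hm => coeff_eq_zero_of_natDegree_lt (h.trans_lt hm), fun h => ?_⟩
  refine Finset.sup_le fun m hm => ?_
  by_contra hmn
  exact mem_support.mp hm (h m (not_le.mp hmn))

theorem coeff_natDegree_ne_zero {μ : TwistedPoly Fq F} (h : μ ≠ 0) :
    μ.coeff μ.natDegree ≠ 0 := by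
  have hs : μ.support.Nonempty := by
    by_contra hs
    rw [Finset.not_nonempty_iff_eq_empty] at hs
    refine h (ext_coeff fun n => ?_)
    by_contra hn
    exact absurd (mem_support.mpr hn) (by simp [hs])
  obtain ⟨m, hm, e⟩ := Finset.exists_mem_eq_sup μ.support hs id
  unfold natDegree
  rw [e]
  exact mem_support.mp hm

theorem natDegree_eq_of_coeff {μ : TwistedPoly Fq F} {n : ℕ} (h : μ.coeff n ≠ 0)
    (h' : ∀ m, n < m → μ.coeff m = 0) : μ.natDegree = n :=
  le_antisymm (natDegree_le_iff.mpr h') (Finset.le_sup (f := id) (mem_support.mpr h))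

theorem natDegree_C (c : F) : (C Fq F c).natDegree = 0 :=
  Nat.le_zero.mp (natDegree_le_iff.mpr fun m hm => by simp [coeff_C, hm.ne'])

theorem eq_C_of_natDegree_eq_zero {μ : TwistedPoly Fq F} (h : μ.natDegree = 0) :
    μ = C Fq F μ.diff := by
  refine ext_coeff fun n => ?_
  rw [coeff_C]
  split_ifs with hn
  · rw [hn]; rfl
  · exact coeff_eq_zero_of_natDegree_lt (by omega)

theorem coeff_mul_add_natDegree (μ ν : TwistedPoly Fq F) :
    (μ * ν).coeff (μ.natDegree + ν.natDegree) =
      μ.coeff μ.natDegree * ν.coeff ν.natDegree ^ Fintype.card Fq ^ μ.natDegree := by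
  rw [coeff_mul, Finset.sum_eq_single (μ.natDegree, ν.natDegree)]
  · rintro ⟨i, j⟩ hij h
    rw [Finset.HasAntidiagonal.mem_antidiagonal] at hij
    dsimp only at hij ⊢
    rcases lt_trichotomy i μ.natDegree with hi | hi | hi
    · rw [coeff_eq_zero_of_natDegree_lt (μ := ν) (by omega)]
      simp
    · exact absurd (by ext <;> simp <;> omega) h
    · rw [coeff_eq_zero_of_natDegree_lt hi]; simp
  · simp

instance : NoZeroDivisors (TwistedPoly Fq F) where
  eq_zero_or_eq_zero_of_mul_eq_zero {μ ν} h := by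
    by_contra! h0
    have e := coeff_mul_add_natDegree μ ν
    rw [h, coeff_zero] at e
    exact mul_ne_zero (coeff_natDegree_ne_zero h0.1)
      (pow_ne_zero _ (coeff_natDegree_ne_zero h0.2)) e.symm

instance : IsDomain (TwistedPoly Fq F) := NoZeroDivisors.to_isDomain _

theorem natDegree_mul {μ ν : TwistedPoly Fq F} (hμ : μ ≠ 0) (hν : ν ≠ 0) :
    (μ * ν).natDegree = μ.natDegree + ν.natDegree := by
  refine natDegree_eq_of_coeff ?_ fun m hm => ?_
  · rw [coeff_mul_add_natDegree]
    exact mul_ne_zero (coeff_natDegree_ne_zero hμ) (pow_ne_zero _ (coeff_natDegree_ne_zero hν))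
  · rw [coeff_mul]
    refine Finset.sum_eq_zero ?_
    rintro ⟨i, j⟩ hij
    rw [Finset.HasAntidiagonal.mem_antidiagonal] at hij
    dsimp only at hij ⊢
    by_cases hi : μ.natDegree < i
    · rw [coeff_eq_zero_of_natDegree_lt hi]; simp
    · rw [coeff_eq_zero_of_natDegree_lt (μ := ν) (by omega)]
      simp

/-- Division with remainder by `μ` on the right. -/
theorem exists_eq_mul_add {μ : TwistedPoly Fq F} (hμ : μ ≠ 0) (ν : TwistedPoly Fq F) :
    ∃ η ρ : TwistedPoly Fq F, ν = η * μ + ρ ∧ (ρ = 0 ∨ ρ.natDegree < μ.natDegree) := by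
  induction hn : ν.natDegree using Nat.strong_induction_on generalizing ν with
  | _ n ih =>
  subst hn
  by_cases h0 : ν = 0
  · exact ⟨0, 0, by simp [h0], Or.inl rfl⟩
  by_cases hlt : ν.natDegree < μ.natDegree
  · exact ⟨0, ν, by simp, Or.inr hlt⟩
  rw [not_lt] at hlt
  obtain ⟨k, hk⟩ := Nat.exists_eq_add_of_le' hlt
  have hlead := coeff_natDegree_ne_zero hμ
  -- `c τ ^ k μ` has the same leading term as `ν`
  let c := ν.coeff ν.natDegree / μ.coeff μ.natDegree ^ Fintype.card Fq ^ k
  let η₀ : TwistedPoly Fq F := C Fq F c * tau ^ k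
  have hc : c ≠ 0 := div_ne_zero (coeff_natDegree_ne_zero h0) (pow_ne_zero _ hlead)
  have hη₀ : η₀.natDegree = k := by
    refine natDegree_eq_of_coeff ?_ fun m hm => ?_
    · simp [η₀, coeff_C_mul, coeff_tau_pow, hc]
    · simp [η₀, coeff_C_mul, coeff_tau_pow, hm.ne]
  have hη₀0 : η₀ ≠ 0 := by
    intro h
    have : η₀.coeff k = c := by simp [η₀, coeff_C_mul, coeff_tau_pow]
    rw [h, coeff_zero] at this
    exact hc this.symm
  have htop : (ν - η₀ * μ).coeff ν.natDegree = 0 := by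
    have e := coeff_mul_add_natDegree η₀ μ
    rw [hη₀, ← hk] at e
    rw [coeff_sub, e]
    simp only [η₀, coeff_C_mul, coeff_tau_pow, if_true, c]
    field_simp
    simp
  have hle : (ν - η₀ * μ).natDegree ≤ ν.natDegree := natDegree_le_iff.mpr fun m hm => by
    rw [coeff_sub, coeff_eq_zero_of_natDegree_lt hm, coeff_eq_zero_of_natDegree_lt, sub_zero]
    rwa [natDegree_mul hη₀0 hμ, hη₀, ← hk]
  by_cases h1 : ν - η₀ * μ = 0
  · exact ⟨η₀, 0, by rw [add_zero]; exact sub_eq_zero.mp h1, Or.inl rfl⟩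
  have hlt' : (ν - η₀ * μ).natDegree < ν.natDegree := by
    refine lt_of_le_of_ne hle fun h => ?_
    exact coeff_natDegree_ne_zero h1 (h ▸ htop)
  obtain ⟨η, ρ, e, hρ⟩ := ih _ hlt' _ rfl
  exact ⟨η₀ + η, ρ, by rw [add_mul, add_assoc, ← e]; abel, hρ⟩

/-! ### Twisted polynomials as additive polynomials -/

theorem one_lt_card : 1 < Fintype.card Fq := Fintype.one_lt_card

/-- The additive polynomial `∑ c_i X ^ (q ^ i)` attached to `∑ c_i τ ^ i`. -/
def toPoly (μ : TwistedPoly Fq F) : F[X] :=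
  ∑ i ∈ μ.support, Polynomial.C (μ.coeff i) * X ^ Fintype.card Fq ^ i

theorem eval_toPoly (μ : TwistedPoly Fq F) (x : F) : μ.toPoly.eval x = toEnd μ x := by
  rw [toEnd_apply, toPoly, eval_finsetSum]
  simp

theorem coeff_toPoly_pow (μ : TwistedPoly Fq F) (n : ℕ) :
    μ.toPoly.coeff (Fintype.card Fq ^ n) = μ.coeff n := by
  have hinj := Nat.pow_right_injective (one_lt_card (Fq := Fq))
  simp only [toPoly, finsetSum_coeff, Polynomial.coeff_C_mul, coeff_X_pow, mul_ite, mul_one,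
    mul_zero]
  rw [Finset.sum_eq_single n]
  · simp
  · intro m _ hm
    rw [if_neg]
    exact fun h => hm (hinj h).symm
  · intro hn
    rw [if_pos rfl]
    by_contra h
    exact hn (mem_support.mpr h)

theorem toPoly_ne_zero {μ : TwistedPoly Fq F} (h : μ ≠ 0) : μ.toPoly ≠ 0 := by
  intro h0
  refine h (ext_coeff fun n => ?_)
  rw [← coeff_toPoly_pow, h0]
  rfl

theorem natDegree_toPoly {μ : TwistedPoly Fq F} (h : μ ≠ 0) :
    μ.toPoly.natDegree = Fintype.card Fq ^ μ.natDegree := by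
  refine natDegree_eq_of_le_of_coeff_ne_zero ?_ ?_
  · refine natDegree_sum_le_of_forall_le _ _ fun i hi => ?_
    refine (natDegree_C_mul_X_pow_le _ _).trans ?_
    exact Nat.pow_le_pow_right Fintype.card_pos (Finset.le_sup (f := id) hi)
  · rw [coeff_toPoly_pow]
    exact coeff_natDegree_ne_zero h

variable (Fq F) in
theorem card_cast_eq_zero : ((Fintype.card Fq : ℕ) : F) = 0 := by
  rw [← map_natCast (constHom Fq F), FiniteField.cast_card_eq_zero, map_zero]

theorem derivative_toPoly (μ : TwistedPoly Fq F) :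
    derivative μ.toPoly = Polynomial.C μ.diff := by
  rw [toPoly, derivative_sum]
  have h : ∀ i ∈ μ.support, derivative (Polynomial.C (μ.coeff i) * X ^ Fintype.card Fq ^ i) =
      if i = 0 then Polynomial.C μ.diff else 0 := by
    intro i _
    split_ifs with hi
    · subst hi
      simp [diff]
    · rw [derivative_C_mul_X_pow, Nat.cast_pow, card_cast_eq_zero, zero_pow hi]
      simp
  rw [Finset.sum_congr rfl h, Finset.sum_ite_eq']
  split_ifs with h0
  · rfl
  · have : μ.diff = 0 := by
      by_contra hd
      exact h0 (mem_support.mpr hd)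
    rw [this, map_zero]

theorem separable_toPoly {μ : TwistedPoly Fq F} (h : μ.diff ≠ 0) : μ.toPoly.Separable := by
  rw [Polynomial.Separable, derivative_toPoly]
  exact ⟨0, Polynomial.C μ.diff⁻¹, by rw [← Polynomial.C_mul, inv_mul_cancel₀ h]; simp⟩

end TwistedPoly
end Drinfeld

namespace Drinfeld
namespace TwistedPoly

variable {Fq : Type*} [Field Fq] [Fintype Fq]
variable {F : Type*} [Field F] [Algebra (RatFunc Fq) F]

/-! ### Zeros of additive polynomials -/

/-- The set of zeros of the additive polynomial attached to `μ`. -/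
def zeros (μ : TwistedPoly Fq F) : Set F := {x | toEnd μ x = 0}

theorem mem_zeros {μ : TwistedPoly Fq F} {x : F} : x ∈ μ.zeros ↔ toEnd μ x = 0 := Iff.rfl

theorem zeros_eq_rootSet {μ : TwistedPoly Fq F} (h : μ ≠ 0) :
    μ.zeros = μ.toPoly.rootSet F := by
  ext x
  rw [mem_rootSet, coe_aeval_eq_eval, eval_toPoly]
  exact ⟨fun hx => ⟨toPoly_ne_zero h, hx⟩, fun hx => hx.2⟩

theorem finite_zeros {μ : TwistedPoly Fq F} (h : μ ≠ 0) : μ.zeros.Finite := by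
  rw [zeros_eq_rootSet h]
  exact rootSet_finite _ _

theorem ncard_zeros_le {μ : TwistedPoly Fq F} (h : μ ≠ 0) :
    μ.zeros.ncard ≤ Fintype.card Fq ^ μ.natDegree := by
  rw [zeros_eq_rootSet h, ← natDegree_toPoly h]
  exact ncard_rootSet_le _ _

theorem ne_zero_of_diff_ne_zero {μ : TwistedPoly Fq F} (h : μ.diff ≠ 0) : μ ≠ 0 := by
  rintro rfl; exact h rfl

/-- Over an algebraically closed field, a separable additive polynomial has as many zeros as its
degree. -/
theorem ncard_zeros [IsAlgClosed F] {μ : TwistedPoly Fq F} (h : μ.diff ≠ 0) :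
    μ.zeros.ncard = Fintype.card Fq ^ μ.natDegree := by
  have h0 := ne_zero_of_diff_ne_zero h
  rw [zeros_eq_rootSet h0, ← natDegree_toPoly h0,
    ← card_rootSet_eq_natDegree (K := F) (separable_toPoly h) (IsAlgClosed.splits _),
    ← Nat.card_eq_fintype_card, Nat.card_coe_set_eq]

theorem toEnd_surjective [IsAlgClosed F] {μ : TwistedPoly Fq F} (h : μ ≠ 0) :
    Function.Surjective (toEnd μ) := by
  intro y
  have hd : (μ.toPoly - Polynomial.C y).degree ≠ 0 := by
    have h1 : 0 < μ.toPoly.natDegree := by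
      rw [natDegree_toPoly h]; exact pow_pos Fintype.card_pos _
    have h2 : (μ.toPoly - Polynomial.C y).natDegree = μ.toPoly.natDegree := natDegree_sub_C
    intro h3
    rw [natDegree_eq_zero_iff_degree_le_zero.mpr h3.le] at h2
    omega
  obtain ⟨x, hx⟩ := IsAlgClosed.exists_root _ hd
  refine ⟨x, ?_⟩
  rw [← eval_toPoly]
  simpa [sub_eq_zero] using hx

theorem mul_apply (μ ν : TwistedPoly Fq F) (x : F) : toEnd (μ * ν) x = toEnd μ (toEnd ν x) := by
  rw [map_mul]; rfl

theorem C_apply (c x : F) : toEnd (C Fq F c) x = c * x := by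
  rw [← eval_toPoly, toPoly]
  have h : (C Fq F c).support ⊆ {0} := fun n hn => by
    rw [mem_support, coeff_C] at hn
    simp at hn
    simp [hn]
  rw [Finset.sum_subset h fun n _ hn => by
    rw [mem_support, not_not] at hn; rw [hn]; simp]
  simp [coeff_C]

theorem tau_apply (x : F) : toEnd (tau : TwistedPoly Fq F) x = x ^ Fintype.card Fq := by
  rw [← eval_toPoly, toPoly]
  have h : (tau : TwistedPoly Fq F).support ⊆ {1} := fun n hn => by
    rw [mem_support, coeff_tau] at hn
    simp at hn
    simp [hn]
  rw [Finset.sum_subset h fun n _ hn => by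
    rw [mem_support, not_not] at hn; rw [hn]; simp]
  simp [coeff_tau]

theorem toEnd_const_mul (μ : TwistedPoly Fq F) (c : Fq) (x : F) :
    toEnd μ (constHom Fq F c * x) = constHom Fq F c * toEnd μ x := by
  rw [← C_apply (Fq := Fq), ← mul_apply, ← C_constHom_comm, mul_apply, C_apply]

/-- A twisted polynomial that vanishes on the zeros of `μ` is a left multiple of `μ`, if `μ` has
as many zeros as its degree. -/
theorem exists_eq_mul_of_zeros_subset {μ ν : TwistedPoly Fq F} (hμ : μ ≠ 0)
    (hcard : Fintype.card Fq ^ μ.natDegree ≤ μ.zeros.ncard) (h : μ.zeros ⊆ ν.zeros) :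
    ∃ η, ν = η * μ := by
  obtain ⟨η, ρ, e, hρ⟩ := exists_eq_mul_add hμ ν
  refine ⟨η, ?_⟩
  suffices hρ0 : ρ = 0 by rw [e, hρ0, add_zero]
  by_contra hρ0
  have hlt := hρ.resolve_left hρ0
  have hsub : μ.zeros ⊆ ρ.zeros := fun x hx => by
    have h1 := h hx
    rw [mem_zeros, e, map_add] at h1
    change toEnd (η * μ) x + toEnd ρ x = 0 at h1
    rwa [mul_apply, mem_zeros.mp hx, map_zero, zero_add] at h1
  have h1 := Set.ncard_le_ncard hsub (finite_zeros hρ0)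
  have h2 := ncard_zeros_le hρ0
  have h3 := Nat.pow_lt_pow_right (one_lt_card (Fq := Fq)) hlt
  omega

/-! ### Scalar extension -/

section Map

variable {L : Type*} [Field L] [Algebra (RatFunc Fq) L] (f : F →ₐ[RatFunc Fq] L)

theorem map_tau : map f (tau : TwistedPoly Fq F) = tau := by
  refine ext_coeff fun n => ?_
  rw [coeff_map, coeff_tau, coeff_tau]
  split_ifs <;> simp

theorem support_map (μ : TwistedPoly Fq F) : (map f μ).support = μ.support := by
  ext n
  rw [mem_support, mem_support, coeff_map, _root_.map_ne_zero]

theorem natDegree_map (μ : TwistedPoly Fq F) : (map f μ).natDegree = μ.natDegree := by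
  rw [natDegree, support_map]; rfl

theorem diff_map (μ : TwistedPoly Fq F) : (map f μ).diff = f μ.diff := coeff_map f μ 0

theorem map_apply (μ : TwistedPoly Fq F) (x : F) : toEnd (map f μ) (f x) = f (toEnd μ x) := by
  rw [toEnd_apply, toEnd_apply, support_map, map_sum]
  simp [coeff_map]

end Map

/-! ### Additive polynomials with prescribed zeros -/

/-- The elements fixed by the `q`-Frobenius are the constants. -/
theorem exists_constHom_eq {u : F} (hu : u ^ Fintype.card Fq = u) : ∃ c, constHom Fq F c = u := by
  classical
  have hne : (X ^ Fintype.card Fq - X : F[X]) ≠ 0 :=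
    FiniteField.X_pow_card_sub_X_ne_zero F one_lt_card
  have hsub : Finset.univ.image (constHom Fq F) ⊆
      (X ^ Fintype.card Fq - X : F[X]).roots.toFinset := by
    intro y hy
    obtain ⟨c, -, rfl⟩ := Finset.mem_image.mp hy
    rw [Multiset.mem_toFinset, mem_roots hne]
    simp [← map_pow, FiniteField.pow_card]
  have hcard : (X ^ Fintype.card Fq - X : F[X]).roots.toFinset.card ≤
      (Finset.univ.image (constHom Fq F)).card := by
    rw [Finset.card_image_of_injective _ (constHom Fq F).injective, Finset.card_univ]
    refine (Multiset.toFinset_card_le _).trans ((card_roots' _).trans ?_)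
    rw [FiniteField.X_pow_card_sub_X_natDegree_eq F one_lt_card]
  have hmem : u ∈ (X ^ Fintype.card Fq - X : F[X]).roots.toFinset := by
    rw [Multiset.mem_toFinset, mem_roots hne]
    simp [hu]
  rw [← Finset.eq_of_subset_of_card_le hsub hcard] at hmem
  obtain ⟨c, -, hc⟩ := Finset.mem_image.mp hmem
  exact ⟨c, hc⟩

variable (Fq F) in
/-- The structure of an `𝔽_q`-vector space on a field containing `𝔽_q(T)`. -/
abbrev constModule : Module Fq F := Module.compHom F (constHom Fq F)

/-- A finite-dimensional `𝔽_q`-subspace spanned by elements of a subfield is the zero set of a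
separable additive polynomial over the subfield: if `μ` has the zero set `V` and
`w = μ(x) ≠ 0`, then `(τ - w ^ (q - 1)) μ` has the zero set `V + 𝔽_q x`. -/
theorem exists_zeros_eq_span {L : Type*} [Field L] [Algebra (RatFunc Fq) L]
    (f : F →ₐ[RatFunc Fq] L) (s : Finset F) :
    ∃ μ : TwistedPoly Fq F, μ.diff ≠ 0 ∧ ∀ y : L, y ∈ (map f μ).zeros ↔
      y ∈ (letI := constModule Fq L; Submodule.span Fq (f '' (s : Set F))) := by
  classical
  let := constModule Fq L
  induction s using Finset.induction_on with
  | empty =>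
    refine ⟨1, by rw [diff_one]; exact one_ne_zero, fun y => ?_⟩
    rw [mem_zeros, map_one, map_one]
    simp
  | insert x s _ ih =>
    obtain ⟨μ, hμ, h⟩ := ih
    rw [Finset.coe_insert, Set.image_insert_eq]
    by_cases hx : toEnd μ x = 0
    · refine ⟨μ, hμ, fun y => ?_⟩
      rw [Submodule.span_insert_eq_span]
      · exact h y
      · rw [← h, mem_zeros, map_apply, hx, map_zero]
    set w := toEnd μ x with hw
    refine ⟨(tau - C Fq F (w ^ (Fintype.card Fq - 1))) * μ, ?_, fun y => ?_⟩
    · rw [diff_mul]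
      refine mul_ne_zero ?_ hμ
      rw [diff, coeff_sub, coeff_tau, coeff_C]
      simpa using fun h => absurd h hx
    · have hfw : f w ≠ 0 := (_root_.map_ne_zero f).mpr hx
      have hq : f w ^ Fintype.card Fq = f w ^ (Fintype.card Fq - 1) * f w := by
        rw [← pow_succ, Nat.sub_add_cancel Fintype.card_pos]
      have hy : y ∈ (map f ((tau - C Fq F (w ^ (Fintype.card Fq - 1))) * μ)).zeros ↔
          toEnd (map f μ) y ^ Fintype.card Fq =
            f w ^ (Fintype.card Fq - 1) * toEnd (map f μ) y := by
        rw [mem_zeros, map_mul, mul_apply, map_sub, map_tau, map_C, map_sub, map_pow]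
        refine Iff.trans (Eq.congr_left ?_) sub_eq_zero
        exact congrArg₂ (fun a b : L => a - b) (tau_apply _) (C_apply _ _)
      rw [hy, Submodule.mem_span_insert]
      constructor
      · intro e
        obtain ⟨c, hc⟩ := exists_constHom_eq (Fq := Fq) (u := toEnd (map f μ) y / f w) (by
          rw [div_pow, e, hq]; field_simp)
        refine ⟨c, y - constHom Fq L c * f x, ?_, ?_⟩
        · rw [← h, mem_zeros, map_sub, toEnd_const_mul, map_apply, hc, ← hw]
          field_simp
          simp
        · exact (add_sub_cancel _ _).symm
      · rintro ⟨c, z, hz, rfl⟩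
        rw [← h, mem_zeros] at hz
        rw [map_add, hz, add_zero]
        have e : toEnd (map f μ) (c • f x) = constHom Fq L c * f w :=
          (toEnd_const_mul _ _ _).trans (by rw [map_apply])
        rw [e, mul_pow, ← map_pow, FiniteField.pow_card, hq]
        ring

/-- A finite `𝔽_q`-subspace contained in a subfield is the zero set of a separable additive
polynomial over the subfield. -/
theorem exists_zeros_eq {L : Type*} [Field L] [Algebra (RatFunc Fq) L]
    (f : F →ₐ[RatFunc Fq] L) (H : AddSubgroup L) (hfin : (H : Set L).Finite)
    (hsmul : ∀ (c : Fq), ∀ x ∈ H, constHom Fq L c * x ∈ H) (hH : ∀ x ∈ H, x ∈ Set.range f) :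
    ∃ μ : TwistedPoly Fq F, μ.diff ≠ 0 ∧ (map f μ).zeros = H := by
  classical
  let := constModule Fq L
  let W : Submodule Fq L := { H with smul_mem' := fun c x hx => hsmul c x hx }
  let s : Finset F := (hfin.preimage f.injective.injOn).toFinset
  have hs : f '' (s : Set F) = (W : Set L) := by
    rw [Set.Finite.coe_toFinset]
    exact Set.image_preimage_eq_of_subset hH
  obtain ⟨μ, hμ, h⟩ := exists_zeros_eq_span f s
  refine ⟨μ, hμ, Set.ext fun y => (h y).trans ?_⟩
  rw [hs, Submodule.span_eq]
  rfl

end TwistedPoly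
end Drinfeld

namespace Drinfeld

/-! ### The order ideal of a torsion module over a polynomial ring -/

section Order

variable (k : Type*) [Field k]
variable (M : Type*) [AddCommGroup M] [Module k M] [Module k[X] M] [IsScalarTower k k[X] M]
variable [Module.Finite k M]
variable {N : Type*} [AddCommGroup N] [Module k N] [Module k[X] N] [IsScalarTower k k[X] N]

/-- The multiplication by `X`, as an endomorphism over `k`. -/
abbrev mulX : Module.End k M := Algebra.lsmul k k M (X : k[X])

/-- The order ideal of a `k[X]`-module of finite dimension over `k`: it is generated by the
characteristic polynomial of the multiplication by `X`. -/
def orderIdeal : Ideal k[X] := Ideal.span {(mulX k M).charpoly}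

variable {k M}

theorem aeval_lsmul (p : k[X]) : aeval (mulX k M) p = Algebra.lsmul k k M p := by
  rw [aeval_algHom_apply, aeval_X_left_apply]

variable [Module.Finite k N]

theorem orderIdeal_ne_bot : orderIdeal k M ≠ ⊥ := by
  rw [orderIdeal, Ne, Ideal.span_singleton_eq_bot]
  exact (LinearMap.charpoly_monic _).ne_zero

/-- The order ideal annihilates the module, by the theorem of Cayley and Hamilton. -/
theorem smul_eq_zero_of_mem_orderIdeal {p : k[X]} (hp : p ∈ orderIdeal k M) (x : M) :
    p • x = 0 := by
  obtain ⟨r, rfl⟩ := Ideal.mem_span_singleton'.mp hp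
  have h : Algebra.lsmul k k M (mulX k M).charpoly x = 0 := by
    rw [← aeval_lsmul, LinearMap.aeval_self_charpoly]; rfl
  rw [mul_smul]
  exact (congrArg (r • ·) h).trans (smul_zero r)

theorem finrank_quotient_orderIdeal :
    Module.finrank k (k[X] ⧸ orderIdeal k M) = Module.finrank k M := by
  rw [orderIdeal, finrank_quotient_span_eq_natDegree, LinearMap.charpoly_natDegree]

instance : Module.Finite k (k[X] ⧸ orderIdeal k M) :=
  (AdjoinRoot.powerBasis (LinearMap.charpoly_monic (mulX k M)).ne_zero).finite

theorem natCard_quotient_orderIdeal : Nat.card (k[X] ⧸ orderIdeal k M) = Nat.card M := by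
  rw [Module.natCard_eq_pow_finrank (K := k), Module.natCard_eq_pow_finrank (K := k) (V := M),
    finrank_quotient_orderIdeal]

theorem orderIdeal_eq_top_iff : orderIdeal k M = ⊤ ↔ Subsingleton M := by
  rw [← Module.finrank_eq_zero_iff_of_free k M, ← finrank_quotient_orderIdeal,
    Module.finrank_eq_zero_iff_of_free, Ideal.Quotient.subsingleton_iff]

theorem orderIdeal_congr (e : M ≃ₗ[k[X]] N) : orderIdeal k M = orderIdeal k N := by
  have h : (e.restrictScalars k).conj (mulX k M) = mulX k N := by
    ext y
    simp [LinearEquiv.conj_apply]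
  rw [orderIdeal, orderIdeal, ← h, LinearEquiv.charpoly_conj]

theorem orderIdeal_prod : orderIdeal k (M × N) = orderIdeal k M * orderIdeal k N := by
  have h : mulX k (M × N) =
      (mulX k M).prodMap (mulX k N) := by
    ext <;> simp
  rw [orderIdeal, h, LinearMap.charpoly_prodMap, orderIdeal, orderIdeal,
    Ideal.span_singleton_mul_span_singleton]

/-- The characteristic polynomial is multiplicative along an invariant subspace. -/
theorem charpoly_eq_charpoly_restrict_mul_charpoly_mapQ {V : Type*} [AddCommGroup V] [Module k V]
    [Module.Finite k V] (W : Submodule k V) (e : V →ₗ[k] V) (he : W ≤ W.comap e) :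
    e.charpoly = (e.restrict he).charpoly * (W.mapQ W e he).charpoly := by
  classical
  let bW := Module.Free.chooseBasis k W
  let bQ := Module.Free.chooseBasis k (V ⧸ W)
  let b := Module.Basis.sumQuot bW bQ
  let A := LinearMap.toMatrix bW bW (e.restrict he)
  let B := Matrix.of fun i l ↦ (b.repr (e (b (Sum.inr l)))) (Sum.inl i)
  let D := LinearMap.toMatrix bQ bQ (W.mapQ W e he)
  suffices LinearMap.toMatrix b b e = Matrix.fromBlocks A B 0 D by
    rw [← LinearMap.charpoly_toMatrix e b, this, ← LinearMap.charpoly_toMatrix _ bW,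
      ← LinearMap.charpoly_toMatrix _ bQ, Matrix.charpoly_fromBlocks_zero₂₁]
  ext u v
  cases u with
  | inl i =>
    cases v with
    | inl k =>
      simp only [b, Module.Basis.sumQuot_inl, Matrix.fromBlocks_apply₁₁, A,
        LinearMap.toMatrix_apply]
      apply Module.Basis.sumQuot_repr_inl_of_mem
    | inr l => simp [b, LinearMap.toMatrix_apply, Matrix.fromBlocks_apply₁₂, B]
  | inr j =>
    cases v with
    | inl k =>
      suffices W.mkQ (e (bW k)) = 0 by simp [LinearMap.toMatrix_apply, b, this]
      rw [← LinearMap.mem_ker, Submodule.ker_mkQ]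
      exact he (Submodule.coe_mem (bW k))
    | inr l =>
      simp only [LinearMap.toMatrix_apply, Module.Basis.sumQuot_repr_inr,
        Matrix.fromBlocks_apply₂₂, b, D]
      rw [← Module.Basis.sumQuot_inr bW bQ l, W.mapQ_apply]
      simp

/-- The order ideal is multiplicative in exact sequences `0 → W → M → N → 0`. -/
theorem orderIdeal_eq_mul (W : Submodule k[X] M) [Module.Finite k W] (g : M →ₗ[k[X]] N)
    (hg : Function.Surjective g) (hW : LinearMap.ker g = W) :
    orderIdeal k M = orderIdeal k W * orderIdeal k N := by
  subst hW
  let W := LinearMap.ker (g.restrictScalars k)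
  have hinv : W ≤ W.comap (mulX k M) :=
    fun x hx => (LinearMap.ker g).smul_mem X hx
  have h := charpoly_eq_charpoly_restrict_mul_charpoly_mapQ W
    (mulX k M) hinv
  let e := (g.restrictScalars k).quotKerEquivOfSurjective hg
  have h2 : e.conj (W.mapQ W
      (mulX k M) hinv) = mulX k N := by
    ext y
    obtain ⟨x, rfl⟩ := hg y
    have hx : e.symm (g x) = W.mkQ x :=
      e.symm_apply_eq.mpr rfl
    rw [LinearEquiv.conj_apply_apply, hx]
    exact map_smul g X x
  have h3 : ((mulX k M).restrict hinv).charpoly =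
      (mulX k (LinearMap.ker g)).charpoly := rfl
  rw [h3, ← LinearEquiv.charpoly_conj e, h2] at h
  rw [orderIdeal, h, orderIdeal, orderIdeal, Ideal.span_singleton_mul_span_singleton]

theorem orderIdeal_quotient {I : Ideal k[X]} [Module.Finite k (k[X] ⧸ I)] :
    orderIdeal k (k[X] ⧸ I) = I := by
  obtain ⟨f, rfl⟩ := IsPrincipalIdealRing.principal I
  change orderIdeal k (k[X] ⧸ Ideal.span {f}) = Ideal.span {f}
  change Module.Finite k (k[X] ⧸ Ideal.span {f}) at *
  have hle : f ∣ (mulX k (k[X] ⧸ Ideal.span {f})).charpoly := by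
    rw [← Ideal.mem_span_singleton, ← Ideal.Quotient.eq_zero_iff_mem]
    have := smul_eq_zero_of_mem_orderIdeal (k := k) (M := k[X] ⧸ Ideal.span {f})
      (Ideal.mem_span_singleton_self _) 1
    have e : ∀ p : k[X], p • (1 : k[X] ⧸ Ideal.span {f}) = Ideal.Quotient.mk _ p :=
      fun p => (Algebra.smul_def p (1 : k[X] ⧸ Ideal.span {f})).trans (mul_one _)
    exact (e _).symm.trans this
  have hne := (LinearMap.charpoly_monic (mulX k (k[X] ⧸ Ideal.span {f}))).ne_zero
  rw [orderIdeal, Ideal.span_singleton_eq_span_singleton]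
  refine (associated_of_dvd_of_natDegree_le hle hne ?_).symm
  rw [LinearMap.charpoly_natDegree, finrank_quotient_span_eq_natDegree]

theorem finite_quotient {I : Ideal k[X]} (hI : I ≠ ⊥) : Module.Finite k (k[X] ⧸ I) := by
  obtain ⟨f, rfl⟩ := IsPrincipalIdealRing.principal I
  have hf : f ≠ 0 := by rintro rfl; simp at hI
  exact (AdjoinRoot.powerBasis hf).finite

theorem orderIdeal_pi {n : ℕ} {P : Fin n → Type*} [∀ i, AddCommGroup (P i)] [∀ i, Module k (P i)]
    [∀ i, Module k[X] (P i)] [∀ i, IsScalarTower k k[X] (P i)] [∀ i, Module.Finite k (P i)] :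
    orderIdeal k ((i : Fin n) → P i) = ∏ i, orderIdeal k (P i) := by
  induction n with
  | zero =>
    rw [Fin.prod_univ_zero, Ideal.one_eq_top, orderIdeal_eq_top_iff]
    infer_instance
  | succ n ih =>
    rw [Fin.prod_univ_succ, ← orderIdeal_congr (Fin.consLinearEquiv k[X] P), orderIdeal_prod, ih]

/-- The structure theorem, with non-trivial cyclic summands. -/
theorem exists_linearEquiv_pi_quotient :
    ∃ (n : ℕ) (𝔫 : Fin n → Ideal k[X]), (∀ i, 𝔫 i ≠ ⊥ ∧ 𝔫 i ≠ ⊤) ∧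
      Nonempty (M ≃ₗ[k[X]] ((i : Fin n) → k[X] ⧸ 𝔫 i)) := by
  classical
  have : Module.Finite k[X] M := Module.Finite.of_restrictScalars_finite k k[X] M
  have htor : Module.IsTorsion k[X] M := fun x =>
    ⟨⟨_, mem_nonZeroDivisors_of_ne_zero
      (LinearMap.charpoly_monic (mulX k M)).ne_zero⟩,
      smul_eq_zero_of_mem_orderIdeal (Ideal.mem_span_singleton_self _) x⟩
  obtain ⟨ι, _, p, hp, e, ⟨E⟩⟩ := Module.equiv_directSum_of_isTorsion htor
  let I : ι → Ideal k[X] := fun i => Ideal.span {p i ^ e i}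
  let E' : M ≃ₗ[k[X]] ((i : ι) → k[X] ⧸ I i) := E.trans (DirectSum.linearEquivFunOnFintype _ _ _)
  let r : ((i : ι) → k[X] ⧸ I i) →ₗ[k[X]] ((i : {i : ι // I i ≠ ⊤}) → k[X] ⧸ I i.1) :=
    LinearMap.pi fun i => LinearMap.proj i.1
  have hr : Function.Bijective r := by
    constructor
    · intro x y hxy
      ext i
      by_cases hi : I i = ⊤
      · have : Subsingleton (k[X] ⧸ I i) := Ideal.Quotient.subsingleton_iff.mpr hi
        exact Subsingleton.elim _ _
      · exact congrFun hxy ⟨i, hi⟩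
    · intro y
      refine ⟨fun i => if h : I i ≠ ⊤ then y ⟨i, h⟩ else 0, ?_⟩
      ext i
      exact dif_pos i.2
  let c := Fintype.equivFin {i : ι // I i ≠ ⊤}
  refine ⟨_, fun j => I (c.symm j).1, fun j => ⟨?_, (c.symm j).2⟩,
    ⟨(E'.trans (LinearEquiv.ofBijective r hr)).trans
      (LinearEquiv.piCongrLeft k[X] (fun i : {i : ι // I i ≠ ⊤} => k[X] ⧸ I i.1) c.symm).symm⟩⟩
  rw [Ne, Ideal.span_singleton_eq_bot]
  exact pow_ne_zero _ (hp _).ne_zero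

/-- The order ideal is the product of the ideals in any decomposition into cyclic modules. -/
theorem orderIdeal_eq_prod {n : ℕ} {𝔫 : Fin n → Ideal k[X]} (h : ∀ i, 𝔫 i ≠ ⊥)
    (e : M ≃ₗ[k[X]] ((i : Fin n) → k[X] ⧸ 𝔫 i)) : orderIdeal k M = ∏ i, 𝔫 i := by
  have := fun i => finite_quotient (h i)
  rw [orderIdeal_congr e, orderIdeal_pi]
  simp only [orderIdeal_quotient]

/-- If a prime `p` divides the order ideal, then there is non-zero `p`-torsion. -/
theorem exists_torsion_of_orderIdeal_le {p : k[X]} (hp : Prime p)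
    (h : orderIdeal k M ≤ Ideal.span {p}) : ∃ x : M, x ≠ 0 ∧ p • x = 0 := by
  classical
  obtain ⟨n, 𝔫, h𝔫, ⟨e⟩⟩ := exists_linearEquiv_pi_quotient (k := k) (M := M)
  rw [orderIdeal_eq_prod (fun i => (h𝔫 i).1) e] at h
  obtain ⟨i, -, hi⟩ := (Ideal.IsPrime.prod_le
    ((Ideal.span_singleton_prime hp.ne_zero).mpr hp)).mp h
  obtain ⟨f, hf⟩ : ∃ f, 𝔫 i = Ideal.span {f} := (IsPrincipalIdealRing.principal (𝔫 i)).principal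
  have hf0 : f ≠ 0 := by
    rintro rfl
    exact (h𝔫 i).1 (by simpa using hf)
  rw [hf, Ideal.span_singleton_le_span_singleton] at hi
  obtain ⟨m, rfl⟩ := hi
  refine ⟨e.symm (Pi.single i (Ideal.Quotient.mk (𝔫 i) m)), ?_, ?_⟩
  · rw [Ne, EmbeddingLike.map_eq_zero_iff, Pi.single_eq_zero_iff, Ideal.Quotient.eq_zero_iff_mem,
      hf, Ideal.mem_span_singleton]
    intro hd
    refine hp.not_isUnit (isUnit_of_dvd_one ?_)
    refine (mul_dvd_mul_iff_right (right_ne_zero_of_mul hf0)).mp ?_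
    rwa [one_mul]
  · rw [← map_smul, ← Pi.single_smul, EmbeddingLike.map_eq_zero_iff, Pi.single_eq_zero_iff]
    change Ideal.Quotient.mk (𝔫 i) (p * m) = 0
    rw [Ideal.Quotient.eq_zero_iff_mem, hf]
    exact Ideal.mem_span_singleton_self _

/-- A module annihilated by a prime `p` has a power of `p` as its order ideal. -/
theorem exists_orderIdeal_eq_pow {p : k[X]} (hp : Prime p) (h : ∀ x : M, p • x = 0) :
    ∃ n, orderIdeal k M = Ideal.span {p} ^ n ∧ n * p.natDegree = Module.finrank k M := by
  obtain ⟨n, 𝔫, h𝔫, ⟨e⟩⟩ := exists_linearEquiv_pi_quotient (k := k) (M := M)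
  have hmax : (Ideal.span {p}).IsMaximal :=
    PrincipalIdealRing.isMaximal_of_irreducible hp.irreducible
  have heq : ∀ i, 𝔫 i = Ideal.span {p} := fun i => by
    refine (hmax.eq_of_le (h𝔫 i).2 ?_).symm
    rw [Ideal.span_singleton_le_iff_mem, ← Ideal.Quotient.eq_zero_iff_mem]
    have h1 := h (e.symm fun i => 1)
    rw [← map_smul, EmbeddingLike.map_eq_zero_iff] at h1
    exact ((Algebra.smul_def p (1 : k[X] ⧸ 𝔫 i)).trans (mul_one _)).symm.trans (congrFun h1 i)
  have hord : orderIdeal k M = Ideal.span {p} ^ n := by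
    rw [orderIdeal_eq_prod (fun i => (h𝔫 i).1) e, Finset.prod_congr rfl fun i _ => heq i]
    simp
  refine ⟨n, hord, ?_⟩
  rw [← finrank_quotient_orderIdeal, hord, Ideal.span_singleton_pow,
    finrank_quotient_span_eq_natDegree, natDegree_pow]

/-- The submodule generated by a non-zero element annihilated by a prime `p` is isomorphic to
`k[X] / (p)`. -/
theorem orderIdeal_span_singleton {P : Type*} [AddCommGroup P] [Module k P] [Module k[X] P]
    [IsScalarTower k k[X] P] {p : k[X]} (hp : Prime p) {x : P} (hx : x ≠ 0)
    (hpx : p • x = 0) [Module.Finite k (Submodule.span k[X] {x})] :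
    orderIdeal k (Submodule.span k[X] {x}) = Ideal.span {p} := by
  have hmax : (Ideal.span {p}).IsMaximal :=
    PrincipalIdealRing.isMaximal_of_irreducible hp.irreducible
  have ht : Ideal.torsionOf k[X] P x = Ideal.span {p} := by
    refine (hmax.eq_of_le (fun ht => hx ?_) ?_).symm
    · rwa [Ideal.torsionOf_eq_top_iff] at ht
    · rwa [Ideal.span_singleton_le_iff_mem, Ideal.mem_torsionOf_iff]
  have hfin : Module.Finite k (k[X] ⧸ Ideal.torsionOf k[X] P x) := by
    rw [ht]
    exact finite_quotient (by simpa using hp.ne_zero)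
  rw [← orderIdeal_congr (Ideal.quotTorsionOfEquivSpanSingleton k[X] P x), orderIdeal_quotient, ht]

end Order
end Drinfeld

namespace Drinfeld

variable {Fq : Type*} [Field Fq] [Fintype Fq]

theorem incl_injective (F : Type*) [Field F] [Algebra (RatFunc Fq) F] :
    Function.Injective (incl Fq F) :=
  (algebraMap (RatFunc Fq) F).injective.comp (IsFractionRing.injective Fq[X] (RatFunc Fq))

namespace DrinfeldModule

variable {F : Type*} [Field F] [Algebra (RatFunc Fq) F]

/-! ### Drinfeld modules and their points -/

theorem toAlgHom_ne_zero (φ : DrinfeldModule Fq F) {a : Fq[X]} (ha : a ≠ 0) :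
    φ.toAlgHom a ≠ 0 := by
  refine TwistedPoly.ne_zero_of_diff_ne_zero ?_
  rw [φ.diff_eq]
  exact (map_ne_zero_iff _ (incl_injective F)).mpr ha

theorem toAlgHom_C (φ : DrinfeldModule Fq F) (c : Fq) :
    φ.toAlgHom (C c) = TwistedPoly.C Fq F (constHom Fq F c) := φ.toAlgHom.commutes c

theorem natDegree_toAlgHom (φ : DrinfeldModule Fq F) (hr : 0 < φ.rank) {a : Fq[X]} (ha : a ≠ 0) :
    (φ.toAlgHom a).natDegree = φ.rank * a.natDegree := by
  induction hn : a.natDegree generalizing a with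
  | zero =>
    rw [eq_C_of_natDegree_eq_zero hn, toAlgHom_C, TwistedPoly.natDegree_C, mul_zero]
  | succ n ih =>
    have hdiv : a.divX ≠ 0 := by
      intro h
      rw [divX_eq_zero_iff] at h
      rw [h, natDegree_C] at hn
      omega
    have hdeg : a.divX.natDegree = n := by rw [natDegree_divX_eq_natDegree_tsub_one, hn]; rfl
    have h1 : (φ.toAlgHom a.divX * φ.toAlgHom X).natDegree = φ.rank * (n + 1) := by
      rw [TwistedPoly.natDegree_mul (φ.toAlgHom_ne_zero hdiv) (φ.toAlgHom_ne_zero X_ne_zero),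
        ih hdiv hdeg, mul_add, mul_one]
      rfl
    have hne : φ.toAlgHom a.divX * φ.toAlgHom X ≠ 0 :=
      mul_ne_zero (φ.toAlgHom_ne_zero hdiv) (φ.toAlgHom_ne_zero X_ne_zero)
    have h2 := TwistedPoly.coeff_natDegree_ne_zero hne
    rw [h1] at h2
    have hpos : 0 < φ.rank * (n + 1) := by positivity
    rw [← divX_mul_X_add a, map_add, map_mul, toAlgHom_C]
    refine TwistedPoly.natDegree_eq_of_coeff ?_ fun m hm => ?_
    · rwa [TwistedPoly.coeff_add, TwistedPoly.coeff_C, if_neg hpos.ne', add_zero]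
    · rw [TwistedPoly.coeff_add, TwistedPoly.coeff_C, if_neg (by omega), add_zero]
      exact TwistedPoly.coeff_eq_zero_of_natDegree_lt (h1 ▸ hm)

instance (φ : DrinfeldModule Fq F) : Module Fq φ.Points :=
  Module.compHom φ.Points (C : Fq →+* Fq[X])

instance (φ : DrinfeldModule Fq F) : IsScalarTower Fq Fq[X] φ.Points :=
  ⟨fun c p x => by rw [smul_eq_C_mul, mul_smul]; rfl⟩

theorem C_smul_points (φ : DrinfeldModule Fq F) (c : Fq) (x : F) :
    @HSMul.hSMul Fq[X] φ.Points φ.Points _ (C c) x = constHom Fq F c * x :=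
  (congrArg (fun μ => TwistedPoly.toEnd μ x) (φ.toAlgHom_C c)).trans (TwistedPoly.C_apply _ _)

theorem map_toAlgHom {L : Type*} [Field L] [Algebra (RatFunc Fq) L] (f : F →ₐ[RatFunc Fq] L)
    (φ : DrinfeldModule Fq F) (a : Fq[X]) :
    (φ.map f).toAlgHom a = TwistedPoly.map f (φ.toAlgHom a) := rfl

theorem rank_map {L : Type*} [Field L] [Algebra (RatFunc Fq) L] (f : F →ₐ[RatFunc Fq] L)
    (φ : DrinfeldModule Fq F) : (φ.map f).rank = φ.rank := TwistedPoly.natDegree_map f _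

/-! ### Isogenies -/

variable {φ ψ χ : DrinfeldModule Fq F}

theorem incl_X_pow_ne (n : ℕ) (hn : 1 < n) : incl Fq F X ^ n ≠ incl Fq F X := by
  intro h
  rw [← map_pow] at h
  have := congrArg natDegree (incl_injective F h)
  rw [natDegree_X_pow, natDegree_X] at this
  omega

/-- A non-zero twisted polynomial that intertwines two Drinfeld modules over a field containing
`𝔽_q(T)` is separable: comparing the lowest coefficients of `μ φ_T = ψ_T μ` gives
`T ^ (q ^ k) = T` for the lowest exponent `k` of `μ`. -/
theorem diff_ne_zero_of_comm {μ : TwistedPoly Fq F} (h0 : μ ≠ 0)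
    (h : μ * φ.toAlgHom X = ψ.toAlgHom X * μ) : μ.diff ≠ 0 := by
  classical
  have hex : ∃ k, μ.coeff k ≠ 0 := ⟨_, TwistedPoly.coeff_natDegree_ne_zero h0⟩
  let k := Nat.find hex
  have hk : μ.coeff k ≠ 0 := Nat.find_spec hex
  have hlow : ∀ j < k, μ.coeff j = 0 := fun j hj => not_not.mp (Nat.find_min hex hj)
  by_cases hk0 : k = 0
  · rw [hk0] at hk; exact hk
  exfalso
  have e := congrArg (fun ν => TwistedPoly.coeff ν k) h
  simp only [TwistedPoly.coeff_mul] at e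
  rw [Finset.sum_eq_single (k, 0), Finset.sum_eq_single (0, k)] at e
  · have h1 : (φ.toAlgHom X).coeff 0 = incl Fq F X := φ.diff_eq X
    have h2 : (ψ.toAlgHom X).coeff 0 = incl Fq F X := ψ.diff_eq X
    simp only [h1, h2, pow_zero, pow_one] at e
    rw [mul_comm] at e
    exact incl_X_pow_ne (F := F) _ (Nat.one_lt_pow hk0 (TwistedPoly.one_lt_card (Fq := Fq)))
      (mul_right_cancel₀ hk e)
  · rintro ⟨i, j⟩ hij hne
    rw [Finset.HasAntidiagonal.mem_antidiagonal] at hij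
    have hj : j < k := by
      rcases Nat.eq_zero_or_pos i with hi | hi
      · exact absurd (by ext <;> simp <;> omega) hne
      · dsimp only at hij; omega
    dsimp only
    rw [hlow j hj, zero_pow (by simp), mul_zero]
  · simp
  · rintro ⟨i, j⟩ hij hne
    rw [Finset.HasAntidiagonal.mem_antidiagonal] at hij
    have hi : i < k := by
      rcases Nat.eq_zero_or_pos j with hj | hj
      · exact absurd (by ext <;> simp <;> omega) hne
      · dsimp only at hij; omega
    dsimp only
    rw [hlow i hi, zero_mul]
  · simp

namespace Isogeny

theorem diff_ne_zero (μ : Isogeny φ ψ) : μ.val.diff ≠ 0 :=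
  diff_ne_zero_of_comm μ.ne_zero (μ.comm X)

/-- The composition `η μ` of isogenies. -/
def comp (η : Isogeny ψ χ) (μ : Isogeny φ ψ) : Isogeny φ χ where
  val := η.val * μ.val
  ne_zero := mul_ne_zero η.ne_zero μ.ne_zero
  comm a := by rw [mul_assoc, μ.comm, ← mul_assoc, η.comm, mul_assoc]

theorem comp_val (η : Isogeny ψ χ) (μ : Isogeny φ ψ) : (η.comp μ).val = η.val * μ.val := rfl

/-- The endomorphism `φ_a` of `φ`, for `a ≠ 0`. -/
def mulBy (φ : DrinfeldModule Fq F) {a : Fq[X]} (ha : a ≠ 0) : Isogeny φ φ where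
  val := φ.toAlgHom a
  ne_zero := φ.toAlgHom_ne_zero ha
  comm b := by rw [← map_mul, ← map_mul, mul_comm]

theorem mulBy_val {a : Fq[X]} (ha : a ≠ 0) : (mulBy φ ha).val = φ.toAlgHom a := rfl

theorem ext_val {μ ν : Isogeny φ ψ} (h : μ.val = ν.val) : μ = ν := by
  cases μ; cases ν; cases h; rfl

theorem rank_eq (μ : Isogeny φ ψ) : φ.rank = ψ.rank := by
  have h := congrArg TwistedPoly.natDegree (μ.comm X)
  rw [TwistedPoly.natDegree_mul μ.ne_zero (φ.toAlgHom_ne_zero X_ne_zero),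
    TwistedPoly.natDegree_mul (ψ.toAlgHom_ne_zero X_ne_zero) μ.ne_zero] at h
  exact Nat.add_left_cancel (h.trans (add_comm _ _))

theorem mem_ker {μ : Isogeny φ ψ} {x : φ.Points} : x ∈ μ.ker ↔ μ.toLinearMap x = 0 := Iff.rfl

theorem toLinearMap_comp (η : Isogeny ψ χ) (μ : Isogeny φ ψ) (x : φ.Points) :
    (η.comp μ).toLinearMap x = η.toLinearMap (μ.toLinearMap x) :=
  TwistedPoly.mul_apply η.val μ.val x

theorem toLinearMap_mulBy {a : Fq[X]} (ha : a ≠ 0) (x : φ.Points) :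
    (mulBy φ ha).toLinearMap x = a • x := rfl

instance (μ : Isogeny φ ψ) : Finite μ.ker := TwistedPoly.finite_zeros (F := F) μ.ne_zero

theorem isIso_of_natDegree_eq_zero {μ : Isogeny φ ψ} (h : μ.val.natDegree = 0) : μ.IsIso :=
  ⟨_, μ.diff_ne_zero, TwistedPoly.eq_C_of_natDegree_eq_zero h⟩

theorem IsIso.natDegree_eq_zero {μ : Isogeny φ ψ} (h : μ.IsIso) : μ.val.natDegree = 0 := by
  obtain ⟨c, -, hc⟩ := h
  rw [hc, TwistedPoly.natDegree_C]

theorem natDegree_comp (η : Isogeny ψ χ) (μ : Isogeny φ ψ) :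
    (η.comp μ).val.natDegree = η.val.natDegree + μ.val.natDegree :=
  TwistedPoly.natDegree_mul η.ne_zero μ.ne_zero

/-- An isomorphism has an inverse. -/
theorem IsIso.exists_inv {μ : Isogeny φ ψ} (h : μ.IsIso) :
    ∃ η : Isogeny ψ φ, η.IsIso ∧ η.val * μ.val = 1 ∧ μ.val * η.val = 1 := by
  obtain ⟨η, d, hd, hη⟩ := h.symm
  obtain ⟨c, hc, hμ⟩ := h
  refine ⟨(⟨TwistedPoly.C Fq F c⁻¹, ?_, fun a => ?_⟩ : Isogeny ψ φ), ⟨_, inv_ne_zero hc, rfl⟩,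
    ?_, ?_⟩
  · exact (map_ne_zero_iff _ TwistedPoly.C_injective).mpr (inv_ne_zero hc)
  · have h2 : TwistedPoly.C Fq F c⁻¹ * TwistedPoly.C Fq F c = 1 := by
      rw [← map_mul, inv_mul_cancel₀ hc, map_one]
    have h3 : TwistedPoly.C Fq F c * TwistedPoly.C Fq F c⁻¹ = 1 := by
      rw [← map_mul, mul_inv_cancel₀ hc, map_one]
    have e := μ.comm a
    rw [hμ] at e
    calc TwistedPoly.C Fq F c⁻¹ * ψ.toAlgHom a
        = TwistedPoly.C Fq F c⁻¹ * (ψ.toAlgHom a * TwistedPoly.C Fq F c) *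
            TwistedPoly.C Fq F c⁻¹ := by rw [mul_assoc, mul_assoc, h3, mul_one]
      _ = φ.toAlgHom a * TwistedPoly.C Fq F c⁻¹ := by
          rw [← e, ← mul_assoc, h2, one_mul]
  · change TwistedPoly.C Fq F c⁻¹ * μ.val = 1
    rw [hμ, ← map_mul, inv_mul_cancel₀ hc, map_one]
  · change μ.val * TwistedPoly.C Fq F c⁻¹ = 1
    rw [hμ, ← map_mul, mul_inv_cancel₀ hc, map_one]

section AlgClosed

variable [IsAlgClosed F]

theorem natCard_ker (μ : Isogeny φ ψ) :
    Nat.card μ.ker = Fintype.card Fq ^ μ.val.natDegree := by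
  rw [← TwistedPoly.ncard_zeros μ.diff_ne_zero]
  exact Nat.card_coe_set_eq _

theorem finrank_ker (μ : Isogeny φ ψ) : Module.finrank Fq μ.ker = μ.val.natDegree := by
  have h := Module.natCard_eq_pow_finrank (K := Fq) (V := μ.ker)
  rw [natCard_ker, Nat.card_eq_fintype_card] at h
  exact (Nat.pow_right_injective (TwistedPoly.one_lt_card (Fq := Fq)) h).symm

theorem toLinearMap_surjective (μ : Isogeny φ ψ) : Function.Surjective μ.toLinearMap :=
  TwistedPoly.toEnd_surjective (F := F) μ.ne_zero

/-- An isogeny that vanishes on the kernel of `μ` factors through `μ`. -/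
theorem exists_factor {μ : Isogeny φ ψ} {ν : Isogeny φ χ} (h : μ.ker ≤ ν.ker) :
    ∃ η : Isogeny ψ χ, ν = η.comp μ := by
  obtain ⟨η, e⟩ := TwistedPoly.exists_eq_mul_of_zeros_subset (ν := ν.val) μ.ne_zero
    (TwistedPoly.ncard_zeros μ.diff_ne_zero).ge h
  refine ⟨⟨η, fun h0 => ν.ne_zero (by rw [e, h0, zero_mul]), fun a => ?_⟩, ext_val e⟩
  refine mul_right_cancel₀ μ.ne_zero ?_
  rw [mul_assoc, ← μ.comm, ← mul_assoc, ← e, ν.comm, e, mul_assoc]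

/-- If `a` annihilates the kernel of `μ`, then `μ` has a dual with respect to `a`. -/
theorem exists_dual {μ : Isogeny φ ψ} {a : Fq[X]} (ha : a ≠ 0) (h : ∀ x ∈ μ.ker, a • x = 0) :
    ∃ η : Isogeny ψ φ, η.comp μ = mulBy φ ha ∧ μ.comp η = mulBy ψ ha := by
  obtain ⟨η, e⟩ := exists_factor (μ := μ) (ν := mulBy φ ha) h
  refine ⟨η, e.symm, ext_val ?_⟩
  refine mul_right_cancel₀ μ.ne_zero ?_
  have e' : φ.toAlgHom a = η.val * μ.val := congrArg val e
  rw [comp_val, mulBy_val, mul_assoc, ← e', μ.comm]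

theorem isDegree_orderIdeal (μ : Isogeny φ ψ) : μ.IsDegree (orderIdeal Fq μ.ker) := by
  obtain ⟨n, 𝔫, h, ⟨e⟩⟩ := exists_linearEquiv_pi_quotient (k := Fq) (M := μ.ker)
  exact ⟨n, 𝔫, h, ⟨e⟩, orderIdeal_eq_prod (fun i => (h i).1) e⟩

/-- The degree of an isogeny is the order ideal of its kernel. -/
theorem degree_eq_orderIdeal (μ : Isogeny φ ψ) : μ.degree = orderIdeal Fq μ.ker := by
  obtain ⟨n, 𝔫, h, ⟨e⟩, h𝔡⟩ := Classical.epsilon_spec ⟨_, μ.isDegree_orderIdeal⟩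
  rw [orderIdeal_eq_prod (fun i => (h i).1) e, ← h𝔡]
  rfl

theorem degree_ne_bot (μ : Isogeny φ ψ) : μ.degree ≠ ⊥ := by
  rw [degree_eq_orderIdeal]
  exact orderIdeal_ne_bot

theorem smul_eq_zero_of_mem_degree {μ : Isogeny φ ψ} {a : Fq[X]} (ha : a ∈ μ.degree)
    {x : φ.Points} (hx : x ∈ μ.ker) : a • x = 0 := by
  rw [degree_eq_orderIdeal] at ha
  exact congrArg Subtype.val (smul_eq_zero_of_mem_orderIdeal ha (⟨x, hx⟩ : μ.ker))

theorem exists_mem_degree (μ : Isogeny φ ψ) : ∃ a ∈ μ.degree, a ≠ 0 :=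
  Submodule.exists_mem_ne_zero_of_ne_bot μ.degree_ne_bot

theorem degree_eq_one_iff {μ : Isogeny φ ψ} : μ.degree = 1 ↔ μ.IsIso := by
  rw [degree_eq_orderIdeal, Ideal.one_eq_top, orderIdeal_eq_top_iff,
    ← Module.finrank_eq_zero_iff_of_free Fq, finrank_ker]
  exact ⟨isIso_of_natDegree_eq_zero, IsIso.natDegree_eq_zero⟩

/-- The kernel of `η μ` is an extension of the kernel of `η` by the kernel of `μ`. -/
theorem degree_comp (η : Isogeny ψ χ) (μ : Isogeny φ ψ) :
    (η.comp μ).degree = μ.degree * η.degree := by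
  simp only [degree_eq_orderIdeal]
  have hle : μ.ker ≤ (η.comp μ).ker := fun x hx => by
    rw [mem_ker, toLinearMap_comp, mem_ker.mp hx, map_zero]
  let g : (η.comp μ).ker →ₗ[Fq[X]] η.ker :=
    μ.toLinearMap.restrict fun x hx => by
      rw [mem_ker, ← toLinearMap_comp]; exact hx
  have hg : Function.Surjective g := by
    rintro ⟨y, hy⟩
    obtain ⟨x, rfl⟩ := μ.toLinearMap_surjective y
    exact ⟨⟨x, by rw [mem_ker, toLinearMap_comp]; exact hy⟩, rfl⟩
  have hker : LinearMap.ker g = μ.ker.comap (η.comp μ).ker.subtype := by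
    ext x
    rw [LinearMap.mem_ker, Submodule.mem_comap, mem_ker, ← Subtype.coe_inj]
    rfl
  rw [orderIdeal_eq_mul _ g hg hker,
    orderIdeal_congr (Submodule.comapSubtypeEquivOfLe hle)]

/-- The kernel of `φ_p` is annihilated by `p`, so that its order ideal is a power of `(p)`; the
exponent is found by counting points. -/
theorem degree_mulBy_of_prime (hr : 0 < φ.rank) {p : Fq[X]} (hp : Prime p) :
    (mulBy φ hp.ne_zero).degree = Ideal.span {p} ^ φ.rank := by
  rw [degree_eq_orderIdeal]
  obtain ⟨n, h, hn⟩ := exists_orderIdeal_eq_pow (M := (mulBy φ hp.ne_zero).ker) hp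
    (fun x => Subtype.ext (show p • (x : φ.Points) = 0 from x.2))
  rw [finrank_ker, mulBy_val, natDegree_toAlgHom _ hr hp.ne_zero] at hn
  have hpos : 0 < p.natDegree := hp.irreducible.natDegree_pos
  rw [h, Nat.eq_of_mul_eq_mul_right hpos hn]

theorem degree_mulBy (hr : 0 < φ.rank) {a : Fq[X]} (ha : a ≠ 0) :
    (mulBy φ ha).degree = Ideal.span {a} ^ φ.rank := by
  induction a using UniqueFactorizationMonoid.induction_on_prime with
  | h₁ => exact absurd rfl ha
  | h₂ a hu =>
    rw [Ideal.span_singleton_eq_top.mpr hu, ← Ideal.one_eq_top, one_pow, degree_eq_one_iff]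
    refine isIso_of_natDegree_eq_zero ?_
    rw [mulBy_val, natDegree_toAlgHom _ hr ha, natDegree_eq_zero_of_isUnit hu, mul_zero]
  | h₃ a p ha0 hp ih =>
    have e : mulBy φ ha = (mulBy φ hp.ne_zero).comp (mulBy φ ha0) :=
      ext_val (map_mul φ.toAlgHom p a)
    rw [e, degree_comp, ih, degree_mulBy_of_prime hr hp, ← mul_pow,
      Ideal.span_singleton_mul_span_singleton, mul_comm]

end AlgClosed

end Isogeny

/-! ### Quotients -/

/-- A finite submodule of points defined over a subfield is the kernel of an isogeny to a Drinfeld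
module over the subfield, and the isogeny is defined over the subfield as well. -/
theorem exists_quotient {L : Type*} [Field L] [Algebra (RatFunc Fq) L] [IsAlgClosed L]
    (f : F →ₐ[RatFunc Fq] L) (φ : DrinfeldModule Fq F) (H : Submodule Fq[X] (φ.map f).Points)
    (hfin : Finite H) (hH : ∀ x ∈ H, x ∈ Set.range f) :
    ∃ (ψ : DrinfeldModule Fq F) (μ : Isogeny (φ.map f) (ψ.map f)) (μ₀ : TwistedPoly Fq F),
      μ.ker = H ∧ μ.val = TwistedPoly.map f μ₀ := by
  let HL : AddSubgroup L := H.toAddSubgroup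
  have hsmul : ∀ (c : Fq), ∀ x ∈ HL, constHom Fq L c * x ∈ HL := by
    intro c x hx
    have h := (φ.map f).C_smul_points c x
    exact h ▸ H.smul_mem (C c) hx
  obtain ⟨μ, hμ, hz⟩ := TwistedPoly.exists_zeros_eq f HL hfin hsmul hH
  have hμ0 := TwistedPoly.ne_zero_of_diff_ne_zero hμ
  have hdiff : (TwistedPoly.map f μ).diff ≠ 0 := by
    rw [TwistedPoly.diff_map]; exact (_root_.map_ne_zero f).mpr hμ
  -- dividing `μ φ_T` by `μ` over the subfield leaves a remainder with too many zeros, so that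
  -- `μ φ_T = ψ_T μ` for some `ψ_T`
  obtain ⟨ψT, ρ, e, hρ⟩ := TwistedPoly.exists_eq_mul_add hμ0 (μ * φ.toAlgHom X)
  have hρ0 : ρ = 0 := by
    by_contra hne
    have hlt := hρ.resolve_left hne
    have hne' : TwistedPoly.map f ρ ≠ 0 := by
      rwa [Ne, map_eq_zero_iff _ (TwistedPoly.map_injective f)]
    have hsub : (TwistedPoly.map f μ).zeros ⊆ (TwistedPoly.map f ρ).zeros := by
      intro x hx
      have hxH : X • (show (φ.map f).Points from x) ∈ H :=
        H.smul_mem X (by rw [hz] at hx; exact hx)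
      have h1 : TwistedPoly.toEnd (TwistedPoly.map f μ)
          (TwistedPoly.toEnd (TwistedPoly.map f (φ.toAlgHom X)) x) = 0 := by
        rw [← TwistedPoly.mem_zeros, hz]; exact hxH
      have e' := congrArg (fun ν => TwistedPoly.toEnd (TwistedPoly.map f ν) x) e
      simp only [map_mul, map_add] at e'
      have e2 : TwistedPoly.toEnd (TwistedPoly.map f μ)
          (TwistedPoly.toEnd (TwistedPoly.map f (φ.toAlgHom X)) x) =
          TwistedPoly.toEnd (TwistedPoly.map f ψT) (TwistedPoly.toEnd (TwistedPoly.map f μ) x) +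
          TwistedPoly.toEnd (TwistedPoly.map f ρ) x := e'
      rw [h1, TwistedPoly.mem_zeros.mp hx, map_zero, zero_add] at e2
      exact e2.symm
    have h1 := Set.ncard_le_ncard hsub (TwistedPoly.finite_zeros hne')
    have h2 := TwistedPoly.ncard_zeros_le hne'
    rw [TwistedPoly.ncard_zeros hdiff, TwistedPoly.natDegree_map] at h1
    rw [TwistedPoly.natDegree_map] at h2
    have h3 := Nat.pow_lt_pow_right (TwistedPoly.one_lt_card (Fq := Fq)) hlt
    omega
  rw [hρ0, add_zero] at e
  have hcomm : ∀ a, μ * φ.toAlgHom a = aeval ψT a * μ := by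
    intro a
    induction a using Polynomial.induction_on' with
    | add a b ha hb => rw [map_add, map_add, mul_add, add_mul, ha, hb]
    | monomial n c =>
      rw [← C_mul_X_pow_eq_monomial, map_mul, map_mul, toAlgHom_C, aeval_C, map_pow, map_pow,
        aeval_X, TwistedPoly.algebraMap_eq, ← mul_assoc, ← TwistedPoly.C_constHom_comm, mul_assoc,
        mul_assoc]
      congr 1
      induction n with
      | zero => simp
      | succ n ih => rw [pow_succ, ← mul_assoc, ih, mul_assoc, e, ← mul_assoc, ← pow_succ]
  let ψ : DrinfeldModule Fq F :=
    { toAlgHom := aeval ψT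
      diff_eq := fun a => by
        have h := congrArg TwistedPoly.diff (hcomm a)
        rw [TwistedPoly.diff_mul, TwistedPoly.diff_mul, φ.diff_eq, mul_comm] at h
        exact (mul_right_cancel₀ hμ h).symm
      nontrivial := by
        obtain ⟨a, ha⟩ := φ.nontrivial
        refine ⟨a, fun h => ha ?_⟩
        by_cases ha0 : a = 0
        · simp [ha0]
        have hd := congrArg TwistedPoly.natDegree (hcomm a)
        rw [h, TwistedPoly.natDegree_mul hμ0 (φ.toAlgHom_ne_zero ha0),
          TwistedPoly.natDegree_mul _ hμ0, TwistedPoly.natDegree_C] at hd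
        · rw [TwistedPoly.eq_C_of_natDegree_eq_zero (μ := φ.toAlgHom a) (by omega), φ.diff_eq]
        · rw [map_ne_zero_iff _ TwistedPoly.C_injective, map_ne_zero_iff _ (incl_injective F)]
          exact ha0 }
  refine ⟨ψ, ⟨TwistedPoly.map f μ, TwistedPoly.ne_zero_of_diff_ne_zero hdiff, fun a => ?_⟩, μ,
    ?_, rfl⟩
  · rw [map_toAlgHom, map_toAlgHom, ← map_mul, hcomm, map_mul]
  · exact SetLike.coe_injective hz

end DrinfeldModule
end Drinfeld

namespace Drinfeld

variable {Fq : Type*} [Field Fq] [Fintype Fq]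

/-! ### Isogenies between Drinfeld modules without extra endomorphisms -/

theorem exists_isCoprime_factor {b : Fq[X]} (hb : b ≠ 0) (c : Fq[X]) :
    ∃ g b' c', b = g * b' ∧ c = g * c' ∧ IsCoprime b' c' := by
  classical
  obtain ⟨b', hb'⟩ := EuclideanDomain.gcd_dvd_left b c
  obtain ⟨c', hc'⟩ := EuclideanDomain.gcd_dvd_right b c
  refine ⟨EuclideanDomain.gcd b c, b', c', hb', hc', EuclideanDomain.gcdA b c,
    EuclideanDomain.gcdB b c, ?_⟩
  have hg : EuclideanDomain.gcd b c ≠ 0 := by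
    intro h
    rw [h, zero_mul] at hb'
    exact hb hb'
  refine mul_left_cancel₀ hg ?_
  have h := EuclideanDomain.gcd_eq_gcd_ab b c
  calc _ = EuclideanDomain.gcd b c * b' * EuclideanDomain.gcdA b c +
        EuclideanDomain.gcd b c * c' * EuclideanDomain.gcdB b c := by ring
    _ = _ := by rw [← hb', ← hc', ← h, mul_one]

namespace DrinfeldModule

variable {F : Type*} [Field F] [Algebra (RatFunc Fq) F]
variable {φ ψ χ : DrinfeldModule Fq F}

/-- All endomorphisms of `φ` with coefficients in `F` are of the form `φ_c`. -/
def HasTrivialEnd (φ : DrinfeldModule Fq F) : Prop :=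
  ∀ μ : TwistedPoly Fq F, (∀ a, μ * φ.toAlgHom a = φ.toAlgHom a * μ) → ∃ c, μ = φ.toAlgHom c

namespace Isogeny

/-- An isogeny is reduced if it does not factor through the multiplication by a non-unit of
`𝔽_q[T]`. In rank two, over an algebraically closed field, this says that its kernel is a cyclic
module. -/
def IsReduced (μ : Isogeny φ ψ) : Prop :=
  ∀ (a : Fq[X]) (ha : a ≠ 0) (μ' : Isogeny φ ψ), μ = μ'.comp (mulBy φ ha) → IsUnit a

theorem comp_right_cancel {η η' : Isogeny ψ χ} {μ : Isogeny φ ψ} (h : η.comp μ = η'.comp μ) :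
    η = η' :=
  ext_val (mul_right_cancel₀ μ.ne_zero (congrArg val h))

theorem comp_assoc {ω : DrinfeldModule Fq F} (θ : Isogeny χ ω) (η : Isogeny ψ χ)
    (μ : Isogeny φ ψ) : (θ.comp η).comp μ = θ.comp (η.comp μ) :=
  ext_val (mul_assoc _ _ _)

theorem comp_mulBy (μ : Isogeny φ ψ) {a : Fq[X]} (ha : a ≠ 0) :
    μ.comp (mulBy φ ha) = (mulBy ψ ha).comp μ := ext_val (μ.comm a)

theorem mulBy_comp_mulBy {a b : Fq[X]} (ha : a ≠ 0) (hb : b ≠ 0) :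
    (mulBy φ ha).comp (mulBy φ hb) = mulBy φ (mul_ne_zero ha hb) :=
  ext_val (map_mul φ.toAlgHom a b).symm

theorem comp_mulBy_one (μ : Isogeny φ ψ) : μ.comp (mulBy φ one_ne_zero) = μ :=
  ext_val (by rw [comp_val, mulBy_val, map_one, mul_one])

/-- Every endomorphism is a multiplication if there are no others. -/
theorem eq_mulBy (h : φ.HasTrivialEnd) (μ : Isogeny φ φ) :
    ∃ (c : Fq[X]) (hc : c ≠ 0), μ = mulBy φ hc := by
  obtain ⟨c, hc⟩ := h μ.val μ.comm
  refine ⟨c, ?_, ext_val hc⟩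
  rintro rfl
  rw [map_zero] at hc
  exact μ.ne_zero hc

/-- An isogeny of the least possible degree in `τ` is reduced. -/
theorem exists_isReduced (hr : 0 < φ.rank) (h : Nonempty (Isogeny φ ψ)) :
    ∃ μ : Isogeny φ ψ, μ.IsReduced := by
  classical
  have hex : ∃ n, ∃ μ : Isogeny φ ψ, μ.val.natDegree = n := ⟨_, h.some, rfl⟩
  obtain ⟨μ, hμ⟩ := Nat.find_spec hex
  refine ⟨μ, fun a ha μ' e => ?_⟩
  have h1 : Nat.find hex ≤ μ'.val.natDegree := Nat.find_min' hex ⟨μ', rfl⟩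
  rw [e, natDegree_comp, mulBy_val, natDegree_toAlgHom _ hr ha] at hμ
  have h2 : φ.rank * a.natDegree = 0 := by omega
  rw [isUnit_iff_degree_eq_zero, degree_eq_natDegree ha,
    (mul_eq_zero.mp h2).resolve_left hr.ne']
  rfl

section AlgClosed

variable [IsAlgClosed F]

theorem exists_nonzero_annihilator (μ : Isogeny φ ψ) :
    ∃ a : Fq[X], a ≠ 0 ∧ ∀ x ∈ μ.ker, a • x = 0 := by
  obtain ⟨a, ha, ha0⟩ := μ.exists_mem_degree
  exact ⟨a, ha0, fun x hx => smul_eq_zero_of_mem_degree ha hx⟩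

end AlgClosed

end Isogeny

open Isogeny

variable [IsAlgClosed F]

/-- If `φ_b μ = φ_c`, then `b` divides `c`, because `c` kills the `b`-torsion. Hence `μ` is the
multiplication by the quotient. -/
theorem exists_eq_of_toAlgHom_mul_eq (hr : 0 < φ.rank) {b c : Fq[X]} (hb : b ≠ 0)
    {μ : TwistedPoly Fq F} (h : φ.toAlgHom b * μ = φ.toAlgHom c) : ∃ d, μ = φ.toAlgHom d := by
  obtain ⟨g, b, c, rfl, rfl, hbc⟩ := exists_isCoprime_factor hb c
  have hg0 := left_ne_zero_of_mul hb
  have hb0 := right_ne_zero_of_mul hb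
  have h1 : φ.toAlgHom b * μ = φ.toAlgHom c := by
    refine mul_left_cancel₀ (φ.toAlgHom_ne_zero hg0) ?_
    rw [← mul_assoc, ← map_mul, ← map_mul, h]
  have h2 : μ * φ.toAlgHom b = φ.toAlgHom c := by
    refine mul_left_cancel₀ (φ.toAlgHom_ne_zero hb0) ?_
    rw [← mul_assoc, h1, ← map_mul, ← map_mul, mul_comm]
  obtain ⟨u, v, huv⟩ := hbc
  have hker : ∀ x ∈ (mulBy φ hb0).ker, x = 0 := by
    intro x hx
    have hbx : b • x = 0 := hx
    have hcx : c • x = 0 :=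
      (congrArg (fun ν => TwistedPoly.toEnd (F := F) ν x) h2).symm.trans
        ((TwistedPoly.mul_apply μ _ _).trans
          ((congrArg (TwistedPoly.toEnd μ) hbx).trans (map_zero (TwistedPoly.toEnd μ))))
    rw [← one_smul Fq[X] x, ← huv, add_smul, mul_smul, mul_smul, hbx, hcx, smul_zero, smul_zero,
      add_zero]
  have hdeg := natCard_ker (mulBy φ hb0)
  rw [(Submodule.eq_bot_iff _).mpr hker, Nat.card_unique, mulBy_val,
    natDegree_toAlgHom _ hr hb0] at hdeg
  have hd0 : φ.rank * b.natDegree = 0 := by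
    by_contra hne
    exact (Nat.one_lt_pow hne (TwistedPoly.one_lt_card (Fq := Fq))).ne hdeg
  have hu : IsUnit b := by
    rw [isUnit_iff_degree_eq_zero, degree_eq_natDegree hb0,
      (mul_eq_zero.mp hd0).resolve_left hr.ne']
    rfl
  obtain ⟨d, rfl⟩ := hu.dvd (a := c)
  refine ⟨d, mul_left_cancel₀ (φ.toAlgHom_ne_zero hb0) ?_⟩
  rw [h1, map_mul]

/-- Triviality of the endomorphism ring is invariant under isogenies. -/
theorem HasTrivialEnd.of_isogeny (h : φ.HasTrivialEnd) (hr : 0 < φ.rank) (α : Isogeny φ ψ) :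
    ψ.HasTrivialEnd := by
  intro μ hμ
  obtain ⟨a, ha, hker⟩ := α.exists_nonzero_annihilator
  obtain ⟨β, -, hαβ⟩ := exists_dual ha hker
  obtain ⟨c, hc⟩ := h (β.val * μ * α.val) fun x => by
    rw [mul_assoc, α.comm, ← mul_assoc, mul_assoc β.val, hμ, ← mul_assoc, β.comm]
    simp only [mul_assoc]
  refine exists_eq_of_toAlgHom_mul_eq (b := a) (c := c) (α.rank_eq ▸ hr) ha ?_
  refine mul_right_cancel₀ α.ne_zero ?_
  have e : α.val * β.val = ψ.toAlgHom a := congrArg val hαβ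
  rw [← e, ← α.comm c, ← hc]
  simp only [mul_assoc]

namespace Isogeny

/-- Any two isogenies with the same source and target are proportional over `𝔽_q[T]`. -/
theorem exists_comp_mulBy_eq_comp_mulBy (h : φ.HasTrivialEnd) (μ ν : Isogeny φ ψ) :
    ∃ (b c : Fq[X]) (hb : b ≠ 0) (hc : c ≠ 0), ν.comp (mulBy φ hb) = μ.comp (mulBy φ hc) := by
  obtain ⟨a, ha, hker⟩ := μ.exists_nonzero_annihilator
  obtain ⟨η, -, hη⟩ := exists_dual ha hker
  obtain ⟨c, hc, e⟩ := eq_mulBy h (η.comp ν)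
  refine ⟨a, c, ha, hc, ?_⟩
  rw [comp_mulBy, ← hη, comp_assoc, e]

/-- Every isogeny is a multiple of a reduced one with the same source and target. -/
theorem IsReduced.exists_eq_comp_mulBy (h : φ.HasTrivialEnd) {μ : Isogeny φ ψ}
    (hμ : μ.IsReduced) (ν : Isogeny φ ψ) :
    ∃ (c : Fq[X]) (hc : c ≠ 0), ν = μ.comp (mulBy φ hc) := by
  obtain ⟨b, c, hb, hc, e⟩ := exists_comp_mulBy_eq_comp_mulBy h μ ν
  obtain ⟨g, b, c, rfl, rfl, hbc⟩ := exists_isCoprime_factor hb c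
  have hg0 := left_ne_zero_of_mul hb
  have hb0 := right_ne_zero_of_mul hb
  have hc0 := right_ne_zero_of_mul hc
  have e1 : ν.comp (mulBy φ hb0) = μ.comp (mulBy φ hc0) := by
    refine comp_right_cancel (μ := mulBy φ hg0) (ext_val ?_)
    have e2 := congrArg val e
    simp only [comp_val, mulBy_val] at e2 ⊢
    rw [mul_assoc, mul_assoc, ← map_mul, ← map_mul, mul_comm b, mul_comm c, e2]
  obtain ⟨u, v, huv⟩ := hbc
  have hle : (mulBy φ hb0).ker ≤ μ.ker := by
    intro x hx
    have hbx : b • x = 0 := hx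
    have h1 : μ.toLinearMap (c • x) = 0 := by
      have h2 := congrArg (fun η => η.toLinearMap x) e1
      simp only [toLinearMap_comp, toLinearMap_mulBy] at h2
      rw [← h2, hbx, map_zero]
    rw [mem_ker, ← one_smul Fq[X] x, ← huv, add_smul, mul_smul, mul_smul, hbx, smul_zero,
      zero_add, map_smul, h1, smul_zero]
  obtain ⟨μ', hμ'⟩ := exists_factor hle
  obtain ⟨w, hw⟩ := (hμ b hb0 μ' hμ').exists_right_inv
  have hw0 : w ≠ 0 := right_ne_zero_of_mul (hw ▸ one_ne_zero)
  refine ⟨c * w, mul_ne_zero hc0 hw0, ?_⟩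
  have e3 := congrArg (fun η => val (η.comp (mulBy φ hw0))) e1
  simp only [comp_val, mulBy_val, mul_assoc, ← map_mul, hw, map_one, mul_one] at e3
  exact ext_val e3

theorem degree_comp_mulBy (hr : 0 < φ.rank) (μ : Isogeny φ ψ) {a : Fq[X]} (ha : a ≠ 0) :
    (μ.comp (mulBy φ ha)).degree = Ideal.span {a} ^ φ.rank * μ.degree := by
  rw [degree_comp, degree_mulBy hr]

/-- Splitting off the multiplication by `a` divides the degree by a power of `(a)`. -/
theorem IsPrimitive.isReduced (hr : 0 < φ.rank) {μ : Isogeny φ ψ} (hμ : μ.IsPrimitive) :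
    μ.IsReduced := by
  intro a ha μ' e
  have h1 := degree_comp_mulBy hr μ' ha
  rw [← e] at h1
  have h2 := hμ μ' (Dvd.intro_left _ h1.symm)
  rw [h2] at h1
  have h3 : Ideal.span {a} ^ φ.rank = 1 :=
    mul_right_cancel₀ (b := μ.degree) μ.degree_ne_bot (by rw [one_mul, ← h1])
  rw [← Ideal.span_singleton_eq_top, ← Ideal.isUnit_iff]
  exact IsUnit.of_pow_eq_one h3 hr.ne'

/-- All isogenies with the given source and target are multiples of the reduced one, so that its
degree divides theirs. -/
theorem IsReduced.isPrimitive (hr : 0 < φ.rank) (h : φ.HasTrivialEnd) {μ : Isogeny φ ψ}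
    (hμ : μ.IsReduced) : μ.IsPrimitive := by
  intro η hη
  obtain ⟨c, hc, e⟩ := hμ.exists_eq_comp_mulBy h η
  have h1 := degree_comp_mulBy hr μ hc
  rw [← e] at h1
  exact dvd_antisymm hη (Dvd.intro_left _ h1.symm)

/-- Two reduced isogenies with the same source and target differ by a unit. -/
theorem IsReduced.exists_isUnit (h : φ.HasTrivialEnd) {μ ν : Isogeny φ ψ} (hμ : μ.IsReduced)
    (hν : ν.IsReduced) : ∃ (c : Fq[X]) (hc : c ≠ 0), IsUnit c ∧ ν = μ.comp (mulBy φ hc) := by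
  obtain ⟨c, hc, e⟩ := hμ.exists_eq_comp_mulBy h ν
  exact ⟨c, hc, hν c hc μ e, e⟩

theorem isIso_mulBy (hr : 0 < φ.rank) {c : Fq[X]} (hc : c ≠ 0) (hu : IsUnit c) :
    (mulBy φ hc).IsIso := by
  refine isIso_of_natDegree_eq_zero ?_
  rw [mulBy_val, natDegree_toAlgHom _ hr hc, natDegree_eq_zero_of_isUnit hu, mul_zero]

theorem IsReduced.degree_eq (hr : 0 < φ.rank) (h : φ.HasTrivialEnd) {μ ν : Isogeny φ ψ}
    (hμ : μ.IsReduced) (hν : ν.IsReduced) : ν.degree = μ.degree := by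
  obtain ⟨c, hc, hu, rfl⟩ := hμ.exists_isUnit h hν
  rw [degree_comp, degree_eq_one_iff.mpr (isIso_mulBy hr hc hu), one_mul]

end Isogeny

end DrinfeldModule
end Drinfeld

namespace Drinfeld

open DrinfeldModule Isogeny

variable {Fq : Type*} [Field Fq] [Fintype Fq]

theorem TwistedPoly.toPoly_map {F : Type*} [Field F] [Algebra (RatFunc Fq) F]
    {L : Type*} [Field L] [Algebra (RatFunc Fq) L] (f : F →ₐ[RatFunc Fq] L)
    (μ : TwistedPoly Fq F) : (map f μ).toPoly = μ.toPoly.map f.toRingHom := by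
  rw [toPoly, toPoly, support_map, Polynomial.map_sum]
  simp [coeff_map]

variable {K : Type*} [Field K] [Algebra (RatFunc Fq) K]
variable {Kbar : Type*} [Field Kbar] [Algebra K Kbar] [Algebra (RatFunc Fq) Kbar]
  [IsScalarTower (RatFunc Fq) K Kbar]

/-! ### Descent to the separable closure -/

variable (Fq K Kbar) in
/-- The inclusion of the separable closure, over `𝔽_q(T)`. -/
abbrev sepVal : separableClosure K Kbar →ₐ[RatFunc Fq] Kbar :=
  (separableClosure K Kbar).val.restrictScalars (RatFunc Fq)

theorem overKbar_eq (φ : SepModule Fq K Kbar) : overKbar φ = φ.map (sepVal Fq K Kbar) := rfl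

theorem rank_overKbar (φ : SepModule Fq K Kbar) : (overKbar φ).rank = φ.rank := rank_map _ _

variable (Fq) in
/-- Zeros of separable polynomials over the separable closure lie in the separable closure. -/
theorem mem_range_sepVal_of_separable {P : (separableClosure K Kbar)[X]} (hP : P.Separable)
    {x : Kbar} (hx : aeval x P = 0) : x ∈ Set.range (sepVal Fq K Kbar) := by
  have h : IsSeparable (separableClosure K Kbar) x := hP.of_dvd (minpoly.dvd _ _ hx)
  have h2 : x ∈ separableClosure (separableClosure K Kbar) Kbar := h
  rw [separableClosure.separableClosure_eq_bot] at h2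
  exact h2

/-- The torsion points are separable. -/
theorem mem_range_sepVal_of_torsion (φ : SepModule Fq K Kbar) {a : Fq[X]} (ha : a ≠ 0)
    {x : (overKbar φ).Points} (hx : a • x = 0) : x ∈ Set.range (sepVal Fq K Kbar) := by
  have hd : (φ.toAlgHom a).diff ≠ 0 := by
    rw [φ.diff_eq]
    exact (map_ne_zero_iff _ (incl_injective _)).mpr ha
  refine mem_range_sepVal_of_separable Fq (TwistedPoly.separable_toPoly hd) ?_
  have key : ∀ y : Kbar, aeval y (φ.toAlgHom a).toPoly =
      TwistedPoly.toEnd ((overKbar φ).toAlgHom a) y := fun y => by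
    rw [← TwistedPoly.eval_toPoly, overKbar_eq, map_toAlgHom, TwistedPoly.toPoly_map, eval_map]
    rfl
  exact (key x).trans hx

/-- Every torsion submodule of finite order is the kernel of an isogeny over the separable
closure. -/
theorem exists_sep_quotient [IsAlgClosed Kbar] (φ : SepModule Fq K Kbar)
    (H : Submodule Fq[X] (overKbar φ).Points) (hfin : Finite H) {a : Fq[X]} (ha : a ≠ 0)
    (hH : ∀ x ∈ H, a • x = 0) :
    ∃ (ψ : SepModule Fq K Kbar) (μ : SepIsogeny φ ψ)
      (μ₀ : TwistedPoly Fq (separableClosure K Kbar)),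
      μ.ker = H ∧ μ.val = TwistedPoly.map (sepVal Fq K Kbar) μ₀ :=
  exists_quotient (sepVal Fq K Kbar) φ H hfin
    fun _ hx => mem_range_sepVal_of_torsion φ ha (hH _ hx)

/-- An isomorphism between Drinfeld modules over the separable closure is defined over the
separable closure: it satisfies `c ^ (q ^ r - 1) = d` with a separable `d ≠ 0`. -/
theorem mem_range_sepVal_of_isIso {φ ψ : SepModule Fq K Kbar} (hr : 0 < φ.rank)
    (μ : SepIsogeny φ ψ) {c : Kbar} (hc : c ≠ 0) (h : μ.val = TwistedPoly.C Fq Kbar c) :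
    c ∈ Set.range (sepVal Fq K Kbar) := by
  have hrank : ψ.rank = φ.rank := by
    rw [← rank_overKbar, ← rank_overKbar, μ.rank_eq]
  set r := φ.rank with hr'
  have e := congrArg (fun ν => TwistedPoly.coeff ν r) (μ.comm X)
  simp only [h, TwistedPoly.coeff_C_mul, TwistedPoly.coeff_mul_C, overKbar_eq, map_toAlgHom,
    TwistedPoly.coeff_map] at e
  have h1 : (φ.toAlgHom X).coeff r ≠ 0 :=
    TwistedPoly.coeff_natDegree_ne_zero (φ.toAlgHom_ne_zero X_ne_zero)
  have h2 : (ψ.toAlgHom X).coeff r ≠ 0 := by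
    rw [← hrank]
    exact TwistedPoly.coeff_natDegree_ne_zero (ψ.toAlgHom_ne_zero X_ne_zero)
  set n := Fintype.card Fq ^ r - 1 with hn
  have hn1 : n + 1 = Fintype.card Fq ^ r := Nat.sub_add_cancel (pow_pos Fintype.card_pos r)
  have hcast : ((n : ℕ) : separableClosure K Kbar) ≠ 0 := by
    intro h0
    have h3 := congrArg (fun m : ℕ => (m : separableClosure K Kbar)) hn1
    simp only [Nat.cast_add, Nat.cast_pow, h0, Nat.cast_one,
      TwistedPoly.card_cast_eq_zero Fq (separableClosure K Kbar), zero_pow hr.ne'] at h3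
    simp at h3
  have hsep := separable_X_pow_sub_C ((φ.toAlgHom X).coeff r / (ψ.toAlgHom X).coeff r) hcast
    (div_ne_zero h1 h2)
  refine mem_range_sepVal_of_separable Fq hsep ?_
  have h2' : sepVal Fq K Kbar ((ψ.toAlgHom X).coeff r) ≠ 0 := (_root_.map_ne_zero _).mpr h2
  have e2 : c ^ n = sepVal Fq K Kbar ((φ.toAlgHom X).coeff r) /
      sepVal Fq K Kbar ((ψ.toAlgHom X).coeff r) := by
    rw [eq_div_iff h2']
    refine mul_right_cancel₀ hc ?_
    rw [← hn1, pow_succ] at e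
    linear_combination -e
  rw [map_sub, map_pow, aeval_X, aeval_C, map_div₀, sub_eq_zero]
  exact e2

/-- Without complex multiplication, all endomorphisms over the algebraic closure are
multiplications. The kernel of an endomorphism consists of separable points, so that it is
defined over the separable closure; its differential is then some `a / b` in `𝔽_q(T)`, and
`φ_b μ = φ_a`. -/
theorem hasTrivialEnd_overKbar [IsAlgClosed Kbar] {φ : SepModule Fq K Kbar} (hr : 1 < φ.rank)
    (hCM : ¬ φ.HasCM) : (overKbar φ).HasTrivialEnd := by
  intro μ hμ
  by_cases hμ0 : μ = 0
  · exact ⟨0, by rw [hμ0, map_zero]⟩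
  let M : SepIsogeny φ φ := ⟨μ, hμ0, hμ⟩
  have hr0 : 0 < (overKbar φ).rank := by rw [rank_overKbar]; omega
  obtain ⟨a, ha, hker⟩ := M.exists_nonzero_annihilator
  obtain ⟨ψ, ν, ν₀, hνker, hν⟩ := exists_sep_quotient φ M.ker inferInstance ha hker
  obtain ⟨η, hη⟩ := exists_factor (μ := ν) (ν := M) hνker.le
  -- `M` and `ν` have the same kernel, so that `η` is a constant
  have hdeg : η.val.natDegree = 0 := by
    have h1 := natDegree_comp η ν
    have h2 := natCard_ker M
    rw [← hνker, natCard_ker] at h2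
    have h3 := Nat.pow_right_injective (TwistedPoly.one_lt_card (Fq := Fq)) h2
    rw [hη] at h3
    omega
  obtain ⟨c, hc, hηc⟩ := isIso_of_natDegree_eq_zero hdeg
  have hψr : 0 < ψ.rank := by
    rw [← rank_overKbar, ← ν.rank_eq]; exact hr0
  obtain ⟨c₀, rfl⟩ := mem_range_sepVal_of_isIso hψr η hc hηc
  obtain ⟨m, hm⟩ : ∃ m, μ = TwistedPoly.map (sepVal Fq K Kbar) m := by
    refine ⟨TwistedPoly.C Fq _ c₀ * ν₀, ?_⟩
    have h1 : μ = η.val * ν.val := congrArg val hη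
    rw [h1, hηc, hν, map_mul, TwistedPoly.map_C]
  have hmcomm : ∀ a, m * φ.toAlgHom a = φ.toAlgHom a * m := fun a => by
    refine TwistedPoly.map_injective (sepVal Fq K Kbar) ?_
    rw [map_mul, map_mul, ← hm]
    exact hμ a
  have hQ : ∃ r : RatFunc Fq, algebraMap _ _ r = m.diff := by
    rw [HasCM, not_and, not_lt] at hCM
    have h1 := hCM hr
    have h2 := IntermediateField.rank_eq_one_iff.mp
      (le_antisymm h1 (Cardinal.one_le_iff_pos.mpr rank_pos))
    have h3 := IntermediateField.subset_adjoin (RatFunc Fq) _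
      (show m.diff ∈ {x | ∃ μ : TwistedPoly Fq (separableClosure K Kbar),
        (∀ a, μ * φ.toAlgHom a = φ.toAlgHom a * μ) ∧ μ.diff = x} from ⟨m, hmcomm, rfl⟩)
    rw [h2] at h3
    exact IntermediateField.mem_bot.mp h3
  obtain ⟨r, hrm⟩ := hQ
  obtain ⟨x, y, hy, rfl⟩ := IsFractionRing.div_surjective (A := Fq[X]) r
  have hy0 : y ≠ 0 := nonZeroDivisors.ne_zero hy
  -- the difference of the two sides intertwines `φ` with itself and has differential zero
  have hmxy : φ.toAlgHom y * m = φ.toAlgHom x := by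
    rw [← sub_eq_zero]
    by_contra hne
    refine diff_ne_zero_of_comm (φ := φ) (ψ := φ) hne ?_ ?_
    · rw [sub_mul, mul_sub, mul_assoc, hmcomm, ← mul_assoc, ← mul_assoc, ← map_mul, ← map_mul,
        ← map_mul, ← map_mul, mul_comm y, mul_comm x]
    · rw [TwistedPoly.diff, TwistedPoly.coeff_sub, sub_eq_zero]
      change (φ.toAlgHom y * m).diff = (φ.toAlgHom x).diff
      rw [TwistedPoly.diff_mul, φ.diff_eq, φ.diff_eq, ← hrm, map_div₀]
      have h4 : incl Fq (separableClosure K Kbar) y ≠ 0 :=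
        (map_ne_zero_iff _ (incl_injective _)).mpr hy0
      exact mul_div_cancel₀ _ h4
  refine exists_eq_of_toAlgHom_mul_eq (b := y) (c := x) hr0 hy0 ?_
  rw [hm, overKbar_eq, map_toAlgHom, map_toAlgHom, ← map_mul, hmxy]

end Drinfeld

namespace Drinfeld

variable {Fq : Type*} [Field Fq] [Fintype Fq]

/-! ### Prime ideals of `𝔽_q[T]` -/

theorem prime_span_singleton {p : Fq[X]} (hp : Prime p) : Prime (Ideal.span {p}) :=
  Ideal.prime_of_isPrime (by simpa using hp.ne_zero)
    ((Ideal.span_singleton_prime hp.ne_zero).mpr hp)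

theorem isCoprime_span_singleton_of_not_dvd {p : Fq[X]} (hp : Prime p) {I : Ideal Fq[X]}
    (h : ¬ Ideal.span {p} ∣ I) : IsCoprime I (Ideal.span {p}) := by
  have hmax : (Ideal.span {p}).IsMaximal :=
    PrincipalIdealRing.isMaximal_of_irreducible hp.irreducible
  rw [Ideal.isCoprime_iff_sup_eq]
  refine hmax.1.2 _ (lt_of_le_of_ne le_sup_right fun e => h ?_)
  rw [Ideal.dvd_iff_le, e]
  exact le_sup_left

namespace DrinfeldModule

variable {F : Type*} [Field F] [Algebra (RatFunc Fq) F] [IsAlgClosed F]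
variable {φ ψ χ ω : DrinfeldModule Fq F}

namespace Isogeny

/-! ### Isomorphisms -/

theorem IsIso.degree_eq_one {θ : Isogeny φ ψ} (h : θ.IsIso) : θ.degree = 1 :=
  degree_eq_one_iff.mpr h

theorem IsIso.degree_comp_left {θ : Isogeny ψ χ} (h : θ.IsIso) (μ : Isogeny φ ψ) :
    (θ.comp μ).degree = μ.degree := by
  rw [degree_comp, h.degree_eq_one, mul_one]

theorem IsIso.degree_comp_right {θ : Isogeny φ ψ} (h : θ.IsIso) (μ : Isogeny ψ χ) :
    (μ.comp θ).degree = μ.degree := by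
  rw [degree_comp, h.degree_eq_one, one_mul]

theorem IsIso.exists_inverse {θ : Isogeny φ ψ} (h : θ.IsIso) :
    ∃ η : Isogeny ψ φ, η.IsIso ∧ η.comp θ = mulBy φ one_ne_zero ∧
      θ.comp η = mulBy ψ one_ne_zero := by
  obtain ⟨η, hη, h1, h2⟩ := h.exists_inv
  exact ⟨η, hη, ext_val (h1.trans (map_one φ.toAlgHom).symm),
    ext_val (h2.trans (map_one ψ.toAlgHom).symm)⟩

theorem mulBy_one_comp (μ : Isogeny φ ψ) : (mulBy ψ one_ne_zero).comp μ = μ := by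
  rw [← comp_mulBy, comp_mulBy_one]

theorem IsReduced.iso_comp {θ : Isogeny ψ χ} (h : θ.IsIso) {μ : Isogeny φ ψ} (hμ : μ.IsReduced) :
    (θ.comp μ).IsReduced := by
  intro a ha μ' e
  obtain ⟨η, -, hη, -⟩ := h.exists_inverse
  refine hμ a ha (η.comp μ') ?_
  rw [comp_assoc, ← e, ← comp_assoc, hη, mulBy_one_comp]

theorem isIso_comp {θ : Isogeny φ ψ} {η : Isogeny ψ χ} (hθ : θ.IsIso) (hη : η.IsIso) :
    (η.comp θ).IsIso := by
  rw [← degree_eq_one_iff, hη.degree_comp_left, hθ.degree_eq_one]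

/-- Two isogenies with the same kernel have isomorphic targets. -/
theorem exists_isIso_of_ker_eq {μ : Isogeny φ ψ} {ν : Isogeny φ χ} (h : μ.ker = ν.ker) :
    ∃ θ : Isogeny ψ χ, θ.IsIso ∧ ν = θ.comp μ := by
  obtain ⟨θ, e⟩ := exists_factor h.le
  refine ⟨θ, ?_, e⟩
  have h1 : ν.degree = μ.degree := by
    rw [degree_eq_orderIdeal, degree_eq_orderIdeal]
    exact orderIdeal_congr (LinearEquiv.ofEq _ _ h.symm)
  rw [← degree_eq_one_iff]
  refine mul_left_cancel₀ (a := μ.degree) μ.degree_ne_bot ?_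
  rw [← degree_comp, ← e, h1, mul_one]

theorem exists_ne_zero_of_degree_ne_one {μ : Isogeny φ ψ} (h : μ.degree ≠ 1) :
    ∃ x ∈ μ.ker, x ≠ 0 := by
  by_contra! h0
  refine h ?_
  have hbot : μ.ker = ⊥ := (Submodule.eq_bot_iff _).mpr h0
  have hs : Subsingleton μ.ker := by rw [hbot]; infer_instance
  rw [degree_eq_orderIdeal, Ideal.one_eq_top, orderIdeal_eq_top_iff]
  exact hs

theorem natCard_ker_eq (μ : Isogeny φ ψ) : Nat.card μ.ker = Nat.card (Fq[X] ⧸ μ.degree) := by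
  rw [degree_eq_orderIdeal, natCard_quotient_orderIdeal]

/-! ### Isogenies of prime degree -/

/-- In rank two, the dual of an isogeny of degree `(a)` has degree `(a)`. -/
theorem exists_dual_of_degree (hr : φ.rank = 2) {μ : Isogeny φ ψ} {a : Fq[X]} (ha : a ≠ 0)
    (h : μ.degree = Ideal.span {a}) :
    ∃ η : Isogeny ψ φ, η.degree = Ideal.span {a} ∧ η.comp μ = mulBy φ ha ∧
      μ.comp η = mulBy ψ ha := by
  obtain ⟨η, h1, h2⟩ := exists_dual (μ := μ) ha fun x hx =>
    smul_eq_zero_of_mem_degree (h ▸ Ideal.mem_span_singleton_self a) hx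
  refine ⟨η, ?_, h1, h2⟩
  have h3 := congrArg degree h1
  rw [degree_comp, degree_mulBy (by omega), hr, pow_two, h] at h3
  exact mul_left_cancel₀ (by simpa using ha) h3

/-- In rank two, every isogeny has a dual of the same degree. -/
theorem exists_dual_degree_eq (hr : φ.rank = 2) (μ : Isogeny φ ψ) :
    ∃ η : Isogeny ψ φ, η.degree = μ.degree := by
  obtain ⟨a, ha⟩ := IsPrincipalIdealRing.principal μ.degree
  have ha' : μ.degree = Ideal.span {a} := ha
  have ha0 : a ≠ 0 := by
    rintro rfl
    exact μ.degree_ne_bot (by simpa using ha')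
  obtain ⟨η, h, -⟩ := exists_dual_of_degree hr ha0 ha'
  exact ⟨η, h.trans ha'.symm⟩

theorem isReduced_of_degree_eq_prime (hr : φ.rank = 2) {p : Fq[X]} (hp : Prime p)
    {μ : Isogeny φ ψ} (h : μ.degree = Ideal.span {p}) : μ.IsReduced := by
  intro a ha μ' e
  have h1 := degree_comp_mulBy (by omega) μ' ha
  rw [← e, h, hr, pow_two] at h1
  have h2 := (prime_span_singleton hp).irreducible.squarefree _ (Dvd.intro _ h1.symm)
  rwa [Ideal.isUnit_iff, Ideal.span_singleton_eq_top] at h2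

/-- The kernel of an isogeny of prime degree is generated by any of its non-zero elements. -/
theorem ker_eq_span_singleton {p : Fq[X]} (hp : Prime p) {μ : Isogeny φ ψ}
    (h : μ.degree = Ideal.span {p}) {x : φ.Points} (hx : x ∈ μ.ker) (hx0 : x ≠ 0) :
    μ.ker = Submodule.span Fq[X] {x} := by
  have hle : Submodule.span Fq[X] {x} ≤ μ.ker := by
    rwa [Submodule.span_singleton_le_iff_mem]
  have hpx : p • x = 0 :=
    smul_eq_zero_of_mem_degree (h ▸ Ideal.mem_span_singleton_self p) hx
  have hfin : Finite (Submodule.span Fq[X] {x}) :=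
    Finite.of_injective _ (Submodule.inclusion_injective hle)
  -- the span is isomorphic to the residue field, so that it is as large as the kernel
  have hord := orderIdeal_span_singleton (k := Fq) hp hx0 hpx
  have hcard : Nat.card (Submodule.span Fq[X] {x}) = Nat.card μ.ker := by
    rw [natCard_ker_eq, h, ← natCard_quotient_orderIdeal (k := Fq), hord]
  symm
  exact SetLike.coe_injective
    (Set.eq_of_subset_of_ncard_le hle hcard.ge (Set.finite_coe_iff.mp (inferInstanceAs (Finite μ.ker))))

theorem not_isUnit_of_degree_eq_prime {p : Fq[X]} (hp : Prime p) {μ : Isogeny φ ψ}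
    (h : μ.degree = Ideal.span {p}) : μ.degree ≠ 1 := by
  intro h1
  rw [h, Ideal.one_eq_top, Ideal.span_singleton_eq_top] at h1
  exact hp.not_isUnit h1

/-- The kernels of two `𝔭`-isogenies are equal or span the `𝔭`-torsion. -/
theorem ker_mulBy_le_of_ker_ne (hr : φ.rank = 2) {p : Fq[X]} (hp : Prime p)
    {μ : Isogeny φ ψ} {ν : Isogeny φ χ} (hμ : μ.degree = Ideal.span {p})
    (hν : ν.degree = Ideal.span {p}) (hne : μ.ker ≠ ν.ker) :
    (mulBy φ hp.ne_zero).ker ≤ μ.ker ⊔ ν.ker := by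
  have hkill : ∀ {ψ : DrinfeldModule Fq F} {μ : Isogeny φ ψ}, μ.degree = Ideal.span {p} →
      ∀ x ∈ μ.ker, p • x = 0 := fun h x hx =>
    smul_eq_zero_of_mem_degree (h ▸ Ideal.mem_span_singleton_self p) hx
  -- addition is an injective map from the product of the kernels, which is as large as the
  -- `𝔭`-torsion
  let f : μ.ker × ν.ker → (mulBy φ hp.ne_zero).ker := fun x =>
    ⟨x.1.1 + x.2.1, by
      rw [mem_ker, toLinearMap_mulBy, smul_add, hkill hμ _ x.1.2, hkill hν _ x.2.2, add_zero]⟩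
  have hinj : Function.Injective f := by
    rintro ⟨⟨x, hx⟩, ⟨y, hy⟩⟩ ⟨⟨x', hx'⟩, ⟨y', hy'⟩⟩ h
    have h1 : x + y = x' + y' := congrArg Subtype.val h
    have h2 : x - x' = y' - y := by
      rw [sub_eq_sub_iff_add_eq_add, h1, add_comm]
    have h3 : x - x' = 0 := by
      by_contra h0
      refine hne ?_
      rw [ker_eq_span_singleton hp hμ (μ.ker.sub_mem hx hx') h0,
        ker_eq_span_singleton hp hν (h2 ▸ ν.ker.sub_mem hy' hy) h0]
    have h4 := sub_eq_zero.mp h3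
    have h5 := sub_eq_zero.mp (h2.symm.trans h3)
    subst h4 h5
    rfl
  have hcard : Nat.card (mulBy φ hp.ne_zero).ker ≤ Nat.card (μ.ker × ν.ker) := by
    have h1 : μ.val.natDegree = p.natDegree := by
      rw [← finrank_ker, ← finrank_quotient_orderIdeal, ← degree_eq_orderIdeal, hμ,
        finrank_quotient_span_eq_natDegree]
    have h2 : ν.val.natDegree = p.natDegree := by
      rw [← finrank_ker, ← finrank_quotient_orderIdeal, ← degree_eq_orderIdeal, hν,
        finrank_quotient_span_eq_natDegree]
    rw [Nat.card_prod, natCard_ker, natCard_ker, natCard_ker, h1, h2, mulBy_val,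
      natDegree_toAlgHom _ (by omega) hp.ne_zero, hr, ← pow_add, two_mul]
  have hbij := hinj.bijective_of_nat_card_le hcard
  intro x hx
  obtain ⟨⟨y, z⟩, hyz⟩ := hbij.2 ⟨x, hx⟩
  have h1 : y.1 + z.1 = x := congrArg Subtype.val hyz
  rw [← h1]
  exact Submodule.add_mem_sup y.2 z.2

/-- The composite of a `𝔭`-isogeny `ν : φ → ψ` with an isogeny `μ : ψ → χ` of degree a power of
`𝔭` is reduced, unless `μ` factors through the dual of `ν`. -/
theorem isReduced_comp_or_exists_factor (hr : φ.rank = 2) {p : Fq[X]} (hp : Prime p)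
    {ν : Isogeny φ ψ} (hν : ν.degree = Ideal.span {p}) {μ : Isogeny ψ χ} {n : ℕ}
    (hμ : μ.degree = Ideal.span {p} ^ n) :
    (μ.comp ν).IsReduced ∨ ∃ (η : Isogeny ψ φ) (μ' : Isogeny φ χ),
      η.degree = Ideal.span {p} ∧ μ = μ'.comp η := by
  by_contra! hcon
  obtain ⟨h1, h2⟩ := hcon
  refine h1 fun a ha μ' e => ?_
  by_contra hu
  have hdeg := degree_comp_mulBy (by omega) μ' ha
  rw [← e, degree_comp, hν, hμ, ← pow_succ', hr, pow_two, mul_assoc] at hdeg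
  have hdvd : Ideal.span {a} ∣ Ideal.span {p} ^ (n + 1) := Dvd.intro _ hdeg.symm
  obtain ⟨j, -, hj⟩ := (dvd_prime_pow (prime_span_singleton hp) _).mp hdvd
  have hj0 : j ≠ 0 := by
    rintro rfl
    rw [pow_zero, associated_one_iff_isUnit, Ideal.isUnit_iff, Ideal.span_singleton_eq_top] at hj
    exact hu hj
  have hpa : Ideal.span {p} ∣ Ideal.span {a} := (dvd_pow_self _ hj0).trans hj.symm.dvd
  rw [Ideal.dvd_iff_le, Ideal.span_singleton_le_span_singleton] at hpa
  obtain ⟨b, rfl⟩ := hpa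
  have hb := right_ne_zero_of_mul ha
  obtain ⟨η, hη, hην, -⟩ := exists_dual_of_degree hr hp.ne_zero hν
  refine h2 η (μ'.comp (mulBy φ hb)) hη ?_
  refine comp_right_cancel (μ := ν) ?_
  rw [e, comp_assoc, hην, comp_assoc, mulBy_comp_mulBy]
  exact ext_val (by rw [comp_val, comp_val, mulBy_val, mulBy_val, mul_comm])

/-- There is no `𝔭`-isogeny between isomorphic Drinfeld modules. -/
theorem degree_ne_prime_of_isIso (hr : φ.rank = 2) (h : φ.HasTrivialEnd) {p : Fq[X]}
    (hp : Prime p) {θ : Isogeny ψ φ} (hθ : θ.IsIso) (μ : Isogeny φ ψ) :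
    μ.degree ≠ Ideal.span {p} := by
  intro hμ
  obtain ⟨c, hc, e⟩ := eq_mulBy h (θ.comp μ)
  have hr0 : 0 < φ.rank := by omega
  have h1 : Ideal.span {p} = Ideal.span {c} * Ideal.span {c} := by
    rw [← hμ, ← hθ.degree_comp_left μ, e, degree_mulBy hr0, hr, pow_two]
  have h2 := (prime_span_singleton hp).irreducible.squarefree (Ideal.span {c}) h1.symm.dvd
  refine (prime_span_singleton hp).not_isUnit ?_
  rw [h1]
  exact h2.mul h2

/-! ### The part of an isogeny at a prime -/

/-- If `𝔭 ^ k` divides the degree of a reduced isogeny, then it divides the degree of any isogeny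
between Drinfeld modules that are linked to the given ones by isogenies prime to `𝔭`. -/
theorem IsReduced.pow_dvd_degree (hr : φ.rank = 2) (h : φ.HasTrivialEnd) {p : Fq[X]}
    {k : ℕ} {μ : Isogeny φ ψ} (hμ : μ.IsReduced)
    (hk : Ideal.span {p} ^ k ∣ μ.degree) {α : Isogeny φ χ} {β : Isogeny ω ψ}
    (hα : IsCoprime α.degree (Ideal.span {p})) (hβ : IsCoprime β.degree (Ideal.span {p}))
    (ν : Isogeny χ ω) : Ideal.span {p} ^ k ∣ ν.degree := by
  obtain ⟨c, hc, e⟩ := hμ.exists_eq_comp_mulBy h (β.comp (ν.comp α))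
  have h1 := congrArg degree e
  rw [degree_comp_mulBy (by omega), degree_comp, degree_comp] at h1
  have h2 : Ideal.span {p} ^ k ∣ α.degree * ν.degree * β.degree := by
    rw [h1]; exact hk.mul_left _
  exact (hα.symm.pow_left.dvd_of_dvd_mul_left (hβ.symm.pow_left.dvd_of_dvd_mul_right h2))

/-- If an isogeny is factored into an isogeny of degree a power of `𝔭` and an isogeny of degree prime
to `𝔭`, then the first factor has the `𝔭`-primary part of the kernel as its kernel. This determines
the intermediate Drinfeld module up to isomorphism. -/
theorem exists_isIso_of_comp_eq {p : Fq[X]} {n m : ℕ} {μ : Isogeny φ ψ} {η : Isogeny ψ ω}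
    {μ' : Isogeny φ χ} {η' : Isogeny χ ω} (e : η.comp μ = η'.comp μ')
    (hμ : μ.degree = Ideal.span {p} ^ n) (hμ' : μ'.degree = Ideal.span {p} ^ m)
    (hη : IsCoprime η.degree (Ideal.span {p})) (hη' : IsCoprime η'.degree (Ideal.span {p})) :
    ∃ θ : Isogeny ψ χ, θ.IsIso := by
  have key : ∀ {ψ χ : DrinfeldModule Fq F} {n : ℕ} {μ : Isogeny φ ψ} {η : Isogeny ψ ω}
      {μ' : Isogeny φ χ} {η' : Isogeny χ ω}, η.comp μ = η'.comp μ' →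
      μ.degree = Ideal.span {p} ^ n → IsCoprime η'.degree (Ideal.span {p}) →
      μ.ker ≤ μ'.ker := by
    intro ψ χ n μ η μ' η' e hμ hη' x hx
    have h1 : μ'.toLinearMap x ∈ η'.ker := by
      rw [mem_ker, ← toLinearMap_comp, ← e, toLinearMap_comp, mem_ker.mp hx, map_zero]
    have h2 := hη'.pow_right (n := n)
    rw [← hμ, Ideal.isCoprime_iff_exists] at h2
    obtain ⟨u, hu, w, hw, huw⟩ := h2
    rw [mem_ker, ← one_smul Fq[X] (μ'.toLinearMap x), ← huw, add_smul,
      smul_eq_zero_of_mem_degree hu h1, ← map_smul, smul_eq_zero_of_mem_degree hw hx, map_zero,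
      add_zero]
  obtain ⟨θ, hθ, -⟩ := exists_isIso_of_ker_eq
    (le_antisymm (key e hμ hη') (key e.symm hμ' hη))
  exact ⟨θ, hθ⟩

/-- The degree of a primitive isogeny determines `δ_𝔭`. -/
theorem IsPrimitive.isGreatest_delta (hr : φ.rank = 2) (h : φ.HasTrivialEnd) {p : Fq[X]}
    (hp : Prime p) {μ : Isogeny φ ψ} (hμ : μ.IsPrimitive) :
    IsGreatest {n : ℕ | Ideal.span {p} ^ n ∣ μ.degree} (delta (Ideal.span {p}) φ ψ) := by
  have hset : {n : ℕ | ∃ ν : Isogeny φ ψ, ν.IsPrimitive ∧ Ideal.span {p} ^ n ∣ ν.degree} =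
      {n : ℕ | Ideal.span {p} ^ n ∣ μ.degree} := by
    ext n
    refine ⟨?_, fun hn => ⟨μ, hμ, hn⟩⟩
    rintro ⟨ν, hν, hn⟩
    have e := (hν.isReduced (by omega)).degree_eq (by omega) h (hμ.isReduced (by omega))
    rw [Set.mem_ofPred_eq, e]
    exact hn
  have hfin : FiniteMultiplicity (Ideal.span {p}) μ.degree :=
    FiniteMultiplicity.of_not_isUnit (prime_span_singleton hp).not_isUnit μ.degree_ne_bot
  obtain ⟨N, hN⟩ := hfin
  have hbdd : BddAbove {n : ℕ | Ideal.span {p} ^ n ∣ μ.degree} := by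
    refine ⟨N, fun n hn => ?_⟩
    by_contra hlt
    exact hN ((pow_dvd_pow _ (by omega)).trans hn)
  rw [delta, hset]
  exact ⟨Nat.sSup_mem ⟨0, by simp⟩ hbdd, fun n hn => le_csSup hbdd hn⟩

theorem IsReduced.delta_eq (hr : φ.rank = 2) (h : φ.HasTrivialEnd) {p : Fq[X]}
    (hp : Prime p) {n : ℕ} {μ : Isogeny φ ψ} {η : Isogeny ψ χ} (hred : (η.comp μ).IsReduced)
    (hμ : μ.degree = Ideal.span {p} ^ n) (hη : IsCoprime η.degree (Ideal.span {p})) :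
    delta (Ideal.span {p}) φ χ = n := by
  have hg := (hred.isPrimitive (by omega) h).isGreatest_delta hr h hp
  refine hg.unique ⟨?_, fun m hm => ?_⟩
  · rw [Set.mem_ofPred_eq, degree_comp, hμ]
    exact dvd_mul_right _ _
  · rw [Set.mem_ofPred_eq, degree_comp, hμ] at hm
    have h1 := hη.symm.pow_left.dvd_of_dvd_mul_right hm
    exact (pow_dvd_pow_iff (prime_span_singleton hp).ne_zero
      (prime_span_singleton hp).not_isUnit).mp h1

end Isogeny

end DrinfeldModule
end Drinfeld

namespace Drinfeld

open DrinfeldModule Isogeny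

variable {Fq : Type*} [Field Fq] [Fintype Fq]
variable {K : Type*} [Field K] [Algebra (RatFunc Fq) K]
variable {Kbar : Type*} [Field Kbar] [Algebra K Kbar] [Algebra (RatFunc Fq) Kbar]
  [IsScalarTower (RatFunc Fq) K Kbar]

/-! ### Isogeny classes over the separable closure -/

theorem mk_eq_mk_iff {ψ χ : SepModule Fq K Kbar} :
    (⟦ψ⟧ : IsoClass Fq K Kbar) = ⟦χ⟧ ↔ ∃ θ : SepIsogeny ψ χ, θ.IsIso := Quotient.eq

/-- Rank two, and no endomorphisms over the algebraic closure other than the multiplications by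
elements of `𝔽_q[T]`. -/
def IsRankTwoNonCM (ψ : SepModule Fq K Kbar) : Prop :=
  (overKbar ψ).rank = 2 ∧ (overKbar ψ).HasTrivialEnd

variable [IsAlgClosed Kbar]

theorem IsRankTwoNonCM.of_isogeny {φ ψ : SepModule Fq K Kbar} (h : IsRankTwoNonCM φ) (μ : SepIsogeny φ ψ) :
    IsRankTwoNonCM ψ :=
  ⟨μ.rank_eq ▸ h.1, h.2.of_isogeny (by rw [h.1]; exact two_pos) μ⟩

theorem nonempty_isogeny_symm {φ ψ : SepModule Fq K Kbar} (h : Nonempty (SepIsogeny φ ψ)) :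
    Nonempty (SepIsogeny ψ φ) := by
  obtain ⟨μ⟩ := h
  obtain ⟨a, ha, hker⟩ := μ.exists_nonzero_annihilator
  obtain ⟨η, -⟩ := exists_dual ha hker
  exact ⟨η⟩

theorem mk_mem_isogenyClass_iff {φ ψ : SepModule Fq K Kbar} :
    (⟦ψ⟧ : IsoClass Fq K Kbar) ∈ isogenyClass φ ↔ Nonempty (SepIsogeny ψ φ) := by
  refine ⟨?_, fun h => ⟨ψ, rfl, h⟩⟩
  rintro ⟨ψ', h, ⟨μ⟩⟩
  obtain ⟨θ, -⟩ := mk_eq_mk_iff.mp h.symm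
  exact ⟨μ.comp θ⟩

theorem mk_mem_pIsogenyClass_iff {𝔭 : Ideal Fq[X]} {φ ψ : SepModule Fq K Kbar} :
    (⟦ψ⟧ : IsoClass Fq K Kbar) ∈ pIsogenyClass 𝔭 φ ↔
      ∃ (n : ℕ) (μ : SepIsogeny ψ φ), μ.degree = 𝔭 ^ n := by
  refine ⟨?_, fun h => ⟨ψ, rfl, h⟩⟩
  rintro ⟨ψ', h, n, μ, hμ⟩
  obtain ⟨θ, hθ⟩ := mk_eq_mk_iff.mp h.symm
  exact ⟨n, μ.comp θ, by rw [hθ.degree_comp_right, hμ]⟩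

theorem pEdge_mk_iff {𝔭 : Ideal Fq[X]} {ψ χ : SepModule Fq K Kbar} :
    PEdge 𝔭 (⟦ψ⟧ : IsoClass Fq K Kbar) ⟦χ⟧ ↔ ∃ μ : SepIsogeny ψ χ, μ.degree = 𝔭 := by
  refine ⟨?_, fun h => ⟨ψ, χ, rfl, rfl, h⟩⟩
  rintro ⟨ψ', χ', h, h', μ, hμ⟩
  obtain ⟨θ, hθ⟩ := mk_eq_mk_iff.mp h.symm
  obtain ⟨θ', hθ'⟩ := mk_eq_mk_iff.mp h'
  exact ⟨θ'.comp (μ.comp θ), by rw [hθ'.degree_comp_left, hθ.degree_comp_right, hμ]⟩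

/-- A non-zero `𝔭`-torsion point generates the kernel of a `𝔭`-isogeny. -/
theorem exists_isogeny_of_torsion {p : Fq[X]} (hp : Prime p) {ψ : SepModule Fq K Kbar}
    {x : (overKbar ψ).Points} (hx : x ≠ 0) (hpx : p • x = 0) :
    ∃ (χ : SepModule Fq K Kbar) (ν : SepIsogeny ψ χ), ν.degree = Ideal.span {p} ∧
      ν.ker = Submodule.span Fq[X] {x} := by
  have hle : Submodule.span Fq[X] {x} ≤ (mulBy (overKbar ψ) hp.ne_zero).ker := by
    rw [Submodule.span_singleton_le_iff_mem]
    exact hpx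
  have hfin : Finite (Submodule.span Fq[X] {x}) :=
    Finite.of_injective _ (Submodule.inclusion_injective hle)
  obtain ⟨χ, ν, -, hν, -⟩ := exists_sep_quotient ψ (Submodule.span Fq[X] {x}) hfin hp.ne_zero
    fun y hy => hle hy
  refine ⟨χ, ν, ?_, hν⟩
  rw [degree_eq_orderIdeal, ← orderIdeal_span_singleton (k := Fq) hp hx hpx]
  exact orderIdeal_congr (LinearEquiv.ofEq _ _ hν)

/-- If `𝔭` divides the degree of an isogeny, then the isogeny starts with a `𝔭`-isogeny. -/
theorem exists_isogeny_factor_of_dvd {p : Fq[X]} (hp : Prime p) {ψ ω : SepModule Fq K Kbar}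
    (μ : SepIsogeny ψ ω) (h : Ideal.span {p} ∣ μ.degree) :
    ∃ (χ : SepModule Fq K Kbar) (ν : SepIsogeny ψ χ) (η : SepIsogeny χ ω),
      ν.degree = Ideal.span {p} ∧ μ = η.comp ν := by
  rw [Ideal.dvd_iff_le, degree_eq_orderIdeal] at h
  obtain ⟨⟨x, hx⟩, hx0, hpx⟩ := exists_torsion_of_orderIdeal_le hp h
  obtain ⟨χ, ν, hν, hker⟩ := exists_isogeny_of_torsion (x := x) hp
    (fun h0 => hx0 (Subtype.ext h0)) (congrArg Subtype.val hpx)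
  have hle : ν.ker ≤ μ.ker := by
    rw [hker, Submodule.span_singleton_le_iff_mem]
    exact hx
  obtain ⟨η, hη⟩ := exists_factor hle
  exact ⟨χ, ν, η, hν, hη⟩

/-- Every isogeny is the composite of an isogeny of degree a power of `𝔭` and an isogeny of degree
prime to `𝔭`. -/
theorem exists_pPart {p : Fq[X]} (hp : Prime p) {ψ ω : SepModule Fq K Kbar}
    (μ : SepIsogeny ψ ω) :
    ∃ (χ : SepModule Fq K Kbar) (ν : SepIsogeny ψ χ) (η : SepIsogeny χ ω) (n : ℕ),
      ν.degree = Ideal.span {p} ^ n ∧ IsCoprime η.degree (Ideal.span {p}) ∧ μ = η.comp ν := by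
  induction hn : μ.val.natDegree using Nat.strong_induction_on generalizing ψ with
  | _ N ih =>
  subst hn
  by_cases h : Ideal.span {p} ∣ μ.degree
  · obtain ⟨χ, ν, η, hν, rfl⟩ := exists_isogeny_factor_of_dvd hp μ h
    have hlt : η.val.natDegree < (η.comp ν).val.natDegree := by
      rw [Isogeny.natDegree_comp]
      have h0 : ν.val.natDegree ≠ 0 := fun h0 => not_isUnit_of_degree_eq_prime hp hν
        (isIso_of_natDegree_eq_zero h0).degree_eq_one
      omega
    obtain ⟨χ', ν', η', n, h1, h2, rfl⟩ := ih _ hlt η rfl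
    refine ⟨χ', ν'.comp ν, η', n + 1, ?_, h2, Isogeny.comp_assoc _ _ _⟩
    rw [Isogeny.degree_comp, h1, hν, pow_succ']
  · refine ⟨ψ, mulBy _ one_ne_zero, μ, 0, ?_, isCoprime_span_singleton_of_not_dvd hp h,
      (comp_mulBy_one μ).symm⟩
    rw [pow_zero, degree_eq_one_iff]
    exact ⟨1, one_ne_zero, by rw [mulBy_val, map_one, map_one]⟩

/-! ### The graph of `𝔭`-isogenies -/

section Graph

variable {φ : SepModule Fq K Kbar} {p : Fq[X]}

theorem mk_out_eq (v : IsoClass Fq K Kbar) : (⟦v.out⟧ : IsoClass Fq K Kbar) = v :=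
  Quotient.out_eq v

theorem IsRankTwoNonCM.of_mk_mem (hφ : IsRankTwoNonCM φ) {𝔭 : Ideal Fq[X]} {ψ : SepModule Fq K Kbar}
    (h : (⟦ψ⟧ : IsoClass Fq K Kbar) ∈ pIsogenyClass 𝔭 φ) : IsRankTwoNonCM ψ := by
  obtain ⟨n, μ, -⟩ := mk_mem_pIsogenyClass_iff.mp h
  obtain ⟨η⟩ := nonempty_isogeny_symm ⟨μ⟩
  exact hφ.of_isogeny η

theorem IsRankTwoNonCM.out (hφ : IsRankTwoNonCM φ) {𝔭 : Ideal Fq[X]} (v : pIsogenyClass 𝔭 φ) :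
    IsRankTwoNonCM v.1.out :=
  hφ.of_mk_mem (by rw [mk_out_eq]; exact v.2)

theorem pEdge_iff {𝔭 : Ideal Fq[X]} {v w : IsoClass Fq K Kbar} :
    PEdge 𝔭 v w ↔ ∃ μ : SepIsogeny v.out w.out, μ.degree = 𝔭 := by
  rw [← pEdge_mk_iff, mk_out_eq, mk_out_eq]

/-- The graph of `𝔭`-isogenies on the set `I_𝔭`, for `𝔭 = (p)`. -/
def isogenyGraph (hφ : IsRankTwoNonCM φ) (hp : Prime p) :
    SimpleGraph (pIsogenyClass (Ideal.span {p}) φ) where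
  Adj v w := PEdge (Ideal.span {p}) v.1 w.1
  symm := ⟨fun v w h => by
    obtain ⟨μ, hμ⟩ := pEdge_iff.mp h
    obtain ⟨η, hη, -⟩ := exists_dual_of_degree (hφ.out v).1 hp.ne_zero hμ
    exact pEdge_iff.mpr ⟨η, hη⟩⟩
  loopless := ⟨fun v h => by
    obtain ⟨μ, hμ⟩ := pEdge_iff.mp h
    exact degree_ne_prime_of_isIso (hφ.out v).1 (hφ.out v).2 hp
      (θ := mulBy _ one_ne_zero) ⟨1, one_ne_zero, by rw [mulBy_val, map_one, map_one]⟩ μ hμ⟩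

theorem isogenyGraph_adj (hφ : IsRankTwoNonCM φ) (hp : Prime p)
    {v w : pIsogenyClass (Ideal.span {p}) φ} : (isogenyGraph hφ hp).Adj v w ↔
      ∃ μ : SepIsogeny v.1.out w.1.out, μ.degree = Ideal.span {p} := pEdge_iff

theorem eq_of_isIso_out {𝔭 : Ideal Fq[X]} {v w : pIsogenyClass 𝔭 φ}
    {θ : SepIsogeny v.1.out w.1.out} (hθ : θ.IsIso) : v = w := by
  refine Subtype.ext ?_
  rw [← mk_out_eq v.1, ← mk_out_eq w.1]
  exact mk_eq_mk_iff.mpr ⟨θ, hθ⟩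

/-- Two `𝔭`-isogenies between the same vertices are equivalent. -/
theorem isEquivalent_of_degree_eq (hp : Prime p) {ψ χ ψ' χ' : SepModule Fq K Kbar}
    (hψ : IsRankTwoNonCM ψ) {μ : SepIsogeny ψ χ} {μ' : SepIsogeny ψ' χ'}
    (h : (⟦ψ⟧ : IsoClass Fq K Kbar) = ⟦ψ'⟧) (h' : (⟦χ⟧ : IsoClass Fq K Kbar) = ⟦χ'⟧)
    (hμ : μ.degree = Ideal.span {p}) (hμ' : μ'.degree = Ideal.span {p}) :
    μ.IsEquivalent μ' := by
  obtain ⟨ν, hν⟩ := mk_eq_mk_iff.mp h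
  obtain ⟨l, hl⟩ := mk_eq_mk_iff.mp h'
  have h1 : (l.comp μ).degree = Ideal.span {p} := by rw [hl.degree_comp_left, hμ]
  have h2 : (μ'.comp ν).degree = Ideal.span {p} := by rw [hν.degree_comp_right, hμ']
  obtain ⟨c, hc, hu, e⟩ := (isReduced_of_degree_eq_prime hψ.1 hp h1).exists_isUnit hψ.2
    (isReduced_of_degree_eq_prime hψ.1 hp h2)
  have hiso : (mulBy (overKbar χ) hc).IsIso :=
    isIso_mulBy (by rw [← μ.rank_eq, hψ.1]; exact two_pos) hc hu
  refine ⟨ν, l.comp (mulBy _ hc), hν, isIso_comp hiso hl, ?_⟩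
  have e1 : μ'.comp ν = (l.comp (mulBy _ hc)).comp μ := by
    rw [e, Isogeny.comp_assoc, Isogeny.comp_assoc, comp_mulBy]
  exact congrArg val e1

/-- A path of length `n` gives a reduced isogeny `μ` of degree `𝔭 ^ n`. If `μ` starts with a
`𝔭`-isogeny to a vertex `u`, then `u` lies on the path; this is what keeps the isogeny reduced when
the path is extended. -/
theorem exists_isReduced_of_isPath (hφ : IsRankTwoNonCM φ) (hp : Prime p)
    {v w : pIsogenyClass (Ideal.span {p}) φ} (q : (isogenyGraph hφ hp).Walk v w)
    (hq : q.IsPath) :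
    ∃ μ : SepIsogeny v.1.out w.1.out, μ.IsReduced ∧ μ.degree = Ideal.span {p} ^ q.length ∧
      ∀ (u : pIsogenyClass (Ideal.span {p}) φ) (η : SepIsogeny v.1.out u.1.out)
        (μ' : SepIsogeny u.1.out w.1.out), η.degree = Ideal.span {p} → μ = μ'.comp η →
          u ∈ q.support := by
  induction q with
  | nil =>
    rename_i v
    have hiso : (mulBy (overKbar v.1.out) one_ne_zero).IsIso :=
      isIso_mulBy (by rw [(hφ.out v).1]; exact two_pos) _ isUnit_one
    refine ⟨mulBy _ one_ne_zero, ?_, ?_, fun u η μ' hη e => ?_⟩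
    · intro a ha μ' e
      have h1 := congrArg Isogeny.degree e
      rw [degree_comp_mulBy (by rw [(hφ.out v).1]; exact two_pos), hiso.degree_eq_one,
        (hφ.out v).1, pow_two, mul_assoc] at h1
      rw [← Ideal.span_singleton_eq_top, ← Ideal.isUnit_iff]
      exact IsUnit.of_mul_eq_one _ h1.symm
    · rw [hiso.degree_eq_one, SimpleGraph.Walk.length_nil, pow_zero]
    · have h1 := congrArg Isogeny.degree e
      rw [Isogeny.degree_comp, hiso.degree_eq_one, hη] at h1
      exact absurd (IsUnit.of_mul_eq_one _ h1.symm) (prime_span_singleton hp).not_isUnit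
  | cons h q ih =>
    rename_i v t w
    rw [SimpleGraph.Walk.cons_isPath_iff] at hq
    obtain ⟨μ, hμ, hdeg, hsupp⟩ := ih hq.1
    obtain ⟨ν, hν⟩ := (isogenyGraph_adj hφ hp).mp h
    have hred : (μ.comp ν).IsReduced := by
      refine (isReduced_comp_or_exists_factor (hφ.out v).1 hp hν hdeg).resolve_right ?_
      rintro ⟨η, μ', hη, e⟩
      exact hq.2 (hsupp v η μ' hη e)
    refine ⟨μ.comp ν, hred, ?_, fun u η μ' hη e => ?_⟩
    · rw [Isogeny.degree_comp, hdeg, hν, SimpleGraph.Walk.length_cons, pow_succ']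
    · suffices hu : t = u by
        rw [← hu, SimpleGraph.Walk.support_cons]
        exact List.mem_cons_of_mem _ q.start_mem_support
      -- the `𝔭`-isogeny at the beginning is unique up to isomorphism
      by_cases hker : ν.ker = η.ker
      · obtain ⟨θ, hθ, -⟩ := exists_isIso_of_ker_eq hker
        exact eq_of_isIso_out hθ
      · exfalso
        -- two different kernels span the `𝔭`-torsion, which would be killed by a reduced isogeny
        have h1 : ν.ker ≤ (μ.comp ν).ker := fun x hx => by
          rw [mem_ker, toLinearMap_comp, mem_ker.mp hx, map_zero]
        have h2 : η.ker ≤ (μ.comp ν).ker := fun x hx => by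
          rw [e, mem_ker, toLinearMap_comp, mem_ker.mp hx, map_zero]
        obtain ⟨ρ, hρ⟩ := exists_factor
          ((ker_mulBy_le_of_ker_ne (hφ.out v).1 hp hν hη hker).trans (sup_le h1 h2))
        exact hp.not_isUnit (hred p hp.ne_zero ρ hρ)

/-- A cycle without one of its edges is a path of length at least two between neighbours. It would
give a reduced isogeny whose degree is not `𝔭`, next to a `𝔭`-isogeny, which is reduced as well. -/
theorem isogenyGraph_isAcyclic (hφ : IsRankTwoNonCM φ) (hp : Prime p) :
    (isogenyGraph hφ hp).IsAcyclic := by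
  intro v c hc
  cases c with
  | nil => exact SimpleGraph.Walk.not_isCycle_nil hc
  | cons h q =>
    rename_i w
    rw [SimpleGraph.Walk.cons_isCycle_iff] at hc
    obtain ⟨μ, hμ, hdeg, -⟩ := exists_isReduced_of_isPath hφ hp q hc.1
    obtain ⟨ν, hν⟩ := (isogenyGraph_adj hφ hp).mp h.symm
    have hgood := hφ.out w
    have h1 := (isReduced_of_degree_eq_prime hgood.1 hp hν).degree_eq
      (by rw [hgood.1]; exact two_pos) hgood.2 hμ
    have hne := (prime_span_singleton hp)
    have hlen : q.length = 1 := by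
      rw [hdeg, hν] at h1
      refine le_antisymm ?_ ?_
      · refine (pow_dvd_pow_iff hne.ne_zero hne.not_isUnit).mp ?_
        rw [h1, pow_one]
      · refine (pow_dvd_pow_iff hne.ne_zero hne.not_isUnit).mp ?_
        rw [h1, pow_one]
    refine hc.2 ?_
    cases q with
    | nil => simp at hlen
    | cons h' q' =>
      cases q' with
      | nil => simp [Sym2.eq_swap]
      | cons h'' q'' => simp at hlen

/-- The class of `φ` as a vertex of the graph. -/
def baseVertex (𝔭 : Ideal Fq[X]) (φ : SepModule Fq K Kbar) : pIsogenyClass 𝔭 φ :=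
  ⟨⟦φ⟧, mk_mem_pIsogenyClass_iff.mpr ⟨0, Isogeny.refl _, by
    rw [pow_zero, degree_eq_one_iff]
    exact ⟨1, one_ne_zero, (map_one _).symm⟩⟩⟩

/-- A `𝔭 ^ n`-isogeny is a composite of `𝔭`-isogenies. -/
theorem isogenyGraph_reachable (hφ : IsRankTwoNonCM φ) (hp : Prime p) (n : ℕ) :
    ∀ (v : pIsogenyClass (Ideal.span {p}) φ) (ψ : SepModule Fq K Kbar) (_ : ⟦ψ⟧ = v.1)
      (μ : SepIsogeny ψ φ), μ.degree = Ideal.span {p} ^ n →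
        (isogenyGraph hφ hp).Reachable v (baseVertex _ φ) := by
  induction n with
  | zero =>
    intro v ψ hψ μ hμ
    rw [pow_zero, degree_eq_one_iff] at hμ
    have : v = baseVertex _ φ :=
      Subtype.ext (hψ.symm.trans (mk_eq_mk_iff.mpr ⟨μ, hμ⟩))
    rw [this]
  | succ n ih =>
    intro v ψ hψ μ hμ
    obtain ⟨χ, ν, η, hν, rfl⟩ := exists_isogeny_factor_of_dvd hp μ (hμ ▸ dvd_pow_self _ (by simp))
    rw [Isogeny.degree_comp, hν, pow_succ'] at hμ
    have hη := mul_left_cancel₀ (prime_span_singleton hp).ne_zero hμ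
    let w : pIsogenyClass (Ideal.span {p}) φ :=
      ⟨⟦χ⟧, mk_mem_pIsogenyClass_iff.mpr ⟨n, η, hη⟩⟩
    have hadj : (isogenyGraph hφ hp).Adj v w := by
      change PEdge _ v.1 ⟦χ⟧
      rw [← hψ, pEdge_mk_iff]
      exact ⟨ν, hν⟩
    exact hadj.reachable.trans (ih w χ rfl η hη)

theorem isogenyGraph_isTree (hφ : IsRankTwoNonCM φ) (hp : Prime p) : (isogenyGraph hφ hp).IsTree := by
  have hbase : ∀ v, (isogenyGraph hφ hp).Reachable v (baseVertex _ φ) := by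
    intro v
    obtain ⟨ψ, hψ, n, μ, hμ⟩ := v.2
    exact isogenyGraph_reachable hφ hp n v ψ hψ μ hμ
  have : Nonempty (pIsogenyClass (Ideal.span {p}) φ) := ⟨baseVertex _ φ⟩
  exact ⟨⟨fun v w => (hbase v).trans (hbase w).symm⟩, isogenyGraph_isAcyclic hφ hp⟩

/-- The neighbours of a vertex `ψ` correspond to the lines in the `𝔭`-torsion of `ψ`, a vector
space of dimension two over the residue field. -/
theorem ncard_neighborSet (hφ : IsRankTwoNonCM φ) (hp : Prime p)
    (v : pIsogenyClass (Ideal.span {p}) φ) :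
    ((isogenyGraph hφ hp).neighborSet v).ncard = Nat.card (Fq[X] ⧸ Ideal.span {p}) + 1 := by
  have hgood := hφ.out v
  have hmax : (Ideal.span {p}).IsMaximal :=
    PrincipalIdealRing.isMaximal_of_irreducible hp.irreducible
  let k := Fq[X] ⧸ Ideal.span {p}
  let : Field k := Ideal.Quotient.field _
  let V := Submodule.torsionBy Fq[X] (overKbar v.1.out).Points p
  have hmemV : ∀ x : V, p • x.1 = 0 := fun x => (Submodule.mem_torsionBy_iff _ _).mp x.2
  have hsmul : ∀ (a : Fq[X]) (x : V), (Ideal.Quotient.mk (Ideal.span {p}) a : k) • x = a • x :=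
    fun a x => rfl
  have hVker : V = (mulBy (overKbar v.1.out) hp.ne_zero).ker := by
    ext x
    rw [Submodule.mem_torsionBy_iff, mem_ker, toLinearMap_mulBy]
  have hfinV : Finite V := by rw [hVker]; infer_instance
  have hfink : Module.Finite Fq k := finite_quotient (by simpa using hp.ne_zero)
  have hfink' : Finite k := Module.finite_of_finite Fq
  have hcardk : Nat.card k = Fintype.card Fq ^ p.natDegree := by
    rw [Module.natCard_eq_pow_finrank (K := Fq), Nat.card_eq_fintype_card,
      finrank_quotient_span_eq_natDegree]
  have hcardV : Nat.card V = Nat.card k ^ 2 := by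
    rw [hVker, natCard_ker, mulBy_val, natDegree_toAlgHom _ (by rw [hgood.1]; exact two_pos)
      hp.ne_zero, hgood.1, hcardk, ← pow_mul, mul_comm]
  have hrank : Module.finrank k V = 2 := by
    have h1 := Module.natCard_eq_pow_finrank (K := k) (V := V)
    rw [hcardV] at h1
    exact (Nat.pow_right_injective (Finite.one_lt_card (α := k)) h1).symm
  -- the quotient of the Drinfeld module by a line
  have hex : ∀ x : Projectivization k V, ∃ (w : (isogenyGraph hφ hp).neighborSet v)
      (ν : SepIsogeny v.1.out w.1.1.out), ν.degree = Ideal.span {p} ∧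
        ν.ker = Submodule.span Fq[X] {x.rep.1} := by
    intro x
    obtain ⟨χ, ν, hν, hker⟩ := exists_isogeny_of_torsion (x := x.rep.1) hp
      (fun h => x.rep_nonzero (Subtype.ext h)) (hmemV x.rep)
    obtain ⟨n, μ, hμ⟩ := mk_mem_pIsogenyClass_iff.mp
      (show (⟦v.1.out⟧ : IsoClass Fq K Kbar) ∈ pIsogenyClass (Ideal.span {p}) φ by
        rw [mk_out_eq]; exact v.2)
    obtain ⟨η, hη, -⟩ := exists_dual_of_degree hgood.1 hp.ne_zero hν
    obtain ⟨θ, hθ⟩ := mk_eq_mk_iff.mp (mk_out_eq (⟦χ⟧ : IsoClass Fq K Kbar)).symm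
    have hν' : (θ.comp ν).degree = Ideal.span {p} := by rw [hθ.degree_comp_left, hν]
    let w : pIsogenyClass (Ideal.span {p}) φ := ⟨⟦χ⟧, mk_mem_pIsogenyClass_iff.mpr
      ⟨n + 1, μ.comp η, by rw [Isogeny.degree_comp, hη, hμ, pow_succ']⟩⟩
    refine ⟨⟨w, (isogenyGraph_adj hφ hp).mpr ⟨θ.comp ν, hν'⟩⟩, θ.comp ν, hν', ?_⟩
    have hx : x.rep.1 ∈ (θ.comp ν).ker := by
      have h1 : x.rep.1 ∈ ν.ker := hker ▸ Submodule.mem_span_singleton_self _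
      rw [mem_ker, toLinearMap_comp, mem_ker.mp h1, map_zero]
    exact ker_eq_span_singleton hp hν' hx fun h => x.rep_nonzero (Subtype.ext h)
  choose f ν hν hker using hex
  rw [← Projectivization.card_of_finrank_two k V hrank, ← Nat.card_coe_set_eq]
  refine (Nat.card_congr (Equiv.ofBijective f ⟨fun x y hxy => ?_, fun w => ?_⟩)).symm
  · obtain ⟨ν', hν', hker'⟩ : ∃ ν' : SepIsogeny v.1.out (f y).1.1.out,
        ν'.degree = Ideal.span {p} ∧ ν'.ker = Submodule.span Fq[X] {x.rep.1} := by
      rw [← hxy]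
      exact ⟨ν x, hν x, hker x⟩
    obtain ⟨c, hc, hu, e⟩ := (isReduced_of_degree_eq_prime hgood.1 hp hν').exists_isUnit hgood.2
      (isReduced_of_degree_eq_prime hgood.1 hp (hν y))
    have h1 : x.rep.1 ∈ (ν y).ker := by
      have h2 : x.rep.1 ∈ ν'.ker := hker' ▸ Submodule.mem_span_singleton_self _
      rw [e, mem_ker, toLinearMap_comp, toLinearMap_mulBy, map_smul, mem_ker.mp h2, smul_zero]
    rw [hker, Submodule.mem_span_singleton] at h1
    obtain ⟨a, ha⟩ := h1
    rw [← x.mk_rep, ← y.mk_rep, Projectivization.mk_eq_mk_iff']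
    exact ⟨Ideal.Quotient.mk _ a, (hsmul a y.rep).trans (Subtype.ext ha)⟩
  · obtain ⟨μ, hμ⟩ := (isogenyGraph_adj hφ hp).mp w.2
    obtain ⟨x, hx, hx0⟩ := exists_ne_zero_of_degree_ne_one (not_isUnit_of_degree_eq_prime hp hμ)
    have hpx : p • x = 0 :=
      smul_eq_zero_of_mem_degree (by rw [hμ]; exact Ideal.mem_span_singleton_self p) hx
    let x' : V := ⟨x, (Submodule.mem_torsionBy_iff _ _).mpr hpx⟩
    have hx'0 : x' ≠ 0 := fun h => hx0 (congrArg Subtype.val h)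
    let P : Projectivization k V := Projectivization.mk k x' hx'0
    obtain ⟨a, ha⟩ : ∃ a : k, a • x' = P.rep := by
      obtain ⟨a, ha⟩ := Projectivization.exists_smul_eq_mk_rep k x' hx'0
      exact ⟨a, ha⟩
    obtain ⟨b, rfl⟩ := Ideal.Quotient.mk_surjective a
    have hb : b • x = P.rep.1 := congrArg Subtype.val ((hsmul b x').symm.trans ha)
    have hrep : P.rep.1 ∈ μ.ker := by rw [← hb]; exact μ.ker.smul_mem b hx
    refine ⟨P, Subtype.ext ?_⟩
    have hkereq : (ν P).ker = μ.ker := by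
      rw [hker, ker_eq_span_singleton hp hμ hrep fun h => P.rep_nonzero (Subtype.ext h)]
    obtain ⟨θ, hθ, -⟩ := exists_isIso_of_ker_eq hkereq
    exact eq_of_isIso_out hθ

end Graph

end Drinfeld

namespace Drinfeld

open DrinfeldModule Isogeny

variable {Fq : Type*} [Field Fq] [Fintype Fq]
variable {K : Type*} [Field K] [Algebra (RatFunc Fq) K]
variable {Kbar : Type*} [Field Kbar] [Algebra K Kbar] [Algebra (RatFunc Fq) Kbar]
  [IsScalarTower (RatFunc Fq) K Kbar]

/-! ### The projection to the `𝔭`-isogeny class -/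

/-- Some reduced isogeny `φ → ψ` factors through `ψ'`, with an isogeny `φ → ψ'` of degree a power
of `𝔭 = (p)` and an isogeny `ψ' → ψ` of degree prime to `𝔭`. -/
def HasReducedFactor (p : Fq[X]) (φ ψ ψ' : SepModule Fq K Kbar) : Prop :=
  ∃ (n : ℕ) (μ : SepIsogeny φ ψ') (η : SepIsogeny ψ' ψ), μ.degree = Ideal.span {p} ^ n ∧
    IsCoprime η.degree (Ideal.span {p}) ∧ (η.comp μ).IsReduced

variable [IsAlgClosed Kbar]

section Projection

variable {φ : SepModule Fq K Kbar} {p : Fq[X]}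

theorem IsRankTwoNonCM.rank_pos (hφ : IsRankTwoNonCM φ) : 0 < (overKbar φ).rank := by
  rw [hφ.1]
  exact two_pos

theorem exists_hasReducedFactor (hφ : IsRankTwoNonCM φ) (hp : Prime p) {ψ : SepModule Fq K Kbar}
    (h : Nonempty (SepIsogeny φ ψ)) : ∃ ψ', HasReducedFactor p φ ψ ψ' := by
  obtain ⟨μ, hμ⟩ := exists_isReduced hφ.rank_pos h
  obtain ⟨χ, ν, η, n, h1, h2, rfl⟩ := exists_pPart hp μ
  exact ⟨χ, n, ν, η, h1, h2, hμ⟩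

theorem HasReducedFactor.of_iso {ψ χ ψ' χ' : SepModule Fq K Kbar}
    (h : HasReducedFactor p φ ψ ψ') (e : (⟦ψ⟧ : IsoClass Fq K Kbar) = ⟦χ⟧)
    (e' : (⟦ψ'⟧ : IsoClass Fq K Kbar) = ⟦χ'⟧) : HasReducedFactor p φ χ χ' := by
  obtain ⟨n, μ, η, hμ, hη, hred⟩ := h
  obtain ⟨θ, hθ⟩ := mk_eq_mk_iff.mp e
  obtain ⟨θ', hθ'⟩ := mk_eq_mk_iff.mp e'
  obtain ⟨ρ, hρ, hρθ, -⟩ := hθ'.exists_inverse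
  refine ⟨n, θ'.comp μ, θ.comp (η.comp ρ), ?_, ?_, ?_⟩
  · rw [hθ'.degree_comp_left, hμ]
  · rwa [hθ.degree_comp_left, hρ.degree_comp_right]
  · have h1 : (θ.comp (η.comp ρ)).comp (θ'.comp μ) = θ.comp (η.comp μ) := by
      rw [Isogeny.comp_assoc, Isogeny.comp_assoc, ← Isogeny.comp_assoc ρ, hρθ, mulBy_one_comp]
    rw [h1]
    exact hred.iso_comp hθ

/-- The intermediate Drinfeld module of a reduced isogeny is unique, because reduced isogenies with
the same source and target differ by a unit of `𝔽_q[T]`. -/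
theorem HasReducedFactor.mk_eq (hφ : IsRankTwoNonCM φ) {ψ χ ψ' χ' : SepModule Fq K Kbar}
    (h : HasReducedFactor p φ ψ ψ') (h' : HasReducedFactor p φ χ χ')
    (e : (⟦ψ⟧ : IsoClass Fq K Kbar) = ⟦χ⟧) : (⟦ψ'⟧ : IsoClass Fq K Kbar) = ⟦χ'⟧ := by
  obtain ⟨n, μ, η, hμ, hη, hred⟩ := h.of_iso e rfl
  obtain ⟨m, μ', η', hμ', hη', hred'⟩ := h'
  obtain ⟨c, hc, hu, e⟩ := hred.exists_isUnit hφ.2 hred'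
  rw [Isogeny.comp_assoc] at e
  refine mk_eq_mk_iff.mpr (exists_isIso_of_comp_eq (n := n) e.symm ?_ hμ' hη hη')
  rw [(isIso_mulBy hφ.rank_pos hc hu).degree_comp_right, hμ]

/-- Since primitive isogenies are reduced and unique up to units, factoring one of them is the same
as factoring all of them, and the exponent of `𝔭` is `δ_𝔭(φ, ψ)` automatically. -/
theorem isPPart_iff (hφ : IsRankTwoNonCM φ) (hp : Prime p) {ψ ψ' : SepModule Fq K Kbar}
    (h : Nonempty (SepIsogeny φ ψ)) :
    IsPPart (Ideal.span {p}) (overKbar φ) (overKbar ψ) (overKbar ψ') ↔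
      HasReducedFactor p φ ψ ψ' := by
  constructor
  · intro hP
    obtain ⟨μ, hμ⟩ := exists_isReduced hφ.rank_pos h
    obtain ⟨μ', η, e, h1, h2⟩ := hP μ (hμ.isPrimitive hφ.rank_pos hφ.2)
    refine ⟨_, μ', η, h1, h2, ?_⟩
    rwa [← show μ = η.comp μ' from ext_val e]
  · rintro ⟨n, μ', η, h1, h2, hred⟩ μ hμ
    obtain ⟨c, hc, hu, rfl⟩ := hred.exists_isUnit hφ.2 (hμ.isReduced hφ.rank_pos)
    refine ⟨μ'.comp (mulBy _ hc), η, congrArg val (Isogeny.comp_assoc _ _ _), ?_, h2⟩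
    rw [(isIso_mulBy hφ.rank_pos hc hu).degree_comp_right, h1,
      hred.delta_eq hφ.1 hφ.2 hp h1 h2]

theorem HasReducedFactor.mk_mem_pIsogenyClass (hφ : IsRankTwoNonCM φ) {ψ ψ' : SepModule Fq K Kbar}
    (h : HasReducedFactor p φ ψ ψ') :
    (⟦ψ'⟧ : IsoClass Fq K Kbar) ∈ pIsogenyClass (Ideal.span {p}) φ := by
  obtain ⟨n, μ, -, hμ, -⟩ := h
  obtain ⟨η, hη⟩ := exists_dual_degree_eq hφ.1 μ
  exact mk_mem_pIsogenyClass_iff.mpr ⟨n, η, hη.trans hμ⟩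

/-- A reduced isogeny from `φ` to a vertex of the graph has degree a power of `𝔭`, so that every
vertex is its own projection. -/
theorem hasReducedFactor_self (hφ : IsRankTwoNonCM φ) (hp : Prime p) {ψ : SepModule Fq K Kbar}
    (h : (⟦ψ⟧ : IsoClass Fq K Kbar) ∈ pIsogenyClass (Ideal.span {p}) φ) :
    HasReducedFactor p φ ψ ψ := by
  have hψ := hφ.of_mk_mem h
  obtain ⟨n, ν, hν⟩ := mk_mem_pIsogenyClass_iff.mp h
  obtain ⟨ν', hν'⟩ := exists_dual_degree_eq hψ.1 ν
  obtain ⟨μ, hμ⟩ := exists_isReduced hφ.rank_pos ⟨ν'⟩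
  obtain ⟨c, hc, e⟩ := hμ.exists_eq_comp_mulBy hφ.2 ν'
  have hdvd : μ.degree ∣ Ideal.span {p} ^ n := by
    rw [← hν, ← hν', e, degree_comp_mulBy hφ.rank_pos]
    exact dvd_mul_left _ _
  obtain ⟨m, -, hm⟩ := (dvd_prime_pow (prime_span_singleton hp) n).mp hdvd
  have hiso : (mulBy (overKbar ψ) one_ne_zero).IsIso :=
    isIso_mulBy hψ.rank_pos _ isUnit_one
  refine ⟨m, μ, mulBy _ one_ne_zero, associated_iff_eq.mp hm, ?_, ?_⟩
  · rw [hiso.degree_eq_one]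
    exact isCoprime_one_left
  · rwa [mulBy_one_comp]

theorem exists_isogeny_of_mem (v : isogenyClass φ) {ψ : SepModule Fq K Kbar} (h : ⟦ψ⟧ = v.1) :
    Nonempty (SepIsogeny φ ψ) :=
  nonempty_isogeny_symm (mk_mem_isogenyClass_iff.mp (h ▸ v.2))

/-- The projection from the isogeny class of `φ` to the set of vertices of the graph. -/
theorem exists_projection (hφ : IsRankTwoNonCM φ) (hp : Prime p) :
    ∃ π : isogenyClass φ → pIsogenyClass (Ideal.span {p}) φ,
      ∀ (v : isogenyClass φ) (ψ ψ' : SepModule Fq K Kbar), ⟦ψ⟧ = v.1 →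
        (HasReducedFactor p φ ψ ψ' ↔ ⟦ψ'⟧ = (π v).1) := by
  have hex : ∀ v : isogenyClass φ, ∃ ψ', HasReducedFactor p φ v.1.out ψ' := fun v =>
    exists_hasReducedFactor hφ hp (exists_isogeny_of_mem v (mk_out_eq v.1))
  choose f hf using hex
  refine ⟨fun v => ⟨⟦f v⟧, (hf v).mk_mem_pIsogenyClass hφ⟩, fun v ψ ψ' hψ => ⟨fun h => ?_, fun h => ?_⟩⟩
  · exact h.mk_eq hφ (hf v) (hψ.trans (mk_out_eq v.1).symm)
  · exact (hf v).of_iso ((mk_out_eq v.1).trans hψ.symm) h.symm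

theorem mem_isogenyClass_of_mem_pIsogenyClass {𝔭 : Ideal Fq[X]} (w : pIsogenyClass 𝔭 φ) :
    w.1 ∈ isogenyClass φ := by
  obtain ⟨ψ, hψ, n, μ, -⟩ := w.2
  exact ⟨ψ, hψ, ⟨μ⟩⟩

/-- The length of a path between the projections of `ψ₁` and `ψ₂` is the exponent of `𝔭` in the
degree of a primitive isogeny `ψ₁ → ψ₂`. Composing a primitive isogeny between two modules with
isogenies of degree prime to `𝔭` gives a multiple of the primitive isogeny between the other two
modules, so this exponent does not change when `ψ₁` and `ψ₂` are replaced by their projections. -/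
theorem length_eq_delta (hφ : IsRankTwoNonCM φ) (hp : Prime p)
    {ψ₁ ψ₂ : SepModule Fq K Kbar} {w₁ w₂ : pIsogenyClass (Ideal.span {p}) φ}
    (h₁ : HasReducedFactor p φ ψ₁ w₁.1.out) (h₂ : HasReducedFactor p φ ψ₂ w₂.1.out)
    (hψ : IsRankTwoNonCM ψ₁) {ν : SepIsogeny ψ₁ ψ₂} (hν : ν.IsPrimitive)
    (q : (isogenyGraph hφ hp).Walk w₁ w₂) (hq : q.IsPath) :
    q.length = delta (Ideal.span {p}) (overKbar ψ₁) (overKbar ψ₂) := by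
  obtain ⟨-, -, η₁, -, hη₁, -⟩ := h₁
  obtain ⟨-, -, η₂, -, hη₂, -⟩ := h₂
  obtain ⟨ρ₁, hρ₁⟩ := exists_dual_degree_eq (hφ.out w₁).1 η₁
  obtain ⟨ρ₂, hρ₂⟩ := exists_dual_degree_eq (hφ.out w₂).1 η₂
  obtain ⟨μ, hμ, hdeg, -⟩ := exists_isReduced_of_isPath hφ hp q hq
  have hg := hν.isGreatest_delta hψ.1 hψ.2 hp
  refine le_antisymm (hg.2 ?_) ?_
  · exact hμ.pow_dvd_degree (hφ.out w₁).1 (hφ.out w₁).2 hdeg.symm.dvd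
      hη₁ (hρ₂ ▸ hη₂) ν
  · have h := (hν.isReduced hψ.rank_pos).pow_dvd_degree hψ.1 hψ.2 hg.1 (hρ₁ ▸ hη₁) hη₂ μ
    rw [hdeg] at h
    exact (pow_dvd_pow_iff (prime_span_singleton hp).ne_zero
      (prime_span_singleton hp).not_isUnit).mp h

end Projection

end Drinfeld

end

theorem mainTheorem5 {Fq : Type*} [Field Fq] [Fintype Fq]
    {K : Type*} [Field K] [Algebra (RatFunc Fq) K]
    {Kbar : Type*} [Field Kbar] [Algebra K Kbar] [IsAlgClosure K Kbar]
    [Algebra (RatFunc Fq) Kbar] [IsScalarTower (RatFunc Fq) K Kbar]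
    (φ : SepModule Fq K Kbar) (hrank : φ.rank = 2) (hvirt : IsVirtuallyRational φ)
    (hCM : ¬ φ.HasCM)
    (𝔭 : Ideal Fq[X]) (h𝔭 : 𝔭.IsPrime) (h𝔭0 : 𝔭 ≠ ⊥) :
    ∃ G : SimpleGraph (pIsogenyClass 𝔭 φ),
      -- the edges of `G` are exactly the `𝔭`-isogenies (in particular, these form an undirected
      -- graph without loops), and there are no multiple edges
      (∀ v w : pIsogenyClass 𝔭 φ, G.Adj v w ↔ PEdge 𝔭 v.1 w.1) ∧
      (∀ (ψ χ ψ' χ' : SepModule Fq K Kbar) (μ : SepIsogeny ψ χ) (μ' : SepIsogeny ψ' χ'),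
        (⟦ψ⟧ : IsoClass Fq K Kbar) ∈ pIsogenyClass 𝔭 φ →
        (⟦ψ⟧ : IsoClass Fq K Kbar) = ⟦ψ'⟧ → (⟦χ⟧ : IsoClass Fq K Kbar) = ⟦χ'⟧ →
        μ.degree = 𝔭 → μ'.degree = 𝔭 → μ.IsEquivalent μ') ∧
      G.IsTree ∧
      (∀ v, (G.neighborSet v).ncard = Nat.card (Fq[X] ⧸ 𝔭) + 1) ∧
      -- the projection `π` from `I` onto `I_𝔭`
      ∃ π : isogenyClass φ → pIsogenyClass 𝔭 φ, Function.Surjective π ∧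
        (∀ (v : isogenyClass φ) (ψ ψ' : SepModule Fq K Kbar), ⟦ψ⟧ = v.1 →
          (IsPPart 𝔭 (overKbar φ) (overKbar ψ) (overKbar ψ') ↔
            ⟦ψ'⟧ = (π v).1)) ∧
        ∀ (v₁ v₂ : isogenyClass φ) (ψ₁ ψ₂ : SepModule Fq K Kbar), ⟦ψ₁⟧ = v₁.1 → ⟦ψ₂⟧ = v₂.1 →
          -- `δ_𝔭(ψ₁, ψ₂)` can be computed from any primitive isogeny, and one exists
          (∃ μ : SepIsogeny ψ₁ ψ₂, μ.IsPrimitive) ∧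
          (∀ μ : SepIsogeny ψ₁ ψ₂, μ.IsPrimitive → IsGreatest {n : ℕ | 𝔭 ^ n ∣ μ.degree}
            (delta 𝔭 (overKbar ψ₁) (overKbar ψ₂))) ∧
          ∀ p : G.Walk (π v₁) (π v₂), p.IsPath →
            p.length = delta 𝔭 (overKbar ψ₁) (overKbar ψ₂) := by
  have hclosed : IsAlgClosed Kbar := IsAlgClosure.isAlgClosed K
  obtain ⟨p, rfl⟩ : ∃ p, 𝔭 = Ideal.span {p} :=
    (IsPrincipalIdealRing.principal 𝔭).principal
  have hp0 : p ≠ 0 := by simpa using h𝔭0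
  have hp : Prime p := (Ideal.span_singleton_prime hp0).mp h𝔭
  have hφ : IsRankTwoNonCM φ :=
    ⟨(rank_overKbar φ).trans hrank, hasTrivialEnd_overKbar (by omega) hCM⟩
  obtain ⟨π, hπ⟩ := exists_projection hφ hp
  have hout : ∀ (v : isogenyClass φ) (ψ : SepModule Fq K Kbar), ⟦ψ⟧ = v.1 →
      HasReducedFactor p φ ψ (π v).1.out := fun v ψ hψ =>
    (hπ v ψ _ hψ).mpr (mk_out_eq (π v).1)
  refine ⟨isogenyGraph hφ hp, fun _ _ => Iff.rfl, ?_, isogenyGraph_isTree hφ hp,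
    ncard_neighborSet hφ hp, π, fun w => ?_, fun v ψ ψ' hψ => ?_, fun v₁ v₂ ψ₁ ψ₂ h₁ h₂ => ?_⟩
  · intro ψ χ ψ' χ' μ μ' hψ h h' hμ hμ'
    exact isEquivalent_of_degree_eq hp (hφ.of_mk_mem hψ) h h' hμ hμ'
  · refine ⟨⟨w.1, mem_isogenyClass_of_mem_pIsogenyClass w⟩, Subtype.ext ?_⟩
    have hw : (⟦w.1.out⟧ : IsoClass Fq K Kbar) = w.1 := mk_out_eq w.1
    have hself := hasReducedFactor_self hφ hp (ψ := w.1.out) (by rw [hw]; exact w.2)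
    exact ((hπ ⟨w.1, mem_isogenyClass_of_mem_pIsogenyClass w⟩ _ _ hw).mp hself).symm.trans hw
  · exact (isPPart_iff hφ hp (exists_isogeny_of_mem v hψ)).trans (hπ v ψ ψ' hψ)
  · obtain ⟨μ₁⟩ := exists_isogeny_of_mem v₁ h₁
    obtain ⟨μ₂⟩ := exists_isogeny_of_mem v₂ h₂
    obtain ⟨ρ⟩ := nonempty_isogeny_symm ⟨μ₁⟩
    have hψ := hφ.of_isogeny μ₁
    obtain ⟨ν, hν⟩ := Isogeny.exists_isReduced hψ.rank_pos ⟨μ₂.comp ρ⟩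
    have hν' := hν.isPrimitive hψ.rank_pos hψ.2
    exact ⟨⟨ν, hν'⟩, fun μ hμ => hμ.isGreatest_delta hψ.1 hψ.2 hp, fun q hq =>
      length_eq_delta hφ hp (hout v₁ ψ₁ h₁) (hout v₂ ψ₂ h₂) hψ hν' q hq⟩
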